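/- Let $M=\mathcal H_1\cup\mathcal H_2$ be a Heegaard splitting of genus $g$ of a closed orientable 3-manifold, i.e. $\mathcal H_1,\mathcal H_2$ are closed subsets that are handlebodies of genus $g$ and meet exactly in their common boundary surface $\Sigma_g=\mathcal H_1\cap\mathcal H_2$. Let $\bigvee^g S^1$ be the bouquet of $g$ circles of length one, and let $f=(f_1,f_2):\Sigma_g\to(\bigvee^g S^1)\times(\bigvee^g S^1)$ be a Stallings map for this splitting, i.e. a continuous map such that, for $i=1,2$, $f_i$ is homotopic to the inclusion $\Sigma_g\hookrightarrow\mathcal H_i$ followed by a homotopy equivalence $\mathcal H_i\to\bigvee^g S^1$. Suppose that $f$ is locally injective. Let $S\to\Sigma_g$ be the connected cover corresponding to $\ker\big(f_*:\pi_1(\Sigma_g)\to\pi_1(\bigvee^g S^1\times\bigvee^g S^1)\big)$, let $T_1,T_2$ be universal covers of $\bigvee^g S^1$ (trees with all edges of length one), and let $\hat f=(\hat f_1,\hat f_2):S\to T_1\times T_2$ be a lift of $f$. Fix $s_0\in S$ with image $\sigma_0\in\Sigma_g$. A class $\alpha\in\pi_1(\Sigma_g,\sigma_0)$ acts on $T_i$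 by the deck transformation determined by $f_{i*}(\alpha)$, namely the one that sends $\hat f_i(s_0)$ to the end point of the lift of $f_i\circ\alpha$ starting at $\hat f_i(s_0)$. A direction in a tree is a connected component of the complement of a point, and a quadrant is a product $\delta_1\times\delta_2$ of a direction $\delta_1\subseteq T_1$ and a direction $\delta_2\subseteq T_2$. Fix any base point $(t_1,t_2)\in T_1\times T_2$. A quadrant $Q$ is heavy if there is a sequence $(\gamma_n)$ in $\pi_1(\Sigma_g,\sigma_0)$ with $(\gamma_n t_1,\gamma_n t_2)\in Q$ for all $n$ and $d_{T_i}(t_i,\gamma_n t_i)\to\infty$ for $i=1,2$; otherwise it is light. The Guirardel core of the two actions is the complement in $T_1\times T_2$ of the union of all light quadrants. Then the Guirardel core is the smallest (with respect to inclusion) subset $X\subseteq T_1\times T_2$ such that $\hat f(S)\subseteq X$, the fibre $X\cap p_1^{-1}(t)$ is connected for every $t\in T_1$, and the fibre $X\cap p_2^{-1}(t)$ is connected for every $t\in T_2$, where $p_1,p_2$ are the coordinate projections of $T_1\times T_2$. In particular the core itself has these properties. -/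

import Mathlib

open Set Filter Topology
open scoped ENNReal unitInterval

noncomputable section

/-! ### Handlebodies and Heegaard splittings -/

/-- A closed round disc in the plane with `g` disjoint open round discs removed from its interior. -/
def holedDisc (g : ℕ) : Set ℂ :=
  {z | ‖z‖ ≤ 3 * (g : ℝ) + 3 ∧ ∀ k : Fin g, 1 ≤ ‖z - 3 * ((k : ℕ) : ℂ)‖}

/-- The standard (orientable, three-dimensional) handlebody of genus `g`: a thickened disc with
`g` holes, that is, a closed `3`-ball with `g` one-handles attached. Its boundary surface is its
frontier in `ℂ × ℝ`, a closed orientable surface of genus `g`. -/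
def handlebody (g : ℕ) : Set (ℂ × ℝ) :=
  holedDisc g ×ˢ Icc (0 : ℝ) 1

/-- The subset `H` of `M` is a handlebody of genus `g` with boundary surface `B ⊆ H`. -/
def IsHandlebodyWithBoundary {M : Type*} [TopologicalSpace M] (g : ℕ) (H B : Set M) : Prop :=
  B ⊆ H ∧ ∃ φ : H ≃ₜ handlebody g,
    ∀ x : H, (φ x : ℂ × ℝ) ∈ frontier (handlebody g) ↔ (x : M) ∈ B

/-- `M = H₁ ∪ H₂` is a Heegaard splitting of genus `g`: the two closed sets `H₁` and `H₂` are
handlebodies of genus `g` and they meet exactly in their common boundary surface `H₁ ∩ H₂`.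
A space `M` with such a decomposition is automatically a closed orientable `3`-manifold, so
nothing else is required of `M`. -/
structure IsHeegaardSplitting {M : Type*} [TopologicalSpace M] (g : ℕ) (H₁ H₂ : Set M) :
    Prop where
  isClosed_left : IsClosed H₁
  isClosed_right : IsClosed H₂
  union_eq : H₁ ∪ H₂ = univ
  handlebody_left : IsHandlebodyWithBoundary g H₁ (H₁ ∩ H₂)
  handlebody_right : IsHandlebodyWithBoundary g H₂ (H₁ ∩ H₂)

/-! ### Bouquets of circles and Stallings maps -/

/-- The bouquet of `g` circles of length one, as the union of the coordinate circles in the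
`g`-dimensional torus: at most one coordinate differs from the wedge point `0`. -/
def bouquet (g : ℕ) : Set (Fin g → UnitAddCircle) :=
  {x | ∀ i j, x i ≠ 0 → x j ≠ 0 → i = j}

/-- The first coordinate of a map to a product. -/
def firstCoord {X Y Z : Type*} [TopologicalSpace X] [TopologicalSpace Y] [TopologicalSpace Z]
    (f : C(X, Y × Z)) : C(X, Y) :=
  ContinuousMap.fst.comp f

/-- The second coordinate of a map to a product. -/
def secondCoord {X Y Z : Type*} [TopologicalSpace X] [TopologicalSpace Y] [TopologicalSpace Z]
    (f : C(X, Y × Z)) : C(X, Z) :=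
  ContinuousMap.snd.comp f

/-- `f` is a Stallings map for the splitting `H₁ ∪ H₂`: it goes from the splitting surface
`H₁ ∩ H₂` to a product of two bouquets of `g` circles, and each of its coordinates is homotopic to
the inclusion of the surface in the handlebody followed by a homotopy equivalence from that
handlebody to the bouquet. -/
def IsStallingsMap {M : Type*} [TopologicalSpace M] (g : ℕ) (H₁ H₂ : Set M)
    (f : C(↥(H₁ ∩ H₂), bouquet g × bouquet g)) : Prop :=
  (∃ h : ContinuousMap.HomotopyEquiv H₁ (bouquet g),
    (firstCoord f).Homotopic (h.toFun.comp (ContinuousMap.inclusion inter_subset_left))) ∧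
  (∃ h : ContinuousMap.HomotopyEquiv H₂ (bouquet g),
    (secondCoord f).Homotopic (h.toFun.comp (ContinuousMap.inclusion inter_subset_right)))

/-! ### The universal cover of a bouquet as a tree with a group action -/

/-- The path metric on a covering space `T` of the bouquet for which every edge has length one:
the infimum of the lengths of the paths joining `x` to `y`, lengths being measured in the
bouquet. -/
def treeEDist {g : ℕ} {T : Type*} [TopologicalSpace T] (q : T → bouquet g) (x y : T) : ℝ≥0∞ :=
  ⨅ c : Path x y, eVariationOn (fun s : I => q (c s)) univ

/-- The deck transformation of a universal cover `q : T → B` given by a class `α` of loops at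
`b`, relative to a point `t₀` over `b`. It sends `t₀` to the end point `t₁` of the lift of `α`
starting at `t₀`, and it sends `t` to the end point of the lift starting at `t₁` of the projection
of a path from `t₀` to `t` (as `T` is simply connected, the path does not matter). -/
def deckTransformation {T B : Type*} [TopologicalSpace T] [TopologicalSpace B]
    [SimplyConnectedSpace T] {q : T → B} (hq : IsCoveringMap q) {b : B} (t₀ : q ⁻¹' {b})
    (α : FundamentalGroup B b) (t : T) : T :=
  hq.liftPath ((PathConnectedSpace.somePath (t₀ : T) t).map hq.continuous).toContinuousMap
    (hq.monodromy α t₀ : T)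
    (by
      have h1 : q (hq.monodromy α t₀ : T) = b := (hq.monodromy α t₀).2
      have h0 : q (t₀ : T) = b := t₀.2
      simp [h0, h1]) 1

/-! ### The Guirardel core -/

/-- A direction in a tree: a connected component of the complement of a point. -/
def IsDirection {T : Type*} [TopologicalSpace T] (δ : Set T) : Prop :=
  ∃ x y : T, y ≠ x ∧ δ = connectedComponentIn {x}ᶜ y

/-- A quadrant: the product of a direction in each of the two trees. -/
def IsQuadrant {T₁ T₂ : Type*} [TopologicalSpace T₁] [TopologicalSpace T₂]
    (Q : Set (T₁ × T₂)) : Prop :=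
  ∃ (δ₁ : Set T₁) (δ₂ : Set T₂), IsDirection δ₁ ∧ IsDirection δ₂ ∧ Q = δ₁ ×ˢ δ₂

/-- The set `Q` is heavy with respect to the base point `t`: infinitely far in both trees it
contains translates of `t`. Here `G` acts on the trees by `a₁` and `a₂`, and `d₁`, `d₂` are the
distances of the trees. -/
def IsHeavy {G T₁ T₂ : Type*} (a₁ : G → T₁ → T₁) (a₂ : G → T₂ → T₂)
    (d₁ : T₁ → T₁ → ℝ≥0∞) (d₂ : T₂ → T₂ → ℝ≥0∞) (t : T₁ × T₂) (Q : Set (T₁ × T₂)) : Prop :=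
  ∃ γ : ℕ → G, (∀ n, (a₁ (γ n) t.1, a₂ (γ n) t.2) ∈ Q) ∧
    Tendsto (fun n => d₁ t.1 (a₁ (γ n) t.1)) atTop (𝓝 ⊤) ∧
    Tendsto (fun n => d₂ t.2 (a₂ (γ n) t.2)) atTop (𝓝 ⊤)

/-- The Guirardel core: the complement of the union of the light (not heavy) quadrants. -/
def guirardelCore {G T₁ T₂ : Type*} [TopologicalSpace T₁] [TopologicalSpace T₂]
    (a₁ : G → T₁ → T₁) (a₂ : G → T₂ → T₂)
    (d₁ : T₁ → T₁ → ℝ≥0∞) (d₂ : T₂ → T₂ → ℝ≥0∞) (t : T₁ × T₂) : Set (T₁ × T₂) :=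
  (⋃₀ {Q | IsQuadrant Q ∧ ¬ IsHeavy a₁ a₂ d₁ d₂ t Q})ᶜ

end

/-!
# The Guirardel core of a Heegaard splitting with a locally injective Stallings map

Let `S` be the cover of the splitting surface, `F = (F₁, F₂)` its map to the product of the two
trees, and call a component of the complement of a point in a tree a direction at that point.
The theorem combines three facts.

*The image of `F` lies in the core*: every quadrant `δ₁ × δ₂` that contains a point `F s` is heavy.
Let `y₁`, `y₂` be the vertices of the quadrant. At `F s` exactly one leg of each tree points
towards `yᵢ`, and moving along any other leg increases the distance to `yᵢ`. So it is enough that a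
small disc in the surface around the image of `s` has a point whose image leaves along other legs
in both trees at once (`exists_escape_legs`). If there were none, then the signed coordinates `x`,
`y` of an injective map from a disc to a product of two stars would satisfy `min x y ≤ 0`
throughout; this is excluded by a planar degree argument (`exists_pos_of_injective_disc`): on the
level sets of the coordinates injectivity produces a logarithm, which extends, by Tietze's theorem,
to a nowhere vanishing extension to the disc of the identity of its boundary circle. As the surface
is compact, the gain of distance is uniform away from `y₁` and `y₂`, so it can be iterated
(`exists_far`); as the orbit of the base point is coarsely dense in the image of `F`, it enters the
quadrant arbitrarily far out.

*The fibres of the core are connected.* They are complements of unions of directions in one tree,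
and removing a direction from a connected set leaves a connected set
(`isPreconnected_compl_sUnion_directions`). They are not empty because `F₁` and `F₂` are surjective:
the surface is surjective on fundamental groups onto each handlebody
(`IsHandlebodyWithBoundary.map_surjective`), so the image of `Fᵢ` contains a whole fibre of the
universal cover, and every direction meets every fibre (`IsDirection.exists_proj_eq`).

*The core is minimal.* Let `A` be a set with connected fibres that contains the image of `F` but not
`(a, b)`. The fibres of `A` over `a` and `b` lie in directions `δ₂` at `b` and `δ₁` at `a`. The set
of the `s` with `F s ∈ δ₁ᶜ × δ₂ᶜ` is then open and closed in `S`, and it is empty. Hence the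
quadrant made of directions opposite to `δ₁` and `δ₂` contains `(a, b)` and is light
(`exists_light_quadrant`).

That the trees are trees enters through `exists_arc_side`: an open arc separates a simply connected
space, since collapsing its complement to a point gives a map to a circle, which lifts to the line.
-/

/-! ### Logarithms on plane sets and a planar maximum principle -/

/-- The identity of the plane set `A` has a continuous logarithm. -/
def HasLog (A : Set ℂ) : Prop :=
  ∃ l : ℂ → ℂ, ContinuousOn l A ∧ ∀ z ∈ A, Complex.exp (l z) = z

theorem hasLog_empty : HasLog ∅ := ⟨id, continuousOn_empty _, by simp⟩

theorem HasLog.mono {A B : Set ℂ} (h : HasLog B) (hAB : A ⊆ B) : HasLog A := by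
  obtain ⟨l, hl, he⟩ := h
  exact ⟨l, hl.mono hAB, fun z hz => he z (hAB hz)⟩

theorem HasLog.union {A B : Set ℂ} (hA : IsClosed A) (hB : IsClosed B) (hlA : HasLog A)
    (hlB : HasLog B) (hAB : (A ∩ B).Subsingleton) : HasLog (A ∪ B) := by
  classical
  obtain ⟨a, ha, hae⟩ := hlA
  obtain ⟨b, hb, hbe⟩ := hlB
  -- the two logarithms agree on the common point after a shift by a multiple of `2πi`
  obtain ⟨k, hk, hab⟩ : ∃ k : ℂ, Complex.exp k = 1 ∧ ∀ z ∈ A ∩ B, a z = b z + k := by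
    rcases (A ∩ B).eq_empty_or_nonempty with h | ⟨c, hc⟩
    · exact ⟨0, by simp, by simp [h]⟩
    · refine ⟨a c - b c, ?_, fun z hz => ?_⟩
      · rw [Complex.exp_sub, hae c hc.1, hbe c hc.2, div_self]
        rw [← hae c hc.1]
        exact Complex.exp_ne_zero _
      · rw [hAB hz hc]
        ring
  refine ⟨fun z => if z ∈ A then a z else b z + k, ?_, ?_⟩
  · refine ContinuousOn.union_of_isClosed ?_ ?_ hA hB
    · exact ha.congr fun z hz => by simp [hz]
    · refine (hb.add (continuousOn_const (c := k))).congr fun z hz => ?_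
      by_cases hzA : z ∈ A
      · simp [hzA, hab z ⟨hzA, hz⟩]
      · simp [hzA]
  · intro z hz
    by_cases hzA : z ∈ A
    · simp [hzA, hae z hzA]
    · simp [hzA, Complex.exp_add, hk, hbe z (hz.resolve_left hzA)]

theorem hasLog_biUnion {ι : Type*} (s : Finset ι) (C : ι → Set ℂ) (P : Set ℂ)
    (hP : P.Subsingleton) (hC : ∀ i ∈ s, IsClosed (C i)) (hl : ∀ i ∈ s, HasLog (C i))
    (hCP : ∀ i ∈ s, ∀ j ∈ s, i ≠ j → C i ∩ C j ⊆ P) : HasLog (⋃ i ∈ s, C i) := by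
  classical
  induction s using Finset.induction_on with
  | empty => simpa using hasLog_empty
  | insert i s hi ih =>
    rw [Finset.set_biUnion_insert]
    refine HasLog.union (hC i (by simp)) ?_ (hl i (by simp)) ?_ ?_
    · exact isClosed_biUnion_finset fun j hj => hC j (by simp [hj])
    · exact ih (fun j hj => hC j (by simp [hj])) (fun j hj => hl j (by simp [hj]))
        fun j hj k hk => hCP j (by simp [hj]) k (by simp [hk])
    · refine hP.anti ?_
      rw [inter_iUnion₂]
      refine iUnion₂_subset fun j hj => hCP i (by simp) j (by simp [hj]) ?_
      rintro rfl
      exact hi hj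

theorem hasLog_of_subset_ball {A : Set ℂ} {c : ℂ} (hA : A ⊆ Metric.ball c ‖c‖) : HasLog A := by
  rcases eq_or_ne c 0 with rfl | hc
  · have : A = ∅ := by simpa using hA
    rw [this]
    exact hasLog_empty
  have key : ∀ z ∈ A, z / c ∈ Complex.slitPlane := fun z hz => by
    refine Complex.ball_one_subset_slitPlane ?_
    have := hA hz
    rw [mem_ball_iff_norm] at this ⊢
    rw [div_sub_one hc, norm_div, div_lt_one (norm_pos_iff.2 hc)]
    exact this
  refine ⟨fun z => Complex.log (z / c) + Complex.log c, ?_, fun z hz => ?_⟩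
  · exact ((continuousOn_id.div_const c).clog key).add continuousOn_const
  · rw [Complex.exp_add, Complex.exp_log (Complex.slitPlane_ne_zero (key z hz)),
      Complex.exp_log hc, div_mul_cancel₀ _ hc]

/-- A compact subset of the punctured plane that embeds in the line carries a continuous
logarithm: cut it into short pieces that meet in single points. -/
theorem hasLog_of_injOn {A : Set ℂ} (hA : IsCompact A) (h0 : (0 : ℂ) ∉ A) {y : ℂ → ℝ}
    (hy : ContinuousOn y A) (hinj : InjOn y A) : HasLog A := by
  rcases A.eq_empty_or_nonempty with rfl | hne
  · exact hasLog_empty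
  obtain ⟨c, hcA, hc⟩ := hA.exists_isMinOn hne continuous_norm.continuousOn
  have hc0 : 0 < ‖c‖ := norm_pos_iff.2 fun h => h0 (h ▸ hcA)
  obtain ⟨δ, hδ, hδA⟩ : ∃ δ > 0, ∀ z ∈ A, ∀ w ∈ A, |y z - y w| < δ → ‖z - w‖ < ‖c‖ := by
    have hK : IsCompact ((A ×ˢ A) ∩ {p : ℂ × ℂ | ‖c‖ ≤ ‖p.1 - p.2‖}) :=
      (hA.prod hA).inter_right (isClosed_le continuous_const (by fun_prop))
    rcases ((A ×ˢ A) ∩ {p : ℂ × ℂ | ‖c‖ ≤ ‖p.1 - p.2‖}).eq_empty_or_nonempty with h | h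
    · refine ⟨1, one_pos, fun z hz w hw _ => ?_⟩
      by_contra! hcon
      have : (z, w) ∈ (A ×ˢ A) ∩ {p : ℂ × ℂ | ‖c‖ ≤ ‖p.1 - p.2‖} := ⟨⟨hz, hw⟩, hcon⟩
      simp [h] at this
    · have hcont : ContinuousOn (fun p : ℂ × ℂ => |y p.1 - y p.2|)
          ((A ×ˢ A) ∩ {p : ℂ × ℂ | ‖c‖ ≤ ‖p.1 - p.2‖}) := by
        refine ContinuousOn.abs (ContinuousOn.sub ?_ ?_)
        · exact hy.comp continuousOn_fst fun p hp => hp.1.1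
        · exact hy.comp continuousOn_snd fun p hp => hp.1.2
      obtain ⟨p, hp, hmin⟩ := hK.exists_isMinOn h hcont
      refine ⟨|y p.1 - y p.2|, ?_, fun z hz w hw hzw => ?_⟩
      · refine abs_pos.2 (sub_ne_zero.2 fun h => ?_)
        have h' := hinj hp.1.1 hp.1.2 h
        have := hp.2
        simp only [mem_ofPred_eq, h', sub_self, norm_zero] at this
        linarith
      · by_contra! hcon
        exact absurd (hmin (show (z, w) ∈ _ from ⟨⟨hz, hw⟩, hcon⟩)) (not_le.2 hzw)
  obtain ⟨m, hm⟩ := (hA.image_of_continuousOn hy).bddBelow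
  obtain ⟨N, hN⟩ := (hA.image_of_continuousOn hy).bddAbove
  have hcl : ∀ s : Set ℝ, IsClosed s → IsClosed (A ∩ y ⁻¹' s) := fun s hs =>
    hy.preimage_isClosed_of_isClosed hA.isClosed hs
  have key : ∀ n : ℕ, HasLog (A ∩ y ⁻¹' Iic (m - 1 + n * (δ / 2))) := by
    intro n
    induction n with
    | zero =>
      refine hasLog_empty.mono ?_
      rintro z ⟨hz, hz'⟩
      have := hm (mem_image_of_mem y hz)
      simp at hz'
      linarith
    | succ n ih =>
      have hstep : HasLog (A ∩ y ⁻¹' Icc (m - 1 + n * (δ / 2)) (m - 1 + (n + 1 : ℕ) * (δ / 2))) := by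
        rcases (A ∩ y ⁻¹' Icc (m - 1 + n * (δ / 2))
          (m - 1 + (n + 1 : ℕ) * (δ / 2))).eq_empty_or_nonempty with h | ⟨w, hw, hw'⟩
        · rw [h]
          exact hasLog_empty
        · refine hasLog_of_subset_ball (c := w) fun z hz => ?_
          rw [mem_ball_iff_norm]
          refine (hδA z hz.1 w hw ?_).trans_le (hc hw)
          have h1 := hz.2
          simp only [mem_preimage, mem_Icc] at h1 hw'
          push_cast at h1 hw'
          rw [abs_lt]
          constructor <;> linarith
      refine (HasLog.union (hcl _ isClosed_Iic) (hcl _ isClosed_Icc) ih hstep ?_).mono ?_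
      · rintro z hz w hw
        refine hinj hz.1.1 hw.1.1 ?_
        have h1 := hz.1.2
        have h2 := hz.2.2.1
        have h3 := hw.1.2
        have h4 := hw.2.2.1
        simp only [mem_preimage, mem_Iic] at h1 h3
        linarith
      · rintro z ⟨hz, hz'⟩
        rcases le_total (y z) (m - 1 + n * (δ / 2)) with h | h
        · exact Or.inl ⟨hz, h⟩
        · exact Or.inr ⟨hz, h, hz'⟩
  obtain ⟨n, hn⟩ := exists_nat_ge ((N - m + 1) / (δ / 2))
  refine (key n).mono fun z hz => ⟨hz, ?_⟩
  have := hN (mem_image_of_mem y hz)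
  rw [div_le_iff₀ (by positivity)] at hn
  simp only [mem_preimage, mem_Iic]
  linarith

/-- The identity of the unit circle does not extend to a zero-free map on the closed disc. -/
theorem exists_eq_zero_of_eqOn_sphere {H : ℂ → ℂ} (hH : ContinuousOn H (Metric.closedBall 0 1))
    (hS : ∀ z : ℂ, ‖z‖ = 1 → H z = z) : ∃ z ∈ Metric.closedBall (0 : ℂ) 1, H z = 0 := by
  by_contra! hne
  -- compose with the radial retraction of the plane onto the disc
  let ρ : ℂ → ℂ := fun z => ((max 1 ‖z‖)⁻¹ : ℝ) * z
  have hρ : Continuous ρ := by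
    have : Continuous fun z : ℂ => (max 1 ‖z‖)⁻¹ :=
      (continuous_const.max continuous_norm).inv₀ fun z => by positivity
    fun_prop
  have hρm : ∀ z, ρ z ∈ Metric.closedBall (0 : ℂ) 1 := fun z => by
    have h1 : 0 < max 1 ‖z‖ := by positivity
    simp only [ρ, mem_closedBall_zero_iff, norm_mul, Complex.norm_real, norm_inv, Real.norm_eq_abs,
      abs_of_pos h1]
    rw [inv_mul_le_iff₀ h1]
    simp
  let F : C(ℂ, {z : ℂ // z ≠ 0}) :=
    ⟨fun z => ⟨H (ρ z), hne _ (hρm z)⟩, Continuous.subtype_mk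
      (hH.comp_continuous hρ hρm) _⟩
  have hF1 : F 1 = ⟨Complex.exp 0, Complex.exp_ne_zero _⟩ := by
    apply Subtype.ext
    simp [F, ρ, hS 1 (by simp)]
  obtain ⟨L, ⟨hL1, hL⟩, -⟩ := Complex.isCoveringMap_exp.existsUnique_continuousMap_lifts F 1 0
    hF1.symm
  have hexp : ∀ θ : ℝ, Complex.exp (L (Complex.exp (θ * Complex.I))) =
      Complex.exp (θ * Complex.I) := fun θ => by
    have h := congrArg Subtype.val (congrFun hL (Complex.exp (θ * Complex.I)))
    have hn : ‖Complex.exp (θ * Complex.I)‖ = 1 := Complex.norm_exp_ofReal_mul_I θ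
    simp only [Function.comp_apply, F, ContinuousMap.coe_mk] at h
    rw [h]
    simp only [ρ, hn, max_self, inv_one, Complex.ofReal_one, one_mul]
    exact hS _ hn
  have heq : (fun θ : ℝ => L (Complex.exp (θ * Complex.I))) = fun θ : ℝ => (θ : ℂ) * Complex.I := by
    refine Complex.isCoveringMap_exp.eq_of_comp_eq (by fun_prop) (by fun_prop) ?_ 0 ?_
    · funext θ
      exact Subtype.ext (hexp θ)
    · simp [hL1]
  have h := congrFun heq (2 * Real.pi)
  simp only [Complex.ofReal_mul, Complex.ofReal_ofNat, Complex.exp_two_pi_mul_I, hL1] at h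
  have hpi : (Real.pi : ℂ) ≠ 0 := by exact_mod_cast Real.pi_ne_zero
  simp [hpi] at h

theorem isClosed_level {D : Set ℂ} (hD : IsClosed D) {x y : ℂ → ℝ} (hx : ContinuousOn x D)
    (hy : ContinuousOn y D) (ε : ℝ) :
    IsClosed {z ∈ D | x z ≤ y z ∧ x z = -max 0 (ε - |y z|)} := by
  have h1 : IsClosed (D ∩ (fun z => y z - x z) ⁻¹' Ici 0) :=
    (hy.sub hx).preimage_isClosed_of_isClosed hD isClosed_Ici
  have h2 : IsClosed (D ∩ (fun z => x z + max 0 (ε - |y z|)) ⁻¹' {0}) := by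
    refine ContinuousOn.preimage_isClosed_of_isClosed ?_ hD isClosed_singleton
    exact hx.add (continuousOn_const.sup (continuousOn_const.sub hy.abs))
  convert h1.inter h2 using 1
  ext z
  simp only [mem_inter_iff, mem_ofPred_eq, mem_preimage, mem_Ici, mem_singleton_iff,
    sub_nonneg, eq_neg_iff_add_eq_zero]
  tauto

/-- A level curve `x = -ψ(y)` in the disc, where `x ≤ y`, has a logarithm: the coordinate `y`
embeds it in a star with legs `C j`. -/
theorem hasLog_level {α β ι : Type*} [Finite ι] {D : Set ℂ} (hD : IsCompact D)
    {x y : ℂ → ℝ} (hx : ContinuousOn x D) (hy : ContinuousOn y D) {ax : ℂ → α} {ay : ℂ → β}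
    (hinj : ∀ z ∈ D, ∀ w ∈ D, ax z = ax w → ay z = ay w → z = w)
    (hx_in : ∀ z ∈ D, ∀ w ∈ D, x z = x w → x z ≤ 0 → ax z = ax w)
    (hy_in : ∀ z ∈ D, ∀ w ∈ D, y z = y w → y z ≤ 0 → ay z = ay w)
    (C : ι → Set ℂ) (hC : ∀ i, IsClosed (C i)) (hcov : ∀ z ∈ D, 0 ≤ y z → ∃ i, z ∈ C i)
    (hC_inj : ∀ i, ∀ z ∈ D ∩ C i, ∀ w ∈ D ∩ C i, y z = y w → 0 ≤ y z → ay z = ay w)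
    (hC_disj : ∀ i j, i ≠ j → ∀ z ∈ D, z ∈ C i → z ∈ C j → y z = 0)
    {ε : ℝ} (hε : 0 < ε) (hx0 : x 0 = 0) (hy0 : y 0 = 0) :
    HasLog {z ∈ D | x z ≤ y z ∧ x z = -max 0 (ε - |y z|)} := by
  classical
  have := Fintype.ofFinite ι
  set Λ := {z ∈ D | x z ≤ y z ∧ x z = -max 0 (ε - |y z|)} with hΛ
  have hΛc : IsClosed Λ := isClosed_level hD.isClosed hx hy ε
  have hy' : ∀ s, IsClosed s → IsClosed (Λ ∩ y ⁻¹' s) := fun s hs =>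
    (hy.mono fun z hz => hz.1).preimage_isClosed_of_isClosed hΛc hs
  have h0Λ : (0 : ℂ) ∉ Λ := by
    rintro ⟨-, -, h⟩
    rw [hx0, hy0] at h
    simp [hε.le] at h
    exact hε.ne' h
  have hle : ∀ z ∈ Λ, x z ≤ 0 := fun z hz => by
    rw [hz.2.2]
    simp
  have hax : ∀ z ∈ Λ, ∀ w ∈ Λ, y z = y w → ax z = ax w := fun z hz w hw h =>
    hx_in z hz.1 w hw.1 (by rw [hz.2.2, hw.2.2, h]) (hle z hz)
  have hyΛ : ContinuousOn y Λ := hy.mono fun z hz => hz.1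
  have hin : HasLog (Λ ∩ y ⁻¹' Iic 0) := by
    refine hasLog_of_injOn (hD.of_isClosed_subset (hy' _ isClosed_Iic) fun z hz => hz.1.1)
      (fun h => h0Λ h.1) (hyΛ.mono inter_subset_left) fun z hz w hw h => ?_
    exact hinj z hz.1.1 w hw.1.1 (hax z hz.1 w hw.1 h) (hy_in z hz.1.1 w hw.1.1 h hz.2)
  have hP : (Λ ∩ y ⁻¹' {0}).Subsingleton := fun z hz w hw => by
    have h : y z = y w := hz.2.trans hw.2.symm
    exact hinj z hz.1.1 w hw.1.1 (hax z hz.1 w hw.1 h) (hy_in z hz.1.1 w hw.1.1 h hz.2.le)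
  have hcl : ∀ i, IsClosed ((Λ ∩ y ⁻¹' Ici 0) ∩ C i) := fun i => (hy' _ isClosed_Ici).inter (hC i)
  have hout : HasLog (⋃ i ∈ (Finset.univ : Finset ι), (Λ ∩ y ⁻¹' Ici 0) ∩ C i) := by
    refine hasLog_biUnion _ _ _ hP (fun i _ => hcl i) (fun i _ => ?_) fun i _ j _ hij => ?_
    · refine hasLog_of_injOn (hD.of_isClosed_subset (hcl i) fun z hz => hz.1.1.1)
        (fun h => h0Λ h.1.1) (hyΛ.mono fun z hz => hz.1.1) fun z hz w hw h => ?_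
      exact hinj z hz.1.1.1 w hw.1.1.1 (hax z hz.1.1 w hw.1.1 h)
        (hC_inj i z ⟨hz.1.1.1, hz.2⟩ w ⟨hw.1.1.1, hw.2⟩ h hz.1.2)
    · rintro z ⟨hz, hz'⟩
      exact ⟨hz.1.1, hC_disj i j hij z hz.1.1.1 hz.2 hz'.2⟩
  refine (HasLog.union (hy' _ isClosed_Iic)
    (isClosed_biUnion_finset fun i _ => hcl i) hin hout (hP.anti ?_)).mono fun z hz => ?_
  · rintro z ⟨hz, hz'⟩
    simp only [mem_iUnion] at hz'
    obtain ⟨i, -, hi⟩ := hz'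
    exact ⟨hz.1, le_antisymm hz.2 hi.1.2⟩
  · rcases le_total (y z) 0 with h | h
    · exact Or.inl ⟨hz, h⟩
    · obtain ⟨i, hi⟩ := hcov z hz.1 h
      exact Or.inr (mem_biUnion (Finset.mem_univ i) ⟨⟨hz, h⟩, hi⟩)

/-- **Planar maximum principle.** A disc cannot be injected into the product of two stars so that
its centre goes to the centre while it avoids the product of all legs other than a chosen one
(along which the coordinate is negative) in each star. The maps to the stars are `ax` and `ay`, with
signed coordinates `x` and `y`; the sets `B i` and `C i` are the preimages of the positive legs. -/
theorem exists_pos_of_injective_disc {α β ι κ : Type*} [Finite ι] [Finite κ]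
    {x y : ℂ → ℝ} (hx : ContinuousOn x (Metric.closedBall 0 1))
    (hy : ContinuousOn y (Metric.closedBall 0 1)) {ax : ℂ → α} {ay : ℂ → β}
    (hinj : ∀ z ∈ Metric.closedBall (0 : ℂ) 1, ∀ w ∈ Metric.closedBall (0 : ℂ) 1,
      ax z = ax w → ay z = ay w → z = w)
    (hx_in : ∀ z ∈ Metric.closedBall (0 : ℂ) 1, ∀ w ∈ Metric.closedBall (0 : ℂ) 1,
      x z = x w → x z ≤ 0 → ax z = ax w)
    (hy_in : ∀ z ∈ Metric.closedBall (0 : ℂ) 1, ∀ w ∈ Metric.closedBall (0 : ℂ) 1,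
      y z = y w → y z ≤ 0 → ay z = ay w)
    (B : κ → Set ℂ) (hB : ∀ i, IsClosed (B i))
    (hB_cov : ∀ z ∈ Metric.closedBall (0 : ℂ) 1, 0 ≤ x z → ∃ i, z ∈ B i)
    (hB_inj : ∀ i, ∀ z ∈ Metric.closedBall (0 : ℂ) 1 ∩ B i,
      ∀ w ∈ Metric.closedBall (0 : ℂ) 1 ∩ B i, x z = x w → 0 ≤ x z → ax z = ax w)
    (hB_disj : ∀ i j, i ≠ j → ∀ z ∈ Metric.closedBall (0 : ℂ) 1, z ∈ B i → z ∈ B j → x z = 0)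
    (C : ι → Set ℂ) (hC : ∀ i, IsClosed (C i))
    (hC_cov : ∀ z ∈ Metric.closedBall (0 : ℂ) 1, 0 ≤ y z → ∃ i, z ∈ C i)
    (hC_inj : ∀ i, ∀ z ∈ Metric.closedBall (0 : ℂ) 1 ∩ C i,
      ∀ w ∈ Metric.closedBall (0 : ℂ) 1 ∩ C i, y z = y w → 0 ≤ y z → ay z = ay w)
    (hC_disj : ∀ i j, i ≠ j → ∀ z ∈ Metric.closedBall (0 : ℂ) 1, z ∈ C i → z ∈ C j → y z = 0)
    (hx0 : x 0 = 0) (hy0 : y 0 = 0) :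
    ∃ z ∈ Metric.closedBall (0 : ℂ) 1, 0 < x z ∧ 0 < y z := by
  classical
  by_contra! hmin
  set D := Metric.closedBall (0 : ℂ) 1 with hDdef
  have hD : IsCompact D := isCompact_closedBall _ _
  have h0D : (0 : ℂ) ∈ D := by simp [hDdef]
  have hpos : ∀ z ∈ D, z ≠ 0 → 0 < |x z| + |y z| := fun z hz hz0 => by
    by_contra! h
    have h1 := abs_nonneg (x z)
    have h2 := abs_nonneg (y z)
    have hxz : x z = 0 := abs_eq_zero.1 (by linarith)
    have hyz : y z = 0 := abs_eq_zero.1 (by linarith)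
    exact hz0 (hinj z hz 0 h0D (hx_in z hz 0 h0D (by rw [hxz, hx0]) hxz.le)
      (hy_in z hz 0 h0D (by rw [hyz, hy0]) hyz.le))
  obtain ⟨ε, hε, hεS⟩ : ∃ ε > 0, ∀ z : ℂ, ‖z‖ = 1 → 2 * ε ≤ |x z| + |y z| := by
    have hS : IsCompact (Metric.sphere (0 : ℂ) 1) := isCompact_sphere _ _
    have hSD : Metric.sphere (0 : ℂ) 1 ⊆ D := Metric.sphere_subset_closedBall
    obtain ⟨w, hw, hwm⟩ := hS.exists_isMinOn ⟨1, by simp⟩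
      ((hx.mono hSD).abs.add (hy.mono hSD).abs)
    have hw0 : w ≠ 0 := by
      rintro rfl
      simp at hw
    have := hpos w (hSD hw) hw0
    refine ⟨(|x w| + |y w|) / 2, by linarith, fun z hz => ?_⟩
    have := hwm (show z ∈ Metric.sphere (0 : ℂ) 1 by simpa using hz)
    simp only [mem_ofPred_eq, Pi.add_apply] at this
    linarith
  -- The set `K` contains the boundary circle but not the centre, and the level set `K ∩ K'` has a
  -- logarithm: the identity of `K` extends to `K'` without zeros.
  have hm : ContinuousOn (fun z => min (x z) (y z)) D := hx.inf hy
  have hψ : ContinuousOn (fun z => max 0 (ε - |max (x z) (y z)|)) D :=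
    continuousOn_const.sup (continuousOn_const.sub (hx.sup hy).abs)
  set K := {z ∈ D | min (x z) (y z) ≤ -max 0 (ε - |max (x z) (y z)|)} with hK
  set K' := {z ∈ D | -max 0 (ε - |max (x z) (y z)|) ≤ min (x z) (y z)} with hK'
  have hKc : IsClosed K := by
    convert (hm.add hψ).preimage_isClosed_of_isClosed hD.isClosed isClosed_Iic (t := Iic 0) using 1
    ext z
    simp only [hK, mem_ofPred_eq, mem_inter_iff, mem_preimage, mem_Iic, Pi.add_apply,
      le_neg_iff_add_nonpos_right]
  have hKc' : IsClosed K' := by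
    convert (hm.add hψ).preimage_isClosed_of_isClosed hD.isClosed isClosed_Ici (t := Ici 0) using 1
    ext z
    simp only [hK', mem_ofPred_eq, mem_inter_iff, mem_preimage, mem_Ici, Pi.add_apply,
      neg_le_iff_add_nonneg]
  have h0K : (0 : ℂ) ∉ K := by
    rintro ⟨-, h⟩
    simp only [hx0, hy0, min_self, max_self, abs_zero, sub_zero, max_eq_right hε.le] at h
    linarith
  have hL : HasLog (K ∩ K') := by
    have h1 := hasLog_level hD hx hy hinj hx_in hy_in C hC hC_cov hC_inj hC_disj hε hx0 hy0
    have h2 := hasLog_level hD hy hx (fun z hz w hw h h' => hinj z hz w hw h' h) hy_in hx_in B hB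
      hB_cov hB_inj hB_disj hε hy0 hx0
    refine (HasLog.union (isClosed_level hD.isClosed hx hy ε)
      (isClosed_level hD.isClosed hy hx ε) h1 h2 ?_).mono ?_
    · -- on the diagonal both coordinates are `-ε / 2`
      have hval : ∀ z, z ∈ {z ∈ D | x z ≤ y z ∧ x z = -max 0 (ε - |y z|)} ∩
          {z ∈ D | y z ≤ x z ∧ y z = -max 0 (ε - |x z|)} → x z = -(ε / 2) ∧ y z = -(ε / 2) := by
        rintro z ⟨⟨-, h1, h2⟩, -, h3, -⟩
        have hxy : x z = y z := le_antisymm h1 h3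
        rw [← hxy] at h2
        have hx0 : x z ≤ 0 := by
          rw [h2]
          simp
        rw [abs_of_nonpos hx0] at h2
        rcases le_total 0 (ε - -x z) with h | h
        · rw [max_eq_right h] at h2
          constructor <;> linarith
        · rw [max_eq_left h] at h2
          linarith
      intro z hz w hw
      obtain ⟨hz1, hz2⟩ := hval z hz
      obtain ⟨hw1, hw2⟩ := hval w hw
      exact hinj z hz.1.1 w hw.1.1 (hx_in z hz.1.1 w hw.1.1 (by rw [hz1, hw1]) (by linarith))
        (hy_in z hz.1.1 w hw.1.1 (by rw [hz2, hw2]) (by linarith))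
    · rintro z ⟨⟨hzD, h1⟩, -, h2⟩
      rcases le_total (x z) (y z) with h | h
      · left
        rw [min_eq_left h, max_eq_right h] at h1 h2
        exact ⟨hzD, h, le_antisymm h1 h2⟩
      · right
        rw [min_eq_right h, max_eq_left h] at h1 h2
        exact ⟨hzD, h, le_antisymm h1 h2⟩
  obtain ⟨l, hl, hle⟩ := hL
  obtain ⟨g, hg⟩ := ContinuousMap.exists_restrict_eq (hKc.inter hKc')
    (⟨(K ∩ K').domRestrict l, continuousOn_iff_continuous_domRestrict.1 hl⟩ : C(↥(K ∩ K'), ℂ))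
  have hgl : ∀ z ∈ K ∩ K', g z = l z := fun z hz => DFunLike.congr_fun hg ⟨z, hz⟩
  have hDK : D ⊆ K ∪ K' := fun z hz => by
    rcases le_total (min (x z) (y z)) (-max 0 (ε - |max (x z) (y z)|)) with h | h
    · exact Or.inl ⟨hz, h⟩
    · exact Or.inr ⟨hz, h⟩
  have hH : ContinuousOn (fun z => if z ∈ K then z else Complex.exp (g z)) D := by
    refine (ContinuousOn.union_of_isClosed ?_ ?_ hKc hKc').mono hDK
    · exact continuousOn_id.congr fun z hz => by simp [hz]
    · refine (Complex.continuous_exp.comp g.continuous).continuousOn.congr fun z hz => ?_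
      by_cases hzK : z ∈ K
      · simp [hzK, hgl z ⟨hzK, hz⟩, hle z ⟨hzK, hz⟩]
      · simp [hzK]
  obtain ⟨z, hzD, hz⟩ := exists_eq_zero_of_eqOn_sphere hH fun z hz => by
    have hzD : z ∈ D := by simp [hDdef, hz]
    have hzK : z ∈ K := by
      refine ⟨hzD, ?_⟩
      have hs := hεS z hz
      have hmn := hmin z hzD
      rcases le_total (x z) (y z) with h | h
      · rw [min_eq_left h, max_eq_right h]
        have hx0 : x z ≤ 0 := by
          by_contra! h'
          linarith [hmn h']
        rw [abs_of_nonpos hx0] at hs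
        rcases le_total 0 (ε - |y z|) with h' | h'
        · rw [max_eq_right h']
          linarith [abs_nonneg (y z)]
        · rw [max_eq_left h']
          linarith
      · rw [min_eq_right h, max_eq_left h]
        have hy0 : y z ≤ 0 := by
          by_contra! h'
          linarith [hmn (h'.trans_le h)]
        rw [abs_of_nonpos hy0] at hs
        rcases le_total 0 (ε - |x z|) with h' | h'
        · rw [max_eq_right h']
          linarith [abs_nonneg (x z)]
        · rw [max_eq_left h']
          linarith
    simp [hzK]
  by_cases hzK : z ∈ K
  · simp only [hzK, if_true] at hz
    exact h0K (hz ▸ hzK)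
  · simp only [hzK, if_false] at hz
    exact Complex.exp_ne_zero _ hz

/-! ### The boundary surface of the standard handlebody -/

theorem isClosed_holedDisc (g : ℕ) : IsClosed (holedDisc g) := by
  have h : holedDisc g = {z : ℂ | ‖z‖ ≤ 3 * (g : ℝ) + 3} ∩
      ⋂ k : Fin g, {z : ℂ | 1 ≤ ‖z - 3 * ((k : ℕ) : ℂ)‖} := by
    ext z
    simp [holedDisc]
  rw [h]
  exact (isClosed_le continuous_norm continuous_const).inter
    (isClosed_iInter fun k => isClosed_le continuous_const (by fun_prop))

theorem isCompact_holedDisc (g : ℕ) : IsCompact (holedDisc g) :=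
  (isCompact_closedBall (0 : ℂ) (3 * (g : ℝ) + 3)).of_isClosed_subset (isClosed_holedDisc g)
    fun z hz => by simpa using hz.1

theorem isClosed_handlebody (g : ℕ) : IsClosed (handlebody g) :=
  (isClosed_holedDisc g).prod isClosed_Icc

theorem isCompact_frontier_handlebody (g : ℕ) : IsCompact (frontier (handlebody g)) :=
  ((isCompact_holedDisc g).prod isCompact_Icc).of_isClosed_subset isClosed_frontier
    (isClosed_handlebody g).frontier_subset

/-- The points of the boundary circles of the holed disc. -/
def holedDiscBoundary (g : ℕ) : Set ℂ :=
  {z | z ∈ holedDisc g ∧ (‖z‖ = 3 * (g : ℝ) + 3 ∨ ∃ k : Fin g, ‖z - 3 * ((k : ℕ) : ℂ)‖ = 1)}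

theorem frontier_holedDisc (g : ℕ) : frontier (holedDisc g) = holedDiscBoundary g := by
  apply Subset.antisymm
  · intro z hz
    have hzm := (isClosed_holedDisc g).frontier_subset hz
    refine ⟨hzm, ?_⟩
    by_contra! hcon
    have hU : IsOpen ({z : ℂ | ‖z‖ < 3 * (g : ℝ) + 3} ∩
        ⋂ k : Fin g, {z : ℂ | 1 < ‖z - 3 * ((k : ℕ) : ℂ)‖}) :=
      (isOpen_lt continuous_norm continuous_const).inter
        (isOpen_iInter_of_finite fun k => isOpen_lt continuous_const (by fun_prop))
    have hint : z ∈ interior (holedDisc g) := by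
      refine mem_interior.2 ⟨_, ?_, hU, ?_⟩
      · rintro w ⟨hw, hw'⟩
        exact ⟨le_of_lt hw, fun k => le_of_lt (mem_iInter.1 hw' k)⟩
      · exact ⟨lt_of_le_of_ne hzm.1 hcon.1,
          mem_iInter.2 fun k => lt_of_le_of_ne (hzm.2 k) (hcon.2 k).symm⟩
    exact hz.2 hint
  · rintro z ⟨hz, hz'⟩
    rw [frontier_eq_closure_inter_closure]
    refine ⟨subset_closure hz, ?_⟩
    -- move off the holed disc along the radius of the boundary circle
    have key : ∀ (c : ℂ) (s : ℝ), (∀ δ : ℝ, 0 < δ → δ < 1 → c + (1 + s * δ) * (z - c) ∉ holedDisc g) →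
        z ∈ closure (holedDisc g)ᶜ := fun c s h => by
      have hlim : Tendsto (fun δ : ℝ => c + (1 + s * δ) * (z - c)) (𝓝[>] 0) (𝓝 z) := by
        have : Continuous fun δ : ℝ => c + (1 + s * δ) * (z - c) := by fun_prop
        have h0 := (this.tendsto 0).mono_left (nhdsWithin_le_nhds (s := Ioi 0))
        simpa using h0
      refine mem_closure_of_tendsto hlim ?_
      filter_upwards [Ioo_mem_nhdsGT (one_pos : (0 : ℝ) < 1)] with δ hδ
      exact h δ hδ.1 hδ.2
    rcases hz' with h | ⟨k, h⟩
    · refine key 0 1 fun δ hδ hδ1 hcon => ?_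
      have h1 := hcon.1
      have : ‖(1 + (1 : ℝ) * δ : ℂ)‖ = 1 + δ := by
        rw [← Complex.ofReal_mul, ← Complex.ofReal_one, ← Complex.ofReal_add, Complex.norm_real,
          Real.norm_eq_abs, abs_of_pos (by linarith)]
        ring
      rw [zero_add, sub_zero, norm_mul, this, h] at h1
      have : (0 : ℝ) ≤ g := Nat.cast_nonneg g
      nlinarith
    · refine key (3 * ((k : ℕ) : ℂ)) (-1) fun δ hδ hδ1 hcon => ?_
      have h1 := hcon.2 k
      have : ‖(1 + (-1 : ℝ) * δ : ℂ)‖ = 1 - δ := by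
        rw [← Complex.ofReal_mul, ← Complex.ofReal_one, ← Complex.ofReal_add, Complex.norm_real,
          Real.norm_eq_abs, abs_of_pos (by linarith)]
        ring
      rw [add_sub_cancel_left, norm_mul, this, h] at h1
      linarith

theorem mem_frontier_handlebody {g : ℕ} {p : ℂ × ℝ} :
    p ∈ frontier (handlebody g) ↔ (p.1 ∈ holedDisc g ∧ (p.2 = 0 ∨ p.2 = 1)) ∨
      (p.1 ∈ holedDiscBoundary g ∧ p.2 ∈ Icc (0 : ℝ) 1) := by
  rw [handlebody, frontier_prod_eq, frontier_holedDisc, (isClosed_holedDisc g).closure_eq,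
    isClosed_Icc.closure_eq, frontier_Icc (zero_le_one)]
  rfl

theorem three_le_norm_sub {j k : ℕ} (h : j ≠ k) : (3 : ℝ) ≤ ‖3 * (j : ℂ) - 3 * (k : ℂ)‖ := by
  rw [← mul_sub, norm_mul, Complex.norm_ofNat]
  have h1 : (1 : ℝ) ≤ ‖(j : ℂ) - (k : ℂ)‖ := by
    have : ((j : ℂ) - (k : ℂ)) = (((j : ℤ) - (k : ℤ) : ℤ) : ℂ) := by push_cast; rfl
    have hne : (j : ℤ) - (k : ℤ) ≠ 0 := sub_ne_zero.2 (Int.ofNat_inj.not.2 h)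
    have h1 : ((1 : ℤ) : ℝ) ≤ ((|(j : ℤ) - (k : ℤ)| : ℤ) : ℝ) := Int.cast_le.2 (Int.one_le_abs hne)
    rw [this, Complex.norm_intCast]
    simpa only [Int.cast_one, Int.cast_abs] using h1
  linarith

/-- Near a boundary circle with centre `c` the holed disc contains a one-sided annulus. -/
theorem exists_annulus {g : ℕ} {w : ℂ} (hw : w ∈ holedDiscBoundary g) :
    ∃ (c : ℂ) (κ : ℝ), w ≠ c ∧ κ ≠ 0 ∧ |κ| ≤ 1 ∧ ∀ ζ : ℂ, ‖ζ‖ = 1 →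
      c + (w - c) * ζ ∈ holedDiscBoundary g ∧
      ∀ η ∈ Icc (0 : ℝ) (1 / 2), c + (w - c) * ((1 + κ * η : ℝ) * ζ) ∈ holedDisc g := by
  have hg : (0 : ℝ) ≤ g := Nat.cast_nonneg g
  have hk3 : ∀ k : Fin g, ‖3 * ((k : ℕ) : ℂ)‖ ≤ 3 * (g : ℝ) - 3 := fun k => by
    rw [norm_mul, Complex.norm_ofNat, Complex.norm_natCast]
    have : ((k : ℕ) : ℝ) + 1 ≤ g := by exact_mod_cast k.2
    linarith
  rcases hw with ⟨hw, h | ⟨k, h⟩⟩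
  · have hR : (0 : ℝ) < 3 * g + 3 := by linarith
    have hmem : ∀ ζ : ℂ, ‖ζ‖ = 1 → ∀ η ∈ Icc (0 : ℝ) (1 / 2),
        0 + (w - 0) * ((1 + -(1 / (3 * (g : ℝ) + 3)) * η : ℝ) * ζ) ∈ holedDisc g := by
      intro ζ hζ η hη
      have hη' : 1 / (3 * (g : ℝ) + 3) * η ≤ 1 / 2 := by
        rw [one_div_mul_eq_div, div_le_iff₀ hR]
        linarith [hη.2]
      have hn : ‖0 + (w - 0) * ((1 + -(1 / (3 * (g : ℝ) + 3)) * η : ℝ) * ζ)‖ =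
          3 * (g : ℝ) + 3 - η := by
        rw [zero_add, sub_zero, norm_mul, norm_mul, hζ, h, Complex.norm_real, Real.norm_eq_abs,
          abs_of_pos (by linarith)]
        field_simp
        ring
      refine ⟨by rw [hn]; linarith [hη.1], fun k => ?_⟩
      have := norm_sub_norm_le (0 + (w - 0) * ((1 + -(1 / (3 * (g : ℝ) + 3)) * η : ℝ) * ζ))
        (3 * ((k : ℕ) : ℂ))
      rw [hn] at this
      linarith [hk3 k, hη.2]
    refine ⟨0, -(1 / (3 * (g : ℝ) + 3)), ?_, ?_, ?_, fun ζ hζ => ⟨⟨?_, Or.inl ?_⟩, hmem ζ hζ⟩⟩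
    · rintro rfl
      simp at h
      linarith
    · simpa using hR.ne'
    · rw [abs_neg, abs_of_pos (by positivity), div_le_one hR]
      linarith
    · simpa using hmem ζ hζ 0 ⟨le_rfl, by norm_num⟩
    · simp [hζ, h]
  · have hmem : ∀ ζ : ℂ, ‖ζ‖ = 1 → ∀ η ∈ Icc (0 : ℝ) (1 / 2),
        3 * ((k : ℕ) : ℂ) + (w - 3 * ((k : ℕ) : ℂ)) * ((1 + 1 * η : ℝ) * ζ) ∈ holedDisc g := by
      intro ζ hζ η hη
      set v := (w - 3 * ((k : ℕ) : ℂ)) * ((1 + 1 * η : ℝ) * ζ) with hv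
      have hn : ‖v‖ = 1 + η := by
        rw [hv, norm_mul, norm_mul, hζ, h, Complex.norm_real, Real.norm_eq_abs,
          abs_of_pos (by linarith [hη.1])]
        ring
      refine ⟨?_, fun l => ?_⟩
      · have := norm_add_le (3 * ((k : ℕ) : ℂ)) v
        linarith [hk3 k, hη.2]
      · rcases eq_or_ne l k with rfl | hlk
        · rw [add_sub_cancel_left, hn]
          linarith [hη.1]
        · have h3 := three_le_norm_sub (j := (k : ℕ)) (k := (l : ℕ))
            fun h => hlk (Fin.ext h.symm)
          have := norm_sub_norm_le (3 * ((k : ℕ) : ℂ) - 3 * ((l : ℕ) : ℂ)) (-v)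
          rw [norm_neg, hn, sub_neg_eq_add] at this
          rw [add_sub_right_comm]
          linarith [hη.2]
    refine ⟨3 * ((k : ℕ) : ℂ), 1, ?_, one_ne_zero, by simp,
      fun ζ hζ => ⟨⟨?_, Or.inr ⟨k, ?_⟩⟩, hmem ζ hζ⟩⟩
    · rintro rfl
      simp at h
    · simpa using hmem ζ hζ 0 ⟨le_rfl, by norm_num⟩
    · rw [add_sub_cancel_left, norm_mul, hζ, h, one_mul]

/-- Every point of the boundary surface of the handlebody is the centre of an embedded disc. -/
theorem exists_disc_frontier_handlebody {g : ℕ} {p : ℂ × ℝ} (hp : p ∈ frontier (handlebody g)) :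
    ∃ j : ℂ → ℂ × ℝ, ContinuousOn j (Metric.closedBall 0 1) ∧
      InjOn j (Metric.closedBall 0 1) ∧
      MapsTo j (Metric.closedBall 0 1) (frontier (handlebody g)) ∧ j 0 = p := by
  obtain ⟨w, t⟩ := p
  by_cases hw : w ∈ holedDiscBoundary g
  · -- the profile `(η, h)` of the surface across the circle turns the corner at `t = 0, 1`
    obtain ⟨η, h, hηc, hhc, hη0, hh0, hmem, hinj⟩ : ∃ η h : ℝ → ℝ, Continuous η ∧ Continuous h ∧
        η 0 = 0 ∧ h 0 = t ∧ (∀ v ∈ Icc (-1 : ℝ) 1, η v ∈ Icc (0 : ℝ) (1 / 2) ∧ h v ∈ Icc (0 : ℝ) 1 ∧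
          (η v = 0 ∨ h v = 0 ∨ h v = 1)) ∧
        ∀ v ∈ Icc (-1 : ℝ) 1, ∀ v' ∈ Icc (-1 : ℝ) 1, η v = η v' → h v = h v' → v = v' := by
      have ht : t ∈ Icc (0 : ℝ) 1 := by
        rcases mem_frontier_handlebody.1 hp with ⟨-, h | h⟩ | ⟨-, h⟩
        · simp only at h
          simp [h]
        · simp only at h
          simp [h]
        · exact h
      have hcorner : ∀ v v' : ℝ, max 0 (-v) / 2 = max 0 (-v') / 2 → max 0 v / 2 = max 0 v' / 2 →
          v = v' := fun v v' h1 h2 => by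
        have key : ∀ v : ℝ, v = max 0 v - max 0 (-v) := fun v => by
          rcases le_total 0 v with h | h
          · rw [max_eq_right h, max_eq_left (by linarith)]
            ring
          · rw [max_eq_left h, max_eq_right (by linarith)]
            ring
        rw [key v, key v']
        linarith
      have hbd : ∀ v ∈ Icc (-1 : ℝ) 1, 0 ≤ max 0 v / 2 ∧ max 0 v / 2 ≤ 1 / 2 := fun v hv =>
        ⟨by positivity, by linarith [max_le zero_le_one hv.2]⟩
      have hneg : ∀ v ∈ Icc (-1 : ℝ) 1, -v ∈ Icc (-1 : ℝ) 1 := fun v hv =>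
        ⟨by linarith [hv.2], by linarith [hv.1]⟩
      have hzero : ∀ v : ℝ, max 0 (-v) / 2 = 0 ∨ max 0 v / 2 = 0 := fun v => by
        rcases le_total 0 v with h | h
        · exact Or.inl (by rw [max_eq_left (by linarith)]; simp)
        · exact Or.inr (by rw [max_eq_left h]; simp)
      rcases eq_or_lt_of_le ht.1 with h0 | h0
      · refine ⟨fun v => max 0 (-v) / 2, fun v => max 0 v / 2, by fun_prop, by fun_prop, by simp,
          by simp [← h0], fun v hv => ⟨hbd _ (hneg v hv), ?_, ?_⟩, fun v _ v' _ => hcorner v v'⟩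
        · exact ⟨(hbd v hv).1, by linarith [(hbd v hv).2]⟩
        · exact (hzero v).imp id Or.inl
      rcases eq_or_lt_of_le ht.2 with h1 | h1
      · refine ⟨fun v => max 0 (-v) / 2, fun v => 1 - max 0 v / 2, by fun_prop, by fun_prop, by simp,
          by simp [h1], fun v hv => ⟨hbd _ (hneg v hv), ?_, ?_⟩,
          fun v _ v' _ h h' => hcorner v v' h (by linarith)⟩
        · exact ⟨by linarith [(hbd v hv).2], by linarith [(hbd v hv).1]⟩
        · exact (hzero v).imp id fun h => Or.inr (by simp only [h, sub_zero])
      · have hm : 0 < min t (1 - t) := lt_min h0 (by linarith)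
        refine ⟨fun _ => 0, fun v => t + v * min t (1 - t), by fun_prop, by fun_prop, rfl, by simp,
          fun v hv => ⟨by simp, ⟨?_, ?_⟩, Or.inl rfl⟩, fun v _ v' _ _ h => ?_⟩
        · nlinarith [min_le_left t (1 - t), hv.1]
        · nlinarith [min_le_right t (1 - t), hv.2]
        · exact mul_right_cancel₀ hm.ne' (add_left_cancel h)
    obtain ⟨c, κ, hwc, hκ, hκ1, hann⟩ := exists_annulus hw
    have hre : ∀ z ∈ Metric.closedBall (0 : ℂ) 1, z.re ∈ Icc (-1 : ℝ) 1 := fun z hz =>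
      abs_le.1 ((Complex.abs_re_le_norm z).trans (by simpa using hz))
    have him : ∀ z ∈ Metric.closedBall (0 : ℂ) 1, z.im ∈ Icc (-1 : ℝ) 1 := fun z hz =>
      abs_le.1 ((Complex.abs_im_le_norm z).trans (by simpa using hz))
    refine ⟨fun z => (c + (w - c) * ((1 + κ * η z.im : ℝ) * Complex.exp (z.re * Complex.I)), h z.im),
      ?_, ?_, ?_, ?_⟩
    · have h1 : Continuous fun z : ℂ => η z.im := hηc.comp Complex.continuous_im
      have h2 : Continuous fun z : ℂ => h z.im := hhc.comp Complex.continuous_im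
      have h3 := Complex.continuous_re
      apply Continuous.continuousOn
      fun_prop
    · intro z hz z' hz' heq
      simp only [Prod.mk.injEq, add_right_inj, mul_eq_mul_left_iff, sub_eq_zero, hwc, or_false]
        at heq
      obtain ⟨h1, h2⟩ := heq
      have hpos : ∀ z ∈ Metric.closedBall (0 : ℂ) 1, 0 < 1 + κ * η z.im := fun z hz => by
        have h := (hmem z.im (him z hz)).1
        have := abs_le.1 hκ1
        nlinarith [h.1, h.2]
      have hn := congrArg norm h1
      simp only [norm_mul, Complex.norm_exp_ofReal_mul_I, mul_one, Complex.norm_real,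
        Real.norm_eq_abs, abs_of_pos (hpos z hz), abs_of_pos (hpos z' hz'), add_right_inj,
        mul_eq_mul_left_iff, hκ, or_false] at hn
      have himz := hinj _ (him z hz) _ (him z' hz') hn h2
      rw [himz] at h1
      have hne : ((1 + κ * η z'.im : ℝ) : ℂ) ≠ 0 := by exact_mod_cast (hpos z' hz').ne'
      have hpi := Real.pi_gt_three
      have hexp := Complex.exp_inj_of_neg_pi_lt_of_le_pi (x := z.re * Complex.I)
        (y := z'.re * Complex.I) (by simp; linarith [(hre z hz).1]) (by simp; linarith [(hre z hz).2])
        (by simp; linarith [(hre z' hz').1]) (by simp; linarith [(hre z' hz').2])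
        (mul_left_cancel₀ hne h1)
      refine Complex.ext ?_ himz
      simpa using hexp
    · intro z hz
      rw [mem_frontier_handlebody]
      obtain ⟨h1, h2, h3⟩ := hmem z.im (him z hz)
      obtain ⟨h4, h5⟩ := hann (Complex.exp (z.re * Complex.I)) (Complex.norm_exp_ofReal_mul_I _)
      rcases h3 with h3 | h3
      · right
        refine ⟨?_, h2⟩
        simpa [h3] using h4
      · left
        exact ⟨h5 _ h1, h3⟩
    · simp [hη0, hh0]
  · have hw' : w ∈ holedDisc g ∧ (t = 0 ∨ t = 1) := by
      rcases mem_frontier_handlebody.1 hp with h | h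
      · exact h
      · exact absurd h.1 hw
    have hint : w ∈ interior (holedDisc g) := by
      by_contra h
      exact hw (frontier_holedDisc g ▸ ⟨subset_closure hw'.1, h⟩)
    obtain ⟨r, hr, hrw⟩ := Metric.isOpen_iff.1 isOpen_interior w hint
    have hr2 : ((r / 2 : ℝ) : ℂ) ≠ 0 := by exact_mod_cast (half_pos hr).ne'
    refine ⟨fun z => (w + (r / 2 : ℝ) * z, t), ?_, ?_, ?_, ?_⟩
    · fun_prop
    · intro z _ z' _ h
      simpa [hr.ne'] using h
    · intro z hz
      rw [mem_frontier_handlebody]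
      refine Or.inl ⟨interior_subset (hrw ?_), hw'.2⟩
      rw [mem_ball_iff_norm, add_sub_cancel_left, norm_mul, Complex.norm_real, Real.norm_eq_abs,
        abs_of_pos (half_pos hr)]
      have : ‖z‖ ≤ 1 := by simpa using hz
      nlinarith
    · simp

theorem three_mul_natCast_ne {g : ℕ} {z : ℂ} (hz : z ∈ holedDisc g) (k : Fin g) :
    z - 3 * ((k : ℕ) : ℂ) ≠ 0 := fun h => by
  have := hz.2 k
  rw [h, norm_zero] at this
  linarith

/-- The holed disc is a retract of the plane with the centres of the holes removed. -/
instance locallyPathConnectedSpace_holedDisc (g : ℕ) : LocallyPathConnectedSpace (holedDisc g) := by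
  classical
  set U : Set ℂ := ⋂ k : Fin g, {3 * ((k : ℕ) : ℂ)}ᶜ with hU
  have hUo : IsOpen U := isOpen_iInter_of_finite fun k => isOpen_compl_singleton
  have hsub : holedDisc g ⊆ U := fun z hz => mem_iInter.2 fun k => by
    simpa [sub_eq_zero] using three_mul_natCast_ne hz k
  have hg : (0 : ℝ) ≤ g := Nat.cast_nonneg g
  set R : ℝ := 3 * (g : ℝ) + 3 with hR
  have hk3 : ∀ k : Fin g, ‖3 * ((k : ℕ) : ℂ)‖ ≤ R - 6 := fun k => by
    rw [norm_mul, Complex.norm_ofNat, Complex.norm_natCast]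
    have : ((k : ℕ) : ℝ) + 1 ≤ g := by exact_mod_cast k.2
    linarith
  let ρ : ℂ → ℂ := fun z => (R / max R ‖z‖ : ℝ) * z +
    ∑ k : Fin g, (max 0 (‖z - 3 * ((k : ℕ) : ℂ)‖⁻¹ - 1) : ℝ) * (z - 3 * ((k : ℕ) : ℂ))
  have hρc : ContinuousOn ρ U := by
    have h1 : Continuous fun z : ℂ => R / max R ‖z‖ :=
      continuous_const.div (continuous_const.max continuous_norm) fun z =>
        (lt_max_of_lt_left (by linarith)).ne'
    have h2 : ∀ k : Fin g, ContinuousOn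
        (fun z : ℂ => (max 0 (‖z - 3 * ((k : ℕ) : ℂ)‖⁻¹ - 1) : ℝ)) U := fun k => by
      refine continuousOn_const.sup (ContinuousOn.sub (ContinuousOn.inv₀ (by fun_prop) ?_)
        continuousOn_const)
      intro z hz
      have := mem_iInter.1 hz k
      simpa [sub_eq_zero] using this
    refine ContinuousOn.add (by fun_prop) (continuousOn_finsetSum _ fun k _ => ?_)
    exact (Complex.continuous_ofReal.comp_continuousOn (h2 k)).mul (by fun_prop)
  have hzero : ∀ (z : ℂ) (k : Fin g), 1 ≤ ‖z - 3 * ((k : ℕ) : ℂ)‖ →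
      ((max 0 (‖z - 3 * ((k : ℕ) : ℂ)‖⁻¹ - 1) : ℝ) : ℂ) * (z - 3 * ((k : ℕ) : ℂ)) = 0 :=
    fun z k h => by
      rw [max_eq_left (by linarith [inv_le_one_of_one_le₀ h])]
      simp
  have hρid : ∀ z ∈ holedDisc g, ρ z = z := fun z hz => by
    simp only [ρ]
    rw [Finset.sum_eq_zero fun k _ => hzero z k (hz.2 k), max_eq_left hz.1, div_self (by linarith)]
    simp
  have hρm : ∀ z ∈ U, ρ z ∈ holedDisc g := fun z hz => by
    by_cases hin : ∃ k : Fin g, ‖z - 3 * ((k : ℕ) : ℂ)‖ < 1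
    · -- inside a hole: push out to its boundary circle
      obtain ⟨k, hk⟩ := hin
      have hfar : ∀ l : Fin g, l ≠ k → 2 ≤ ‖z - 3 * ((l : ℕ) : ℂ)‖ := fun l hl => by
        have h3 := three_le_norm_sub (j := (k : ℕ)) (k := (l : ℕ)) fun h => hl (Fin.ext h.symm)
        have := norm_sub_le_norm_sub_add_norm_sub (3 * ((k : ℕ) : ℂ)) z (3 * ((l : ℕ) : ℂ))
        rw [norm_sub_rev _ z] at this
        linarith
      have hzR : ‖z‖ ≤ R := by
        have := norm_le_norm_add_norm_sub (3 * ((k : ℕ) : ℂ)) z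
        rw [norm_sub_rev] at this
        linarith [hk3 k]
      have hz0 : 0 < ‖z - 3 * ((k : ℕ) : ℂ)‖ := norm_pos_iff.2 <| by
        simpa [sub_eq_zero] using mem_iInter.1 hz k
      have hval : ρ z = 3 * ((k : ℕ) : ℂ) +
          (‖z - 3 * ((k : ℕ) : ℂ)‖⁻¹ : ℝ) * (z - 3 * ((k : ℕ) : ℂ)) := by
        simp only [ρ]
        rw [Finset.sum_eq_single k (fun l _ hl => hzero z l (by linarith [hfar l hl]))
          (by simp), max_eq_left hzR, div_self (by linarith),
          max_eq_right (by linarith [one_le_inv₀ hz0 |>.2 hk.le])]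
        push_cast
        ring
      have hn : ‖((‖z - 3 * ((k : ℕ) : ℂ)‖⁻¹ : ℝ) : ℂ) * (z - 3 * ((k : ℕ) : ℂ))‖ = 1 := by
        rw [norm_mul, Complex.norm_real, norm_inv, norm_norm, inv_mul_cancel₀ hz0.ne']
      rw [hval]
      refine ⟨?_, fun l => ?_⟩
      · have := norm_add_le (3 * ((k : ℕ) : ℂ))
          (((‖z - 3 * ((k : ℕ) : ℂ)‖⁻¹ : ℝ) : ℂ) * (z - 3 * ((k : ℕ) : ℂ)))
        linarith [hk3 k]
      · rcases eq_or_ne l k with rfl | hlk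
        · rw [add_sub_cancel_left, hn]
        · have h3 := three_le_norm_sub (j := (k : ℕ)) (k := (l : ℕ))
            fun h => hlk (Fin.ext h.symm)
          have := norm_sub_norm_le (3 * ((k : ℕ) : ℂ) - 3 * ((l : ℕ) : ℂ))
            (-(((‖z - 3 * ((k : ℕ) : ℂ)‖⁻¹ : ℝ) : ℂ) * (z - 3 * ((k : ℕ) : ℂ))))
          rw [norm_neg, hn, sub_neg_eq_add] at this
          rw [add_sub_right_comm]
          linarith
    · push Not at hin
      have hval : ρ z = (R / max R ‖z‖ : ℝ) * z := by
        simp only [ρ]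
        rw [Finset.sum_eq_zero fun k _ => hzero z k (hin k), add_zero]
      rcases le_total ‖z‖ R with h | h
      · rw [hval, max_eq_left h, div_self (by linarith), Complex.ofReal_one, one_mul]
        exact ⟨h, hin⟩
      · have hz0 : 0 < ‖z‖ := by linarith
        have hn : ‖ρ z‖ = R := by
          rw [hval, max_eq_right h, norm_mul, Complex.norm_real, norm_div, norm_norm,
            div_mul_cancel₀ _ hz0.ne', Real.norm_of_nonneg (by linarith)]
        refine ⟨hn.le, fun k => ?_⟩
        have := norm_sub_norm_le (ρ z) (3 * ((k : ℕ) : ℂ))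
        linarith [hk3 k]
  have : LocallyPathConnectedSpace U := hUo.locallyPathConnectedSpace
  let r : U → holedDisc g := fun z => ⟨ρ z, hρm z z.2⟩
  have hr : Continuous r :=
    (continuousOn_iff_continuous_domRestrict.1 hρc).subtype_mk _
  refine (IsQuotientMap.of_inverse (f := inclusion hsub) (g := r) (continuous_inclusion hsub)
    hr fun z => Subtype.ext (hρid z z.2)).locallyPathConnectedSpace

instance locallyPathConnectedSpace_circle : LocallyPathConnectedSpace Circle :=
  (Circle.isCoveringMap_exp.isQuotientMap
    fun z => ⟨z.val.arg, Circle.exp_arg z⟩).locallyPathConnectedSpace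

instance locallyPathConnectedSpace_unitInterval : LocallyPathConnectedSpace I :=
  (IsQuotientMap.of_inverse (f := Subtype.val) (g := projIcc (0 : ℝ) 1 zero_le_one)
    continuous_subtype_val continuous_projIcc fun x => projIcc_val _ x).locallyPathConnectedSpace

/-- The boundary surface is the union of the two faces and of an annulus over each boundary
circle, hence a quotient of a locally path connected space. -/
instance locallyPathConnectedSpace_frontier_handlebody (g : ℕ) :
    LocallyPathConnectedSpace (frontier (handlebody g)) := by
  let _ : TopologicalSpace (Option (Fin g)) := ⊥
  have : DiscreteTopology (Option (Fin g)) := ⟨rfl⟩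
  let c : Option (Fin g) → ℂ := fun o => o.elim 0 fun k => 3 * ((k : ℕ) : ℂ)
  let r : Option (Fin g) → ℝ := fun o => o.elim (3 * (g : ℝ) + 3) fun _ => 1
  have hr : ∀ o, 0 < r o := by
    rintro (_ | _)
    · simp only [r, Option.elim]
      positivity
    · simp [r]
  have hmem : ∀ o (ζ : ℂ), ‖ζ‖ = 1 → c o + r o * ζ ∈ holedDiscBoundary g := by
    have hg : (0 : ℝ) ≤ g := Nat.cast_nonneg g
    have hk3 : ∀ k : Fin g, ‖3 * ((k : ℕ) : ℂ)‖ ≤ 3 * (g : ℝ) - 3 := fun k => by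
      rw [norm_mul, Complex.norm_ofNat, Complex.norm_natCast]
      have : ((k : ℕ) : ℝ) + 1 ≤ g := by exact_mod_cast k.2
      linarith
    rintro (_ | k) ζ hζ
    · have hn : ‖c none + r none * ζ‖ = 3 * (g : ℝ) + 3 := by
        simp only [c, r, Option.elim, zero_add, norm_mul, hζ, mul_one, Complex.norm_real]
        exact Real.norm_of_nonneg (by positivity)
      refine ⟨⟨hn.le, fun k => ?_⟩, Or.inl hn⟩
      have := norm_sub_norm_le (c none + r none * ζ) (3 * ((k : ℕ) : ℂ))
      linarith [hk3 k]
    · have hval : c (some k) + r (some k) * ζ = 3 * ((k : ℕ) : ℂ) + ζ := by simp [c, r]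
      rw [hval]
      refine ⟨⟨?_, fun l => ?_⟩, Or.inr ⟨k, by rw [add_sub_cancel_left, hζ]⟩⟩
      · have := norm_add_le (3 * ((k : ℕ) : ℂ)) ζ
        linarith [hk3 k]
      · rcases eq_or_ne l k with rfl | hlk
        · rw [add_sub_cancel_left, hζ]
        · have h3 := three_le_norm_sub (j := (k : ℕ)) (k := (l : ℕ))
            fun h => hlk (Fin.ext h.symm)
          have := norm_sub_norm_le (3 * ((k : ℕ) : ℂ) - 3 * ((l : ℕ) : ℂ)) (-ζ)
          rw [norm_neg, hζ, sub_neg_eq_add] at this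
          rw [add_sub_right_comm]
          linarith
  let Φ : (holedDisc g × Bool) ⊕ (Circle × Option (Fin g) × I) → frontier (handlebody g) :=
    Sum.elim (fun p => ⟨(p.1, if p.2 then 1 else 0), mem_frontier_handlebody.2 <| Or.inl
        ⟨p.1.2, by cases p.2 <;> simp⟩⟩)
      fun p => ⟨(c p.2.1 + r p.2.1 * p.1, p.2.2), mem_frontier_handlebody.2 <| Or.inr
        ⟨hmem _ _ (Circle.norm_coe _), p.2.2.2⟩⟩
  have hΦc : Continuous Φ := by
    refine Continuous.sumElim (Continuous.subtype_mk ?_ _) (Continuous.subtype_mk ?_ _)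
    · exact (continuous_subtype_val.comp continuous_fst).prodMk
        ((continuous_of_discreteTopology (f := fun b : Bool => if b then (1 : ℝ) else 0)).comp
          continuous_snd)
    · have h1 : Continuous c := continuous_of_discreteTopology
      have h2 : Continuous r := continuous_of_discreteTopology
      fun_prop
  have hΦs : Function.Surjective Φ := by
    rintro ⟨⟨z, t⟩, hp⟩
    rcases mem_frontier_handlebody.1 hp with ⟨hz, ht⟩ | ⟨⟨hz, hz'⟩, ht⟩
    · refine ⟨Sum.inl (⟨z, hz⟩, decide (t = 1)), Subtype.ext (Prod.ext rfl ?_)⟩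
      simp only at ht
      rcases ht with rfl | rfl <;> simp [Φ]
    · obtain ⟨o, ho⟩ : ∃ o, ‖z - c o‖ = r o := by
        rcases hz' with h | ⟨k, h⟩
        · exact ⟨none, by simpa [c, r] using h⟩
        · exact ⟨some k, by simpa [c, r] using h⟩
      have hne : (r o : ℂ) ≠ 0 := by exact_mod_cast (hr o).ne'
      have hζ : ‖(z - c o) / r o‖ = 1 := by
        rw [norm_div, ho, Complex.norm_real, Real.norm_of_nonneg (hr o).le, div_self (hr o).ne']
      refine ⟨Sum.inr (⟨(z - c o) / r o, by simpa [Submonoid.unitSphere] using hζ⟩, o, ⟨t, ht⟩),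
        Subtype.ext (Prod.ext ?_ rfl)⟩
      simp only [Φ, Sum.elim_inr]
      field_simp
      ring
  have : CompactSpace (holedDisc g) := isCompact_iff_compactSpace.1 (isCompact_holedDisc g)
  exact (IsQuotientMap.of_surjective_continuous hΦs hΦc).locallyPathConnectedSpace

/-- Every point of the boundary surface can be joined inside the surface to the bottom face. -/
theorem exists_joinedIn_bottom {g : ℕ} {p : ℂ × ℝ} (hp : p ∈ frontier (handlebody g)) :
    ∃ z : ℂ, JoinedIn (frontier (handlebody g)) p (z, 0) := by
  obtain ⟨z, t⟩ := p
  have hside : ∀ w ∈ holedDiscBoundary g, ∀ t ∈ Icc (0 : ℝ) 1,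
      JoinedIn (frontier (handlebody g)) (w, t) (w, 0) := fun w hw t ht => by
    refine JoinedIn.ofLine (f := fun s : ℝ => (w, (1 - s) * t)) (by fun_prop) (by simp) (by simp) ?_
    rintro _ ⟨s, hs, rfl⟩
    refine mem_frontier_handlebody.2 (Or.inr ⟨hw, ?_, ?_⟩)
    · exact mul_nonneg (by linarith [hs.2]) ht.1
    · exact mul_le_one₀ (by linarith [hs.1]) ht.1 ht.2
  rcases mem_frontier_handlebody.1 hp with ⟨hz, ht⟩ | ⟨hz, ht⟩
  swap
  · exact ⟨z, hside z hz t ht⟩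
  simp only at hz ht
  rcases ht with rfl | rfl
  · exact ⟨z, JoinedIn.refl hp⟩
  -- on the top face move vertically away from the real axis, which carries the centres
  obtain ⟨e, he, hez⟩ : ∃ e : ℝ, e * e = 1 ∧ 0 ≤ e * z.im := by
    rcases le_total 0 z.im with h | h
    · exact ⟨1, by norm_num, by linarith⟩
    · exact ⟨-1, by norm_num, by linarith⟩
  have hsq : ∀ (s : ℝ) (x : ℝ), ‖z + (s * e : ℝ) * Complex.I - (x : ℂ)‖ ^ 2 =
      ‖z - (x : ℂ)‖ ^ 2 + 2 * s * (e * z.im) + s ^ 2 := fun s x => by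
    rw [← Complex.normSq_eq_norm_sq, ← Complex.normSq_eq_norm_sq, Complex.normSq_apply,
      Complex.normSq_apply]
    simp
    linear_combination s ^ 2 * he
  have hg : (0 : ℝ) ≤ g := Nat.cast_nonneg g
  set R : ℝ := 3 * (g : ℝ) + 3 with hR
  have hzR : ‖z‖ ≤ R := hz.1
  obtain ⟨s₀, hs₀, hs₀R⟩ : ∃ s₀ : ℝ, 0 ≤ s₀ ∧ ‖z‖ ^ 2 + 2 * s₀ * (e * z.im) + s₀ ^ 2 = R ^ 2 := by
    have hcont : ContinuousOn (fun s : ℝ => ‖z‖ ^ 2 + 2 * s * (e * z.im) + s ^ 2) (Icc 0 R) := by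
      fun_prop
    have hR0 : 0 ≤ R := by positivity
    have h0 : ‖z‖ ^ 2 ≤ R ^ 2 := by gcongr
    have h1 : 0 ≤ 2 * R * (e * z.im) := by positivity
    have h2 := sq_nonneg ‖z‖
    obtain ⟨s, hs, hs'⟩ := intermediate_value_Icc hR0 hcont
      (show R ^ 2 ∈ Icc _ _ from ⟨by simpa using h0, by linarith⟩)
    exact ⟨s, hs.1, hs'⟩
  have hmem : ∀ s ∈ Icc 0 s₀, z + (s * e : ℝ) * Complex.I ∈ holedDisc g := fun s hs => by
    refine ⟨?_, fun k => ?_⟩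
    · have := hsq s 0
      rw [Complex.ofReal_zero, sub_zero, sub_zero] at this
      refine abs_le_of_sq_le_sq' ?_ (by positivity) |>.2
      rw [this, ← hR, ← hs₀R]
      nlinarith [hs.1, hs.2, mul_nonneg (sub_nonneg.2 hs.2) hez]
    · have := hsq s (3 * (k : ℕ))
      rw [show ((3 * (k : ℕ) : ℝ) : ℂ) = 3 * ((k : ℕ) : ℂ) by push_cast; rfl] at this
      have h1 := hz.2 k
      refine abs_le_of_sq_le_sq' ?_ (norm_nonneg _) |>.2
      rw [this]
      nlinarith [hs.1, mul_nonneg hs.1 hez]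
  refine ⟨z + (s₀ * e : ℝ) * Complex.I, JoinedIn.trans (y := (z + (s₀ * e : ℝ) * Complex.I, 1)) ?_
    (hside _ ⟨hmem s₀ ⟨hs₀, le_rfl⟩, Or.inl ?_⟩ 1 (by simp))⟩
  · refine JoinedIn.ofLine (f := fun s : ℝ => (z + ((s * s₀) * e : ℝ) * Complex.I, 1))
      (by fun_prop) (by simp) (by simp) ?_
    rintro _ ⟨s, hs, rfl⟩
    refine mem_frontier_handlebody.2 (Or.inl ⟨hmem _ ⟨?_, ?_⟩, Or.inr rfl⟩)
    · exact mul_nonneg hs.1 hs₀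
    · exact mul_le_of_le_one_left hs₀ hs.2
  · have := hsq s₀ 0
    rw [Complex.ofReal_zero, sub_zero, sub_zero, hs₀R] at this
    exact (sq_eq_sq₀ (norm_nonneg _) (by positivity)).1 this

/-! ### The boundary of a handlebody inside a space -/

section HandlebodyBoundary

variable {M : Type*} [TopologicalSpace M] {g : ℕ} {H B : Set M}

theorem IsHandlebodyWithBoundary.exists_homeomorph (h : IsHandlebodyWithBoundary g H B) :
    ∃ (φ : H ≃ₜ handlebody g) (ψ : B ≃ₜ frontier (handlebody g)),
      ∀ b : B, (ψ b : ℂ × ℝ) = φ (inclusion h.1 b) := by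
  obtain ⟨hB, φ, hφ⟩ := id h
  have hsub : frontier (handlebody g) ⊆ handlebody g := (isClosed_handlebody g).frontier_subset
  have hinv : ∀ y : frontier (handlebody g), (φ.symm (inclusion hsub y) : M) ∈ B := fun y =>
    (hφ _).1 (by simp)
  refine ⟨φ, ⟨⟨fun b => ⟨φ (inclusion hB b), (hφ _).2 b.2⟩,
    fun y => ⟨φ.symm (inclusion hsub y), hinv y⟩, fun b => ?_, fun y => ?_⟩, ?_, ?_⟩, fun b => rfl⟩
  · apply Subtype.ext
    have : inclusion hsub ⟨φ (inclusion hB b), (hφ _).2 b.2⟩ = φ (inclusion hB b) := rfl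
    simp only [this, Homeomorph.symm_apply_apply, coe_inclusion]
  · apply Subtype.ext
    have : inclusion hB ⟨φ.symm (inclusion hsub y), hinv y⟩ = φ.symm (inclusion hsub y) := rfl
    simp only [this, Homeomorph.apply_symm_apply, coe_inclusion]
  · exact Continuous.subtype_mk (continuous_subtype_val.comp
      (φ.continuous.comp (continuous_inclusion hB))) _
  · exact Continuous.subtype_mk (continuous_subtype_val.comp
      (φ.symm.continuous.comp (continuous_inclusion hsub))) _

theorem IsHandlebodyWithBoundary.compactSpace (h : IsHandlebodyWithBoundary g H B) :
    CompactSpace B := by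
  obtain ⟨-, ψ, -⟩ := h.exists_homeomorph
  have := isCompact_iff_compactSpace.1 (isCompact_frontier_handlebody g)
  exact ψ.symm.compactSpace

theorem IsHandlebodyWithBoundary.locallyPathConnectedSpace (h : IsHandlebodyWithBoundary g H B) :
    LocallyPathConnectedSpace B := by
  obtain ⟨-, ψ, -⟩ := h.exists_homeomorph
  exact ψ.isOpenEmbedding.locallyPathConnectedSpace

/-- Arbitrarily small embedded discs around a point of the boundary surface. -/
theorem IsHandlebodyWithBoundary.exists_disc (h : IsHandlebodyWithBoundary g H B) (b : B)
    {U : Set B} (hU : U ∈ 𝓝 b) :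
    ∃ j : ℂ → B, ContinuousOn j (Metric.closedBall 0 1) ∧ InjOn j (Metric.closedBall 0 1) ∧
      MapsTo j (Metric.closedBall 0 1) U ∧ j 0 = b := by
  classical
  obtain ⟨-, ψ, -⟩ := h.exists_homeomorph
  obtain ⟨j, hjc, hji, hjm, hj0⟩ := exists_disc_frontier_handlebody (ψ b).2
  let k : Metric.closedBall (0 : ℂ) 1 → B := fun z => ψ.symm ⟨j z, hjm z.2⟩
  have hk : Continuous k := ψ.symm.continuous.comp
    (Continuous.subtype_mk (continuousOn_iff_continuous_domRestrict.1 hjc) _)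
  have hk0 : k ⟨0, by simp⟩ = b := by
    have : (⟨j 0, hjm (by simp)⟩ : frontier (handlebody g)) = ψ b := Subtype.ext hj0
    simp only [k, this, Homeomorph.symm_apply_apply]
  have hki : Function.Injective k := fun z w hzw => by
    have := congrArg Subtype.val (ψ.symm.injective hzw)
    exact Subtype.ext (hji z.2 w.2 this)
  -- shrink the disc
  obtain ⟨r, hr, hrU⟩ : ∃ r > 0, ∀ z : Metric.closedBall (0 : ℂ) 1, ‖(z : ℂ)‖ ≤ r → k z ∈ U := by
    have := hk.continuousAt.preimage_mem_nhds (hk0.symm ▸ hU)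
    obtain ⟨r, hr, hrU⟩ := Metric.mem_nhds_iff.1 this
    refine ⟨r / 2, half_pos hr, fun z hz => hrU ?_⟩
    rw [Metric.mem_ball, Subtype.dist_eq, dist_zero_right]
    linarith
  have hs0 : 0 < min r 1 := lt_min hr one_pos
  have hn : ∀ z ∈ Metric.closedBall (0 : ℂ) 1, ‖((min r 1 : ℝ) : ℂ) * z‖ ≤ min r 1 := fun z hz => by
    rw [norm_mul, Complex.norm_real, Real.norm_of_nonneg hs0.le]
    exact mul_le_of_le_one_right hs0.le (by simpa using hz)
  have hm : ∀ z ∈ Metric.closedBall (0 : ℂ) 1,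
      ((min r 1 : ℝ) : ℂ) * z ∈ Metric.closedBall (0 : ℂ) 1 := fun z hz => by
    simpa only [mem_closedBall_zero_iff] using (hn z hz).trans (min_le_right _ _)
  refine ⟨fun z => if hz : z ∈ Metric.closedBall (0 : ℂ) 1 then k ⟨_, hm z hz⟩ else b, ?_, ?_, ?_, ?_⟩
  · rw [continuousOn_iff_continuous_domRestrict]
    have : Continuous fun z : Metric.closedBall (0 : ℂ) 1 =>
        k ⟨((min r 1 : ℝ) : ℂ) * z, hm z z.2⟩ := hk.comp (by fun_prop)
    refine this.congr fun z => ?_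
    simp only [domRestrict_apply, dif_pos z.2]
  · intro z hz w hw hzw
    simp only [dif_pos hz, dif_pos hw] at hzw
    have h1 := congrArg Subtype.val (hki hzw)
    exact mul_left_cancel₀ (by exact_mod_cast hs0.ne') h1
  · intro z hz
    simp only [dif_pos hz]
    exact hrU _ ((hn z hz).trans (min_le_left _ _))
  · have h0 : (0 : ℂ) ∈ Metric.closedBall (0 : ℂ) 1 := by simp
    have h1 : (⟨((min r 1 : ℝ) : ℂ) * 0, hm 0 h0⟩ : Metric.closedBall (0 : ℂ) 1) = ⟨0, by simp⟩ :=
      Subtype.ext (mul_zero _)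
    beta_reduce
    rw [dif_pos h0, h1, hk0]

/-- Every loop in a handlebody, based on the boundary surface, is homotopic to a loop in the
surface: push it down to the bottom face. -/
theorem IsHandlebodyWithBoundary.exists_quotient_map_eq (h : IsHandlebodyWithBoundary g H B) (b : B)
    (β : Path.Homotopic.Quotient (ContinuousMap.inclusion h.1 b) (ContinuousMap.inclusion h.1 b)) :
    ∃ α : Path.Homotopic.Quotient b b, α.map (ContinuousMap.inclusion h.1) = β := by
  obtain ⟨β, rfl⟩ := Path.Homotopic.Quotient.mk_surjective β
  obtain ⟨φ, ψ, hψ⟩ := h.exists_homeomorph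
  let ι : C(B, H) := ContinuousMap.inclusion h.1
  obtain ⟨z, hz⟩ := exists_joinedIn_bottom (ψ b).2
  let b₁ : B := ψ.symm ⟨(z, 0), hz.target_mem⟩
  have hb₁ : (ψ b₁ : ℂ × ℝ) = (z, 0) := by simp [b₁]
  have hc : Joined b b₁ := by
    obtain ⟨c⟩ := hz.joined_subtype
    exact ⟨(c.map ψ.symm.continuous).cast (by simp) rfl⟩
  obtain ⟨c⟩ := hc
  let δ : Path (ι b₁) (ι b₁) := (c.map ι.continuous).symm.trans (β.trans (c.map ι.continuous))
  have hbase : ∀ s, (s = 0 ∨ s = 1) → ((φ (δ s) : ℂ × ℝ)) = (z, 0) := by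
    rintro s (rfl | rfl)
    · rw [δ.source, ← hb₁]
      exact (hψ b₁).symm
    · rw [δ.target, ← hb₁]
      exact (hψ b₁).symm
  have hmem : ∀ s, ((φ (δ s) : ℂ × ℝ).1, (0 : ℝ)) ∈ frontier (handlebody g) := fun s =>
    mem_frontier_handlebody.2 (Or.inl ⟨(φ (δ s)).2.1, Or.inl rfl⟩)
  have hmem' : ∀ p : I × I, ((φ (δ p.2) : ℂ × ℝ).1, (1 - (p.1 : ℝ)) * (φ (δ p.2) : ℂ × ℝ).2) ∈
      handlebody g := fun p => by
    have h2 := (φ (δ p.2)).2.2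
    refine ⟨(φ (δ p.2)).2.1, mul_nonneg (by linarith [p.1.2.2]) h2.1, ?_⟩
    exact mul_le_one₀ (by linarith [p.1.2.1]) h2.1 h2.2
  have hend : ∀ s, (s = 0 ∨ s = 1) → ψ.symm ⟨_, hmem s⟩ = b₁ := fun s hs => by
    apply ψ.injective
    apply Subtype.ext
    rw [ψ.apply_symm_apply, hb₁]
    exact Prod.ext (show (φ (δ s) : ℂ × ℝ).1 = z by rw [hbase s hs]) rfl
  let ρ : Path b₁ b₁ := ⟨⟨fun s => ψ.symm ⟨_, hmem s⟩, by fun_prop⟩, hend 0 (Or.inl rfl),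
    hend 1 (Or.inr rfl)⟩
  have hιψ : ∀ y, ι (ψ.symm y) = φ.symm ⟨y, (isClosed_handlebody g).frontier_subset y.2⟩ :=
    fun y => by
      apply φ.injective
      apply Subtype.ext
      rw [φ.apply_symm_apply]
      have := hψ (ψ.symm y)
      rw [ψ.apply_symm_apply] at this
      exact this.symm
  have hδρ : Path.Homotopic δ (ρ.map ι.continuous) := by
    refine ⟨⟨⟨⟨fun p => φ.symm ⟨_, hmem' p⟩, by fun_prop⟩, fun s => ?_, fun s => ?_⟩, fun u s hs => ?_⟩⟩
    · apply φ.injective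
      apply Subtype.ext
      simp
    · refine Eq.trans ?_ (hιψ ⟨_, hmem s⟩).symm
      apply φ.injective
      apply Subtype.ext
      simp
    · apply φ.injective
      apply Subtype.ext
      have h0 := hbase s (by simpa using hs)
      simp [h0]
  have hδ : Path.Homotopic.Quotient.mk δ = Path.Homotopic.Quotient.mk (ρ.map ι.continuous) :=
    Path.Homotopic.Quotient.eq.2 hδρ
  refine ⟨Path.Homotopic.Quotient.mk (c.trans (ρ.trans c.symm)), ?_⟩
  rw [← Path.Homotopic.Quotient.mk_map]
  have hmap : (c.trans (ρ.trans c.symm)).map ι.continuous =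
      (c.map ι.continuous).trans ((ρ.map ι.continuous).trans (c.map ι.continuous).symm) := by
    rw [Path.map_trans, Path.map_trans, Path.map_symm]
  rw [hmap]
  simp only [Path.Homotopic.Quotient.mk_trans, ← hδ, Path.Homotopic.Quotient.mk_symm, δ]
  simp only [← Path.Homotopic.Quotient.trans_assoc, Path.Homotopic.Quotient.trans_symm,
    Path.Homotopic.Quotient.refl_trans]
  simp only [Path.Homotopic.Quotient.trans_assoc, Path.Homotopic.Quotient.trans_symm,
    Path.Homotopic.Quotient.trans_refl]

open FundamentalGroupoidFunctor CategoryTheory in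
/-- A map homotopic to the inclusion of the boundary surface followed by a homotopy equivalence is
surjective on fundamental groups. -/
theorem IsHandlebodyWithBoundary.map_surjective {Y : Type*} [TopologicalSpace Y]
    (h : IsHandlebodyWithBoundary g H B) (e : ContinuousMap.HomotopyEquiv H Y) (k : C(B, Y))
    (hk : k.Homotopic (e.toFun.comp (ContinuousMap.inclusion h.1))) (b : B) :
    Function.Surjective (FundamentalGroup.map k b) := by
  intro β
  obtain ⟨F⟩ := hk
  let τ := homotopicMapsNatIso F
  have hiso : IsIso (τ.app ⟨b⟩) := inferInstance
  let β' := inv (τ.app ⟨b⟩) ≫ (show (FundamentalGroupoid.map k).obj ⟨b⟩ ⟶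
    (FundamentalGroupoid.map k).obj ⟨b⟩ from β) ≫ τ.app ⟨b⟩
  have hfull : (FundamentalGroupoid.map e.toFun).Full :=
    inferInstanceAs (equivOfHomotopyEquiv e).functor.Full
  obtain ⟨γ, hγ⟩ := hfull.map_surjective (X := ⟨inclusion h.1 b⟩) (Y := ⟨inclusion h.1 b⟩) β'
  obtain ⟨α, hα⟩ := h.exists_quotient_map_eq b γ
  refine ⟨α, ?_⟩
  have hnat := τ.naturality (X := ⟨b⟩) (Y := ⟨b⟩) α
  have hcomp : (FundamentalGroupoid.map (e.toFun.comp (ContinuousMap.inclusion h.1))).map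
      (X := ⟨b⟩) (Y := ⟨b⟩) α = β' := by
    rw [← hγ, ← hα]
    exact Path.Homotopic.Quotient.map_comp
  rw [hcomp] at hnat
  simp only [β', IsIso.hom_inv_id_assoc] at hnat
  exact hiso.mono_of_iso.right_cancellation _ _ hnat

end HandlebodyBoundary

/-! ### Directions and arcs in simply connected spaces -/

section Directions

variable {T : Type*} [TopologicalSpace T]

theorem IsDirection.isOpen [T1Space T] [LocallyConnectedSpace T] {δ : Set T} (h : IsDirection δ) :
    IsOpen δ := by
  obtain ⟨x, y, -, rfl⟩ := h
  exact isOpen_compl_singleton.connectedComponentIn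

theorem isClosed_insert_connectedComponentIn [T1Space T] [LocallyConnectedSpace T] (x y : T) :
    IsClosed (insert x (connectedComponentIn {x}ᶜ y)) := by
  have h : (insert x (connectedComponentIn {x}ᶜ y))ᶜ =
      ⋃ z ∈ (insert x (connectedComponentIn {x}ᶜ y))ᶜ, connectedComponentIn {x}ᶜ z := by
    apply Subset.antisymm
    · intro z hz
      refine mem_biUnion hz (mem_connectedComponentIn ?_)
      simp only [mem_compl_iff, mem_insert_iff, not_or] at hz
      exact hz.1
    · refine iUnion₂_subset fun z hz w hw => ?_
      simp only [mem_compl_iff, mem_insert_iff, not_or] at hz ⊢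
      refine ⟨connectedComponentIn_subset _ _ hw, fun hw' => hz.2 ?_⟩
      rw [connectedComponentIn_eq hw', ← connectedComponentIn_eq hw]
      exact mem_connectedComponentIn hz.1
  rw [← isOpen_compl_iff, h]
  exact isOpen_biUnion fun z _ => isOpen_compl_singleton.connectedComponentIn

/-- Removing a component of the complement of a point does not disconnect a set. -/
theorem IsPreconnected.diff_isDirection [T1Space T] [LocallyConnectedSpace T] {A δ : Set T}
    (hA : IsPreconnected A) (hδ : IsDirection δ) : IsPreconnected (A \ δ) := by
  have hδo := hδ.isOpen
  obtain ⟨x, y, hy, rfl⟩ := hδ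
  have hcl := isClosed_insert_connectedComponentIn x y
  set δ := _root_.connectedComponentIn {x}ᶜ y with hδ
  by_cases hxA : x ∈ A
  · have key : ∀ P Q : Set T, IsClosed P → IsClosed Q → A \ δ ⊆ P ∪ Q → (A \ δ ∩ Q).Nonempty →
        x ∈ P → (A \ δ ∩ (P ∩ Q)).Nonempty := by
      rintro P Q hP hQ hPQ ⟨q, hq, hqQ⟩ hx
      obtain ⟨z, hzA, hz, hzQ⟩ := isPreconnected_closed_iff.1 hA (P ∪ insert x δ) (Q \ δ)
        (hP.union hcl) (hQ.sdiff hδo) (fun z hz => by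
          by_cases hzδ : z ∈ δ
          · exact Or.inl (Or.inr (Or.inr hzδ))
          · exact (hPQ ⟨hz, hzδ⟩).imp Or.inl fun h => ⟨h, hzδ⟩)
        ⟨x, hxA, Or.inl hx⟩ ⟨q, hq.1, hqQ, hq.2⟩
      refine ⟨z, ⟨hzA, hzQ.2⟩, ?_, hzQ.1⟩
      rcases hz with h | h | h
      · exact h
      · exact h ▸ hx
      · exact absurd h hzQ.2
    have hxδ : x ∉ δ := fun h => connectedComponentIn_subset _ _ h rfl
    refine isPreconnected_closed_iff.2 fun P Q hP hQ hPQ hAP hAQ => ?_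
    rcases hPQ ⟨hxA, hxδ⟩ with hx | hx
    · exact key P Q hP hQ hPQ hAQ hx
    · rw [inter_comm P Q]
      exact key Q P hQ hP (by rwa [union_comm]) hAP hx
  · have hA' : A ⊆ {x}ᶜ := fun z hz h => hxA (h ▸ hz)
    by_cases h : (A ∩ δ).Nonempty
    · obtain ⟨z, hzA, hz⟩ := h
      have : A ⊆ δ := by
        rw [hδ, connectedComponentIn_eq hz]
        exact hA.subset_connectedComponentIn hzA hA'
      rw [sdiff_eq_empty.2 this]
      exact isPreconnected_empty
    · rwa [(disjoint_iff_inter_eq_empty.2 (not_nonempty_iff_eq_empty.1 h)).sdiff_eq_left]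

/-- The complement of any union of directions is connected (if it is not empty). -/
theorem isPreconnected_compl_sUnion_directions [T2Space T] [LocallyConnectedSpace T]
    [PathConnectedSpace T] (F : Set (Set T)) (hF : ∀ δ ∈ F, IsDirection δ) :
    IsPreconnected (⋃₀ F)ᶜ := by
  classical
  refine isPreconnected_of_forall_pair fun x hx y hy => ?_
  let c := PathConnectedSpace.somePath x y
  have hA : IsCompact (range c) := isCompact_range c.continuous
  have hfin : ∀ G : Finset (Set T), (∀ δ ∈ G, IsDirection δ) →
      IsPreconnected (range c \ ⋃ δ ∈ G, δ) := by
    intro G hG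
    induction G using Finset.induction_on with
    | empty => simpa using isPreconnected_range c.continuous
    | insert δ G _ ih =>
      rw [Finset.set_biUnion_insert, union_comm, ← sdiff_sdiff]
      exact (ih fun δ hδ => hG δ (by simp [hδ])).diff_isDirection (hG δ (by simp))
  have hK : IsClosed (range c ∩ (⋃₀ F)ᶜ) :=
    hA.isClosed.inter (isOpen_sUnion fun δ hδ => (hF δ hδ).isOpen).isClosed_compl
  refine ⟨range c ∩ (⋃₀ F)ᶜ, inter_subset_right, ⟨⟨0, c.source⟩, hx⟩, ⟨⟨1, c.target⟩, hy⟩, ?_⟩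
  rw [isPreconnected_iff_subset_of_fully_disjoint_closed hK]
  intro a b ha hb hab hdisj
  have hKc : IsCompact (range c ∩ (⋃₀ F)ᶜ) := hA.of_isClosed_subset hK inter_subset_left
  obtain ⟨u, v, hu, hv, hau, hbv, huv⟩ := SeparatedNhds.of_isCompact_isCompact
    (hKc.inter_right ha) (hKc.inter_right hb)
    (hdisj.mono inter_subset_right inter_subset_right)
  have hKuv : range c ∩ (⋃₀ F)ᶜ ⊆ u ∪ v := fun z hz =>
    (hab hz).imp (fun h => hau ⟨hz, h⟩) fun h => hbv ⟨hz, h⟩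
  obtain ⟨G, hGF, hG⟩ : ∃ G : Finset (Set T), (∀ δ ∈ G, δ ∈ F) ∧
      range c \ ⋃ δ ∈ G, δ ⊆ u ∪ v := by
    have hc' : IsCompact (range c \ (u ∪ v)) := hA.diff (hu.union hv)
    obtain ⟨G, hGF, hGfin, hG⟩ := hc'.elim_finite_subcover_image (b := F) (c := id)
      (fun δ hδ => (hF δ hδ).isOpen) fun z hz => by
        by_contra h
        exact hz.2 (hKuv ⟨hz.1, by simpa [mem_sUnion] using h⟩)
    refine ⟨hGfin.toFinset, fun δ hδ => hGF (hGfin.mem_toFinset.1 hδ), fun z hz => ?_⟩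
    by_contra h
    apply hz.2
    simpa using hG ⟨hz.1, h⟩
  have hsub : range c ∩ (⋃₀ F)ᶜ ⊆ range c \ ⋃ δ ∈ G, δ := fun z hz => ⟨hz.1, fun h => by
    obtain ⟨δ, hδ, hzδ⟩ := mem_iUnion₂.1 h
    exact hz.2 ⟨δ, hGF δ hδ, hzδ⟩⟩
  rcases (hfin G fun δ hδ => hF δ (hGF δ hδ)).subset_or_subset hu hv huv hG with h | h
  · left
    intro z hz
    exact (hab hz).resolve_right fun hb => huv.le_bot ⟨h (hsub hz), hbv ⟨hz, hb⟩⟩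
  · right
    intro z hz
    exact (hab hz).resolve_left fun ha => huv.le_bot ⟨hau ⟨hz, ha⟩, h (hsub hz)⟩

theorem continuousOn_invFunOn_of_compact [T2Space T] {c : ℝ → T} {K : Set ℝ} (hK : IsCompact K)
    (hc : ContinuousOn c K) (hi : InjOn c K) : ContinuousOn (Function.invFunOn c K) (c '' K) := by
  rw [continuousOn_iff_isClosed]
  intro t ht
  refine ⟨c '' (K ∩ t), ((hK.inter_right ht).image_of_continuousOn
    (hc.mono inter_subset_left)).isClosed, ?_⟩
  ext y
  constructor
  · rintro ⟨hy, r, hr, rfl⟩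
    rw [mem_preimage, hi.leftInvOn_invFunOn hr] at hy
    exact ⟨⟨r, ⟨hr, hy⟩, rfl⟩, r, hr, rfl⟩
  · rintro ⟨⟨r, hr, rfl⟩, -⟩
    refine ⟨?_, r, hr.1, rfl⟩
    rw [mem_preimage, hi.leftInvOn_invFunOn hr.1]
    exact hr.2

/-- **An open arc separates a simply connected space.** The far side `V` of an arc `c` whose
interior is open in the space is open, and closed up to the starting point of `c`. It is found by
collapsing the complement of the open arc to the base point of a circle and lifting the resulting
map to the line. -/
theorem exists_arc_side [T2Space T] [SimplyConnectedSpace T] [LocallyPathConnectedSpace T] {ρ : ℝ}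
    (hρ : 0 < ρ) {c : ℝ → T} (hc : ContinuousOn c (Icc 0 ρ)) (hi : InjOn c (Icc 0 ρ))
    (ho : IsOpen (c '' Ioo 0 ρ)) :
    ∃ V : Set T, IsOpen V ∧ IsClosed (insert (c 0) V) ∧ c 0 ∉ V ∧ c '' Ioc 0 ρ ⊆ V ∧
      ∃ N ∈ 𝓝 (c 0), N ∩ V ⊆ c '' Ioo 0 ρ := by
  classical
  have hP : IsClosed (c '' Icc 0 ρ) := (isCompact_Icc.image_of_continuousOn hc).isClosed
  let κ : T → AddCircle (1 : ℝ) := fun y =>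
    if y ∈ c '' Ioo 0 ρ then ((Function.invFunOn c (Icc 0 ρ) y / ρ : ℝ) : AddCircle (1 : ℝ)) else 0
  have hinv : ∀ r ∈ Icc 0 ρ, Function.invFunOn c (Icc 0 ρ) (c r) = r := hi.leftInvOn_invFunOn
  have hone : ((1 : ℝ) : AddCircle (1 : ℝ)) = 0 := AddCircle.coe_period 1
  have hκ : ∀ r ∈ Icc 0 ρ, κ (c r) = ((r / ρ : ℝ) : AddCircle (1 : ℝ)) := fun r hr => by
    by_cases h : c r ∈ c '' Ioo 0 ρ
    · simp only [κ, if_pos h, hinv r hr]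
    · simp only [κ, if_neg h]
      rcases eq_or_lt_of_le hr.1 with h0 | h0
      · simp [← h0]
      rcases eq_or_lt_of_le hr.2 with h1 | h1
      · rw [h1, div_self hρ.ne', hone]
      · exact absurd ⟨r, ⟨h0, h1⟩, rfl⟩ h
  have hκc : Continuous κ := by
    rw [← continuousOn_univ, ← union_compl_self (c '' Ioo 0 ρ)]
    refine (ContinuousOn.union_of_isClosed ?_ ?_ hP ho.isClosed_compl).mono
      (union_subset_union_left _ (image_mono Ioo_subset_Icc_self))
    · have h1 : ContinuousOn (fun y => ((Function.invFunOn c (Icc 0 ρ) y / ρ : ℝ) :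
          AddCircle (1 : ℝ))) (c '' Icc 0 ρ) :=
        (AddCircle.continuous_mk' (1 : ℝ)).comp_continuousOn
          ((continuousOn_invFunOn_of_compact isCompact_Icc hc hi).div_const ρ)
      refine h1.congr ?_
      rintro _ ⟨r, hr, rfl⟩
      simp only [hκ r hr, hinv r hr]
    · exact continuousOn_const.congr fun y hy => if_neg hy
  have h0ρ : (0 : ℝ) ∈ Icc 0 ρ := ⟨le_rfl, hρ.le⟩
  obtain ⟨h, ⟨hh0, hh⟩, -⟩ := (AddCircle.isCoveringMap_coe (1 : ℝ)).existsUnique_continuousMap_lifts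
    ⟨κ, hκc⟩ (c 0) 0 (by simp [hκ 0 h0ρ])
  have hhκ : ∀ y, ((h y : ℝ) : AddCircle (1 : ℝ)) = κ y := fun y => congrFun hh y
  have hhc : ∀ r ∈ Icc 0 ρ, h (c r) = r / ρ := by
    refine (AddCircle.isCoveringMap_coe (1 : ℝ)).eqOn_of_comp_eqOn isPreconnected_Icc
      (h.continuous.comp_continuousOn hc) (by fun_prop) (fun r hr => ?_) h0ρ (by simp [hh0])
    exact (hhκ (c r)).trans (hκ r hr)
  have hint : ∀ y ∉ c '' Ioo 0 ρ, ∃ n : ℤ, h y = n := fun y hy => by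
    have h1 := hhκ y
    simp only [κ, if_neg hy] at h1
    obtain ⟨n, hn⟩ := (AddCircle.coe_eq_zero_iff (1 : ℝ)).1 h1
    exact ⟨n, by rw [← hn]; simp⟩
  refine ⟨{y | 0 < h y}, isOpen_lt continuous_const h.continuous, ?_, by simp [hh0], ?_,
    {y | h y < 1}, (isOpen_lt h.continuous continuous_const).mem_nhds (by simp [hh0]), ?_⟩
  · have hV : (insert (c 0) {y | 0 < h y})ᶜ = (c '' Icc 0 ρ)ᶜ ∩ {y | h y < 1} := by
      ext y
      simp only [mem_compl_iff, mem_insert_iff, mem_ofPred_eq, not_or, not_lt, mem_inter_iff]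
      constructor
      · rintro ⟨hy, hy'⟩
        refine ⟨?_, by linarith⟩
        rintro ⟨r, hr, rfl⟩
        rw [hhc r hr, div_nonpos_iff] at hy'
        rcases hy' with h | h
        · linarith
        · exact hy (by rw [le_antisymm h.1 hr.1])
      · rintro ⟨hy, hy'⟩
        refine ⟨fun h => hy ⟨0, h0ρ, h.symm⟩, ?_⟩
        obtain ⟨n, hn⟩ := hint y fun h => hy (image_mono Ioo_subset_Icc_self h)
        rw [hn] at hy' ⊢
        have : n < 1 := by exact_mod_cast hy'
        exact_mod_cast Int.lt_add_one_iff.1 this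
    rw [← isOpen_compl_iff, hV]
    exact hP.isOpen_compl.inter (isOpen_lt h.continuous continuous_const)
  · rintro _ ⟨r, hr, rfl⟩
    rw [mem_ofPred_eq, hhc r ⟨hr.1.le, hr.2⟩]
    exact div_pos hr.1 hρ
  · rintro y ⟨hy1, hy0⟩
    by_contra hcon
    obtain ⟨n, hn⟩ := hint y hcon
    rw [mem_ofPred_eq, hn] at hy1 hy0
    have h1 : n < 1 := by exact_mod_cast hy1
    have h0 : 0 < n := by exact_mod_cast hy0
    omega

/-- A set that is open, and closed up to the point `a`, contains every connected set that meets
it and avoids `a`. -/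
theorem IsPreconnected.subset_of_isClosed_insert {V S : Set T} {a : T} (hV : IsOpen V)
    (hVc : IsClosed (insert a V)) (hS : IsPreconnected S) (ha : a ∉ S) (hSV : (S ∩ V).Nonempty) :
    S ⊆ V := by
  refine hS.subset_left_of_subset_union hV hVc.isOpen_compl ?_ (fun y hy => ?_) hSV
  · exact disjoint_compl_right.mono_left (subset_insert _ _)
  · by_cases h : y ∈ V
    · exact Or.inl h
    · refine Or.inr fun h' => ?_
      rcases h' with h' | h'
      · exact ha (h' ▸ hy)
      · exact h h'

/-- Between the starting point `a` and the end point `a₁` of an open arc there is nothing but the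
arc: the side of `a₁` containing `a` meets the side of `a` containing `a₁` in the arc only. -/
theorem connectedComponentIn_inter_subset_arc [T2Space T] [SimplyConnectedSpace T]
    [LocallyPathConnectedSpace T] {ρ : ℝ} (hρ : 0 < ρ) {c : ℝ → T} (hc : ContinuousOn c (Icc 0 ρ))
    (hi : InjOn c (Icc 0 ρ)) (ho : IsOpen (c '' Ioo 0 ρ)) :
    connectedComponentIn {c ρ}ᶜ (c 0) ∩ connectedComponentIn {c 0}ᶜ (c ρ) ⊆ c '' Ioo 0 ρ := by
  obtain ⟨V, hV, hVc, h0V, hcV, N, hN, hNV⟩ := exists_arc_side hρ hc hi ho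
  obtain ⟨N', hN'N, hN'o, h0N'⟩ := mem_nhds_iff.1 hN
  have h0ρ : c 0 ≠ c ρ := fun h => hρ.ne (hi ⟨le_rfl, hρ.le⟩ ⟨hρ.le, le_rfl⟩ h)
  have hcl := isClosed_insert_connectedComponentIn (c 0) (c ρ)
  have hδo : IsOpen (connectedComponentIn {c 0}ᶜ (c ρ)) :=
    isOpen_compl_singleton.connectedComponentIn
  have hδV : connectedComponentIn {c 0}ᶜ (c ρ) ⊆ V := by
    refine isPreconnected_connectedComponentIn.subset_of_isClosed_insert hV hVc
      (fun h => connectedComponentIn_subset _ _ h rfl) ⟨c ρ, mem_connectedComponentIn h0ρ.symm, ?_⟩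
    exact hcV ⟨ρ, ⟨hρ, le_rfl⟩, rfl⟩
  set δ := connectedComponentIn {c 0}ᶜ (c ρ)
  have hPc : IsClosed (c '' Icc 0 ρ) := (isCompact_Icc.image_of_continuousOn hc).isClosed
  have hsub : connectedComponentIn {c ρ}ᶜ (c 0) ⊆ c '' Ioo 0 ρ ∪ ((insert (c 0) δ)ᶜ ∪ N') := by
    refine isPreconnected_connectedComponentIn.subset_right_of_subset_union
      (hδo.sdiff hPc) (ho.union (hcl.isOpen_compl.union hN'o)) ?_ (fun y hy => ?_)
      ⟨c 0, mem_connectedComponentIn h0ρ, Or.inr (Or.inr h0N')⟩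
    · rw [Set.disjoint_left]
      rintro y ⟨hy, hy'⟩ (h | h | h)
      · exact hy' (image_mono Ioo_subset_Icc_self h)
      · exact h (Or.inr hy)
      · exact hy' (image_mono Ioo_subset_Icc_self (hNV ⟨hN'N h, hδV hy⟩))
    · by_cases hyδ : y ∈ δ
      · by_cases hyP : y ∈ c '' Icc 0 ρ
        · right
          left
          obtain ⟨r, hr, rfl⟩ := hyP
          refine ⟨r, ⟨lt_of_le_of_ne hr.1 ?_, lt_of_le_of_ne hr.2 ?_⟩, rfl⟩
          · rintro rfl
            exact h0V (hδV hyδ)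
          · rintro rfl
            exact connectedComponentIn_subset _ _ hy rfl
        · exact Or.inl ⟨hyδ, hyP⟩
      · right
        right
        by_cases hy0 : y = c 0
        · exact Or.inr (hy0 ▸ h0N')
        · left
          rintro (h | h)
          · exact hy0 h
          · exact hyδ h
  rintro y ⟨hy, hyδ⟩
  rcases hsub hy with h | h | h
  · exact h
  · exact absurd (Or.inr hyδ) h
  · exact hNV ⟨hN'N h, hδV hyδ⟩

end Directions

/-! ### Stars in a bouquet of circles -/

section Bouquet

variable {g : ℕ}

/-- The germs of arcs issuing from a point `b` of the bouquet: a coordinate circle that contains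
`b` and one of its two orientations. -/
abbrev Leg (b : bouquet g) : Type :=
  {l : Fin g × Bool // ∀ j ≠ l.1, (b : Fin g → UnitAddCircle) j = 0}

/-- The real number `r` with the sign of the orientation `o`. -/
def orient (o : Bool) (r : ℝ) : ℝ := if o then r else -r

theorem abs_orient (o : Bool) (r : ℝ) : |orient o r| = |r| := by
  cases o <;> simp [orient]

theorem orient_sub (o : Bool) (r r' : ℝ) : orient o r - orient o r' = orient o (r - r') := by
  cases o <;> simp [orient]; ring

theorem continuous_orient (o : Bool) : Continuous (orient o) := by
  cases o
  · exact continuous_neg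
  · exact continuous_id

/-- The ray that winds around a coordinate circle of the bouquet at unit speed. -/
def legPath (b : bouquet g) (l : Leg b) (r : ℝ) : bouquet g :=
  ⟨(b : Fin g → UnitAddCircle) + Pi.single l.1.1 ((orient l.1.2 r : ℝ) : UnitAddCircle), by
    have h : ∀ i, (((b : Fin g → UnitAddCircle) +
        Pi.single l.1.1 ((orient l.1.2 r : ℝ) : UnitAddCircle) : Fin g → UnitAddCircle) i ≠ 0 →
        i = l.1.1) := fun i hi => by
      by_contra h
      exact hi (by simp [Pi.single_eq_of_ne h, l.2 i h])
    intro i j hi hj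
    rw [h i hi, h j hj]⟩

theorem coe_legPath (b : bouquet g) (l : Leg b) (r : ℝ) :
    (legPath b l r : Fin g → UnitAddCircle) =
      (b : Fin g → UnitAddCircle) + Pi.single l.1.1 ((orient l.1.2 r : ℝ) : UnitAddCircle) := rfl

theorem continuous_legPath (b : bouquet g) (l : Leg b) : Continuous (legPath b l) := by
  refine Continuous.subtype_mk (continuous_const.add ?_) _
  refine (continuous_single l.1.1).comp ?_
  exact (AddCircle.continuous_mk' (1 : ℝ)).comp (continuous_orient _)

theorem legPath_zero (b : bouquet g) (l : Leg b) : legPath b l 0 = b := by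
  apply Subtype.ext
  rw [coe_legPath]
  have : orient l.1.2 0 = 0 := by simp [orient]
  simp [this]

theorem norm_coe_unitAddCircle {r : ℝ} (hr : |r| ≤ 1 / 2) : ‖(r : UnitAddCircle)‖ = |r| :=
  (AddCircle.norm_coe_eq_abs_iff (1 : ℝ) one_ne_zero).2 (by simpa using hr)

theorem dist_legPath (b : bouquet g) (l : Leg b) {r r' : ℝ} (h : |r - r'| ≤ 1 / 2) :
    dist (legPath b l r) (legPath b l r') = |r - r'| := by
  rw [Subtype.dist_eq, coe_legPath, coe_legPath, dist_add_left, dist_eq_norm, ← Pi.single_sub,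
    Pi.norm_single, ← AddCircle.coe_sub, orient_sub, norm_coe_unitAddCircle (by rwa [abs_orient]),
    abs_orient]

theorem legPath_inj (b : bouquet g) {l l' : Leg b} {r r' : ℝ} (hr : r ∈ Ioc 0 (1 / 4))
    (hr' : r' ∈ Ioc 0 (1 / 4)) (h : legPath b l r = legPath b l' r') : l = l' ∧ r = r' := by
  have h1 := congrArg (fun y : bouquet g => (y : Fin g → UnitAddCircle)) h
  simp only [coe_legPath, add_right_inj] at h1
  have hn : ∀ (o : Bool) {u : ℝ}, u ∈ Ioc (0 : ℝ) (1 / 2) →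
      ((orient o u : ℝ) : UnitAddCircle) ≠ 0 := fun o u hu h0 => by
    have := norm_coe_unitAddCircle (r := orient o u) (by
      rw [abs_orient, abs_of_pos hu.1]; exact hu.2)
    rw [h0, norm_zero, abs_orient, abs_of_pos hu.1] at this
    linarith [hu.1]
  have hl : l.1.1 = l'.1.1 := by
    by_contra hne
    have h2 := congrFun h1 l.1.1
    rw [Pi.single_eq_same, Pi.single_eq_of_ne hne] at h2
    exact hn _ ⟨hr.1, by linarith [hr.2]⟩ h2
  rw [hl] at h1
  have h2 := Pi.single_injective _ h1
  rw [← sub_eq_zero, ← AddCircle.coe_sub] at h2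
  obtain ⟨⟨i, o⟩, hi⟩ := l
  obtain ⟨⟨i', o'⟩, hi'⟩ := l'
  obtain rfl : i = i' := hl
  simp only at h2
  have h0 : ∀ u : ℝ, |u| ≤ 1 / 2 → (u : UnitAddCircle) = 0 → u = 0 := fun u hu h => by
    have := norm_coe_unitAddCircle hu
    rw [h, norm_zero] at this
    exact abs_eq_zero.1 this.symm
  have h3 := h0 _ (abs_le.2 (by
    cases o <;> cases o' <;> simp only [orient] <;> constructor <;>
      simp <;> linarith [hr.1, hr.2, hr'.1, hr'.2])) h2
  cases o <;> cases o' <;> simp [orient] at h3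
  · exact ⟨rfl, by linarith⟩
  · linarith [hr.1, hr'.1]
  · linarith [hr.1, hr'.1]
  · exact ⟨rfl, by linarith⟩

/-- Every element of the circle is represented by `± r`, with `r` its distance to zero. -/
theorem exists_orient_eq (u : UnitAddCircle) : ∃ o, ((orient o ‖u‖ : ℝ) : UnitAddCircle) = u := by
  induction u using QuotientAddGroup.induction_on with
  | H z =>
    have h1 : ‖((z : ℝ) : UnitAddCircle)‖ = |z - round z| := UnitAddCircle.norm_eq
    have h2 : ((z - round z : ℝ) : UnitAddCircle) = z := by
      rw [AddCircle.coe_sub]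
      have : (((round z : ℤ) : ℝ) : UnitAddCircle) = 0 :=
        (AddCircle.coe_eq_zero_iff (1 : ℝ)).2 ⟨round z, by simp⟩
      rw [this, sub_zero]
    rcases abs_cases (z - round z) with h | h
    · exact ⟨true, by rw [← h2]; rw [h2]; simp only [orient, if_true]; erw [h1]; rw [h.1]; exact h2⟩
    · refine ⟨false, ?_⟩
      simp only [orient]
      erw [h1]
      rw [h.1]
      simp

/-- Near each of its points the bouquet is a star, the union of the finitely many legs. -/
theorem exists_star (b : bouquet g) : ∃ ρ : ℝ, 0 < ρ ∧ ρ ≤ 1 / 4 ∧ ∀ y ∈ Metric.ball b ρ,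
    y = b ∨ ∃ l : Leg b, ∃ r ∈ Ioo 0 ρ, y = legPath b l r := by
  have key : ∀ ρ : ℝ, ∀ y ∈ Metric.ball b ρ, ∀ i, (∀ j ≠ i, (b : Fin g → UnitAddCircle) j = 0) →
      (∀ j ≠ i, (y : Fin g → UnitAddCircle) j = 0) →
      y = b ∨ ∃ l : Leg b, ∃ r ∈ Ioo 0 ρ, y = legPath b l r := by
    intro ρ y hy i hb hyi
    obtain ⟨o, ho⟩ := exists_orient_eq ((y : Fin g → UnitAddCircle) i - (b : _ → UnitAddCircle) i)
    have hyb : (y : Fin g → UnitAddCircle) = (b : Fin g → UnitAddCircle) +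
        Pi.single i ((y : Fin g → UnitAddCircle) i - (b : _ → UnitAddCircle) i) := by
      ext j
      by_cases hj : j = i
      · subst hj; simp
      · simp [Pi.single_eq_of_ne hj, hb j hj, hyi j hj]
    by_cases h0 : ‖(y : Fin g → UnitAddCircle) i - (b : _ → UnitAddCircle) i‖ = 0
    · left
      apply Subtype.ext
      rw [hyb, norm_eq_zero.1 h0]
      simp
    · refine Or.inr ⟨⟨(i, o), hb⟩, _, ⟨lt_of_le_of_ne (norm_nonneg _) (Ne.symm h0), ?_⟩, ?_⟩
      · refine lt_of_le_of_lt ?_ (Metric.mem_ball.1 hy)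
        rw [← dist_eq_norm]
        exact dist_le_pi_dist (y : Fin g → UnitAddCircle) b i
      · apply Subtype.ext
        rw [coe_legPath]
        simp only [ho]
        exact hyb
  by_cases hb : ∃ i, (b : Fin g → UnitAddCircle) i ≠ 0
  · obtain ⟨i, hi⟩ := hb
    have hpos : 0 < ‖(b : Fin g → UnitAddCircle) i‖ := norm_pos_iff.2 hi
    refine ⟨min (1 / 4) ‖(b : Fin g → UnitAddCircle) i‖, lt_min (by norm_num) hpos,
      min_le_left _ _, fun y hy => key _ y hy i ?_ ?_⟩
    · intro j hj
      by_contra h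
      exact hj (b.2 j i h hi)
    · intro j hj
      by_contra h
      refine hj (y.2 j i h fun h0 => ?_)
      have h1 := dist_le_pi_dist (y : Fin g → UnitAddCircle) b i
      rw [h0, dist_zero_left] at h1
      exact absurd (Metric.mem_ball.1 hy) (not_lt.2 ((min_le_right _ _).trans h1))
  · push Not at hb
    refine ⟨1 / 4, by norm_num, le_rfl, fun y hy => ?_⟩
    by_cases hy0 : ∃ i, (y : Fin g → UnitAddCircle) i ≠ 0
    · obtain ⟨i, hi⟩ := hy0
      refine key _ y hy i (fun j _ => hb j) fun j hj => ?_
      by_contra h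
      exact hj (y.2 j i h hi)
    · push Not at hy0
      exact Or.inl (Subtype.ext (funext fun i => by rw [hb i, hy0 i]))

theorem dist_legPath_self (b : bouquet g) (l : Leg b) {r : ℝ} (h0 : 0 ≤ r) (h : r ≤ 1 / 2) :
    dist (legPath b l r) b = r := by
  have := dist_legPath b l (r := r) (r' := 0) (by rwa [sub_zero, abs_of_nonneg h0])
  rwa [legPath_zero, sub_zero, abs_of_nonneg h0] at this

theorem injOn_legPath (b : bouquet g) (l : Leg b) : InjOn (legPath b l) (Icc 0 (1 / 4)) := by
  intro r hr r' hr' h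
  have hle : |r - r'| ≤ 1 / 2 := abs_le.2 ⟨by linarith [hr.1, hr'.2], by linarith [hr.2, hr'.1]⟩
  have := dist_legPath b l hle
  rw [h, dist_self] at this
  linarith [abs_eq_zero.1 this.symm]

theorem legPath_ne_self (b : bouquet g) (l : Leg b) {r : ℝ} (h0 : 0 < r) (h : r ≤ 1 / 2) :
    legPath b l r ≠ b := fun h' => by
  have := dist_legPath_self b l h0.le h
  rw [h', dist_self] at this
  exact h0.ne this

theorem isOpen_image_legPath {b : bouquet g} {ρ : ℝ} (hρ : ρ ≤ 1 / 4)
    (hstar : ∀ y ∈ Metric.ball b ρ, y = b ∨ ∃ l : Leg b, ∃ r ∈ Ioo 0 ρ, y = legPath b l r)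
    (l : Leg b) : IsOpen (legPath b l '' Ioo 0 ρ) := by
  have h : legPath b l '' Ioo 0 ρ = Metric.ball b ρ \
      ({b} ∪ ⋃ l' ∈ {l' : Leg b | l' ≠ l}, legPath b l' '' Icc 0 ρ) := by
    apply Subset.antisymm
    · rintro _ ⟨r, hr, rfl⟩
      refine ⟨?_, ?_⟩
      · rw [Metric.mem_ball, dist_legPath_self b l hr.1.le (by linarith [hr.2])]
        exact hr.2
      · rintro (h | h)
        · exact legPath_ne_self b l hr.1 (by linarith [hr.2]) h
        · obtain ⟨l', hl', r', hr', h⟩ := mem_iUnion₂.1 h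
          rcases eq_or_lt_of_le hr'.1 with h0 | h0
          · rw [← h0, legPath_zero] at h
            exact legPath_ne_self b l hr.1 (by linarith [hr.2]) h.symm
          · exact hl' (legPath_inj b ⟨h0, by linarith [hr'.2]⟩ ⟨hr.1, by linarith [hr.2]⟩ h).1
    · rintro y ⟨hy, hy'⟩
      rcases hstar y hy with rfl | ⟨l', r, hr, rfl⟩
      · exact absurd (Or.inl rfl) hy'
      · by_cases hl : l' = l
        · subst hl
          exact ⟨r, hr, rfl⟩
        · refine absurd (Or.inr ?_) hy'
          exact mem_biUnion (show l' ∈ {l' : Leg b | l' ≠ l} from hl)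
            ⟨r, Ioo_subset_Icc_self hr, rfl⟩
  rw [h]
  refine Metric.isOpen_ball.sdiff (isClosed_singleton.union ?_)
  exact (toFinite _).isClosed_biUnion fun l' _ =>
    (isCompact_Icc.image (continuous_legPath b l')).isClosed

end Bouquet

/-! ### Sections of coverings -/

/-- Over a neighbourhood `U` of `b` there is a section through every point above `b`, with open
images of open sets, and a connected set above `U` lies in the image of one of the sections. -/
theorem IsCoveringMap.exists_sections {T B : Type*} [TopologicalSpace T] [TopologicalSpace B]
    {q : T → B} (hq : IsCoveringMap q) (b : B) :
    ∃ U ∈ 𝓝 b, ∃ sec : T → B → T,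
      (∀ a, q a = b → ContinuousOn (sec a) U ∧ (∀ y ∈ U, q (sec a y) = y) ∧ sec a b = a ∧
        ∀ V ⊆ U, IsOpen V → IsOpen (sec a '' V)) ∧
      ∀ C ⊆ q ⁻¹' U, IsPreconnected C → C.Nonempty → ∃ a, q a = b ∧ ∀ y ∈ C, sec a (q y) = y := by
  classical
  obtain ⟨hd, U, hbU, hU, hqU, H, hH⟩ := hq b
  by_cases hne : Nonempty T
  swap
  · exact ⟨univ, univ_mem, fun a => (hne ⟨a⟩).elim, fun a => (hne ⟨a⟩).elim,
      fun C _ _ ⟨y, _⟩ => (hne ⟨y⟩).elim⟩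
  let i₀ := fun a : T => if h : a ∈ q ⁻¹' U then some (H ⟨a, h⟩).2 else none
  let sec : T → B → T := fun a y => if h : a ∈ q ⁻¹' U ∧ y ∈ U then
    (H.symm (⟨y, h.2⟩, (H ⟨a, h.1⟩).2) : T) else a
  have hs : ∀ a (ha : a ∈ q ⁻¹' U) y (hy : y ∈ U), sec a y = H.symm (⟨y, hy⟩, (H ⟨a, ha⟩).2) :=
    fun a ha y hy => dif_pos ⟨ha, hy⟩
  have hH' : ∀ z, q (H.symm z : T) = z.1 := fun z => by
    have := hH (H.symm z)
    rw [H.apply_symm_apply] at this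
    exact this.symm
  refine ⟨U, hU.mem_nhds hbU, sec, fun a ha => ?_, fun C hC hpre hCne => ?_⟩
  · have haU : a ∈ q ⁻¹' U := by rw [mem_preimage, ha]; exact hbU
    have hq' : ∀ y ∈ U, q (sec a y) = y := fun y hy => by rw [hs a haU y hy, hH']
    have hc : ContinuousOn (sec a) U := by
      rw [continuousOn_iff_continuous_domRestrict]
      have : U.domRestrict (sec a) = fun y => (H.symm (y, (H ⟨a, haU⟩).2) : T) :=
        funext fun y => hs a haU y y.2
      rw [this]
      exact continuous_subtype_val.comp (H.symm.continuous.comp (by fun_prop))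
    refine ⟨hc, hq', ?_, ?_⟩
    · rw [hs a haU b hbU]
      have h1 : ((⟨b, hbU⟩ : U), (H ⟨a, haU⟩).2) = H ⟨a, haU⟩ := by
        apply Prod.ext
        · exact Subtype.ext ((hH ⟨a, haU⟩).trans ha).symm
        · rfl
      rw [h1, H.symm_apply_apply]
    · intro V hV hVo
      have h1 : sec a '' V = (↑) '' (H ⁻¹' (((↑) ⁻¹' V : Set U) ×ˢ {(H ⟨a, haU⟩).2})) := by
        apply Subset.antisymm
        · rintro _ ⟨y, hy, rfl⟩
          rw [hs a haU y (hV hy)]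
          exact ⟨_, by simp [hy], rfl⟩
        · rintro _ ⟨z, ⟨hz1, hz2⟩, rfl⟩
          refine ⟨(H z).1, hz1, ?_⟩
          rw [hs a haU _ (H z).1.2, ← (hz2 : (H z).2 = _)]
          simp
      rw [h1]
      refine hqU.isOpenMap_subtype_val _ (H.continuous.isOpen_preimage _ ?_)
      exact (hVo.preimage continuous_subtype_val).prod (isOpen_discrete _)
  · obtain ⟨x, hx⟩ := hCne
    let k : q ⁻¹' U → q ⁻¹' {b} := fun y => (H y).2
    have hconst : ∀ y (hy : y ∈ C), (H ⟨y, hC hy⟩).2 = (H ⟨x, hC hx⟩).2 := by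
      intro y hy
      have hpre' : IsPreconnected ((↑) ⁻¹' C : Set (q ⁻¹' U)) := by
        rw [Topology.IsInducing.subtypeVal.isPreconnected_image.symm, Subtype.image_preimage_coe,
          inter_eq_right.2 hC]
        exact hpre
      exact hpre'.constant (f := fun z => (H z).2) (by fun_prop) (x := ⟨y, hC hy⟩)
        (y := ⟨x, hC hx⟩) hy hx
    refine ⟨H.symm (⟨b, hbU⟩, (H ⟨x, hC hx⟩).2), hH' _, fun y hy => ?_⟩
    rw [hs _ (H.symm _).2 _ (hC hy)]
    simp only [Subtype.coe_eta, H.apply_symm_apply]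
    have h1 : ((⟨q y, hC hy⟩ : U), (H ⟨x, hC hx⟩).2) = H ⟨y, hC hy⟩ := by
      apply Prod.ext
      · exact Subtype.ext (hH ⟨y, hC hy⟩).symm
      · exact (hconst y hy).symm
    rw [h1, H.symm_apply_apply]

/-! ### Stars in a covering space of a bouquet -/

section Star

variable {g : ℕ} {T : Type*} [TopologicalSpace T] {q : T → bouquet g}

/-- The ball of radius `ρ` about `b` is a star, evenly covered by `q`: `sec a` is the section of `q`
over this ball through the point `a` above `b`. -/
structure IsStar (q : T → bouquet g) (b : bouquet g) (ρ : ℝ) (sec : T → bouquet g → T) : Prop where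
  pos : 0 < ρ
  le : ρ ≤ 1 / 4
  star : ∀ y ∈ Metric.ball b ρ, y = b ∨ ∃ l : Leg b, ∃ r ∈ Ioo 0 ρ, y = legPath b l r
  continuousOn : ∀ a, q a = b → ContinuousOn (sec a) (Metric.ball b ρ)
  proj : ∀ a, q a = b → ∀ y ∈ Metric.ball b ρ, q (sec a y) = y
  base : ∀ a, q a = b → sec a b = a
  isOpen_image : ∀ a, q a = b → ∀ V ⊆ Metric.ball b ρ, IsOpen V → IsOpen (sec a '' V)
  sheet : ∀ C ⊆ q ⁻¹' Metric.ball b ρ, IsPreconnected C → C.Nonempty →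
    ∃ a, q a = b ∧ ∀ y ∈ C, sec a (q y) = y

theorem IsStar.mono {b : bouquet g} {ρ : ℝ} {sec : T → bouquet g → T} (hs : IsStar q b ρ sec)
    {ρ' : ℝ} (h0 : 0 < ρ') (h : ρ' ≤ ρ) : IsStar q b ρ' sec where
  pos := h0
  le := h.trans hs.le
  star y hy := by
    refine (hs.star y (Metric.ball_subset_ball h hy)).imp id ?_
    rintro ⟨l, r, hr, rfl⟩
    rw [Metric.mem_ball, dist_legPath_self b l hr.1.le (by linarith [hr.2, hs.le])] at hy
    exact ⟨l, r, ⟨hr.1, hy⟩, rfl⟩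
  continuousOn a ha := (hs.continuousOn a ha).mono (Metric.ball_subset_ball h)
  proj a ha y hy := hs.proj a ha y (Metric.ball_subset_ball h hy)
  base := hs.base
  isOpen_image a ha V hV := hs.isOpen_image a ha V (hV.trans (Metric.ball_subset_ball h))
  sheet C hC := hs.sheet C (hC.trans (preimage_mono (Metric.ball_subset_ball h)))

theorem IsCoveringMap.exists_isStar (hq : IsCoveringMap q) (b : bouquet g) :
    ∃ ρ sec, IsStar q b ρ sec := by
  obtain ⟨ρ₁, hρ₁, hle, hstar⟩ := exists_star b
  obtain ⟨U, hU, sec, hsec, hsheet⟩ := hq.exists_sections b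
  obtain ⟨ρ₂, hρ₂, hball⟩ := Metric.mem_nhds_iff.1 hU
  have h1 : Metric.ball b (min ρ₁ ρ₂) ⊆ Metric.ball b ρ₁ := Metric.ball_subset_ball (min_le_left _ _)
  have h2 : Metric.ball b (min ρ₁ ρ₂) ⊆ U :=
    (Metric.ball_subset_ball (min_le_right _ _)).trans hball
  refine ⟨min ρ₁ ρ₂, sec, lt_min hρ₁ hρ₂, (min_le_left _ _).trans hle, fun y hy => ?_,
    fun a ha => (hsec a ha).1.mono h2, fun a ha y hy => (hsec a ha).2.1 y (h2 hy),
    fun a ha => (hsec a ha).2.2.1, fun a ha V hV => (hsec a ha).2.2.2 V (hV.trans h2),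
    fun C hC => hsheet C (hC.trans (preimage_mono h2))⟩
  refine (hstar y (h1 hy)).imp id ?_
  rintro ⟨l, r, hr, rfl⟩
  rw [Metric.mem_ball, dist_legPath_self b l hr.1.le (by linarith [hr.2])] at hy
  exact ⟨l, r, ⟨hr.1, hy⟩, rfl⟩

theorem IsCoveringMap.t2Space_of_bouquet (hq : IsCoveringMap q) : T2Space T := by
  refine ⟨fun x y hxy => ?_⟩
  by_cases h : q x = q y
  · exact hq.isSeparatedMap x y h hxy
  · obtain ⟨u, v, hu, hv, hxu, hyv, huv⟩ := t2_separation h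
    exact ⟨q ⁻¹' u, q ⁻¹' v, hu.preimage hq.continuous, hv.preimage hq.continuous, hxu, hyv,
      huv.preimage q⟩

variable {b : bouquet g} {ρ : ℝ} {sec : T → bouquet g → T} {a : T}

namespace IsStar

theorem legPath_mem_ball (hs : IsStar q b ρ sec) (l : Leg b) {r : ℝ} (hr : r ∈ Ico 0 ρ) :
    legPath b l r ∈ Metric.ball b ρ := by
  rw [Metric.mem_ball, dist_legPath_self b l hr.1 (by linarith [hr.2, hs.le])]
  exact hr.2

theorem center_mem_ball (hs : IsStar q b ρ sec) : b ∈ Metric.ball b ρ :=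
  Metric.mem_ball_self hs.pos

theorem proj_leg (hs : IsStar q b ρ sec) (ha : q a = b) (l : Leg b) {r : ℝ} (hr : r ∈ Ico 0 ρ) :
    q (sec a (legPath b l r)) = legPath b l r :=
  hs.proj a ha _ (hs.legPath_mem_ball l hr)

theorem leg_zero (hs : IsStar q b ρ sec) (ha : q a = b) (l : Leg b) :
    sec a (legPath b l 0) = a := by
  rw [legPath_zero, hs.base a ha]

theorem leg_ne (hs : IsStar q b ρ sec) (ha : q a = b) (l : Leg b) {r : ℝ} (hr : r ∈ Ioo 0 ρ) :
    sec a (legPath b l r) ≠ a := fun h => by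
  have h1 := hs.proj_leg ha l (Ioo_subset_Ico_self hr)
  rw [h, ha] at h1
  exact legPath_ne_self b l hr.1 (by linarith [hr.2, hs.le]) h1.symm

theorem leg_inj (hs : IsStar q b ρ sec) (ha : q a = b) {l l' : Leg b} {r r' : ℝ}
    (hr : r ∈ Ioo 0 ρ) (hr' : r' ∈ Ioo 0 ρ)
    (h : sec a (legPath b l r) = sec a (legPath b l' r')) : l = l' ∧ r = r' := by
  have h1 := congrArg q h
  rw [hs.proj_leg ha l (Ioo_subset_Ico_self hr), hs.proj_leg ha l' (Ioo_subset_Ico_self hr')] at h1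
  exact legPath_inj b ⟨hr.1, by linarith [hr.2, hs.le]⟩ ⟨hr'.1, by linarith [hr'.2, hs.le]⟩ h1

theorem continuousOn_leg (hs : IsStar q b ρ sec) (ha : q a = b) (l : Leg b) :
    ContinuousOn (fun r => sec a (legPath b l r)) (Ico 0 ρ) :=
  (hs.continuousOn a ha).comp (continuous_legPath b l).continuousOn
    fun _ hr => hs.legPath_mem_ball l hr

theorem injOn_leg (hs : IsStar q b ρ sec) (ha : q a = b) (l : Leg b) :
    InjOn (fun r => sec a (legPath b l r)) (Ico 0 ρ) := by
  intro r hr r' hr' h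
  have h1 := congrArg q h
  rw [hs.proj_leg ha l hr, hs.proj_leg ha l hr'] at h1
  exact injOn_legPath b l ⟨hr.1, by linarith [hr.2, hs.le]⟩ ⟨hr'.1, by linarith [hr'.2, hs.le]⟩ h1

theorem isOpen_leg (hs : IsStar q b ρ sec) (ha : q a = b) (l : Leg b) {r : ℝ} (h0 : 0 < r)
    (hr : r ≤ ρ) : IsOpen ((fun r => sec a (legPath b l r)) '' Ioo 0 r) := by
  rw [← image_image]
  refine hs.isOpen_image a ha _ ?_ (isOpen_image_legPath (hr.trans hs.le) (hs.mono h0 hr).star l)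
  rintro _ ⟨u, hu, rfl⟩
  exact hs.legPath_mem_ball l ⟨hu.1.le, hu.2.trans_le hr⟩

theorem image_ball_mem_nhds (hs : IsStar q b ρ sec) (ha : q a = b) :
    sec a '' Metric.ball b ρ ∈ 𝓝 a :=
  (hs.isOpen_image a ha _ subset_rfl Metric.isOpen_ball).mem_nhds
    ⟨b, hs.center_mem_ball, hs.base a ha⟩

theorem exists_image_ball_subset (hs : IsStar q b ρ sec) (ha : q a = b) {N : Set T}
    (hN : N ∈ 𝓝 a) : ∃ ρ', 0 < ρ' ∧ ρ' ≤ ρ ∧ sec a '' Metric.ball b ρ' ⊆ N := by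
  have hc : ContinuousAt (sec a) b :=
    (hs.continuousOn a ha).continuousAt (Metric.isOpen_ball.mem_nhds hs.center_mem_ball)
  rw [ContinuousAt, hs.base a ha] at hc
  obtain ⟨ε, hε, h⟩ := Metric.mem_nhds_iff.1 (hc hN)
  refine ⟨min ε ρ, lt_min hε hs.pos, min_le_right _ _, ?_⟩
  rintro _ ⟨y, hy, rfl⟩
  exact h (Metric.ball_subset_ball (min_le_left _ _) hy)

theorem joinedIn_image_ball (hs : IsStar q b ρ sec) (ha : q a = b) {y : T}
    (hy : y ∈ sec a '' Metric.ball b ρ) : JoinedIn (sec a '' Metric.ball b ρ) a y := by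
  obtain ⟨y, hy, rfl⟩ := hy
  rcases hs.star y hy with rfl | ⟨l, r, hr, rfl⟩
  · rw [hs.base a ha]
    exact JoinedIn.refl ⟨y, hy, hs.base a ha⟩
  · have hsub : ∀ u ∈ I, u * r ∈ Ico 0 ρ := fun u hu =>
      ⟨mul_nonneg hu.1 hr.1.le, (mul_le_of_le_one_left hr.1.le hu.2).trans_lt hr.2⟩
    refine JoinedIn.ofLine (f := fun u => sec a (legPath b l (u * r)))
      ((hs.continuousOn_leg ha l).comp (f := fun u => u * r) (by fun_prop) hsub) ?_ (by simp) ?_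
    · simp [hs.leg_zero ha]
    · rintro _ ⟨u, hu, rfl⟩
      exact ⟨_, hs.legPath_mem_ball l (hsub u hu), rfl⟩

theorem isPathConnected_image_ball (hs : IsStar q b ρ sec) (ha : q a = b) :
    IsPathConnected (sec a '' Metric.ball b ρ) :=
  ⟨a, ⟨b, hs.center_mem_ball, hs.base a ha⟩, fun _ hy => hs.joinedIn_image_ball ha hy⟩

end IsStar

theorem IsCoveringMap.locallyPathConnectedSpace_of_bouquet (hq : IsCoveringMap q) :
    LocallyPathConnectedSpace T := by
  refine ⟨fun a => ⟨fun N => ⟨fun hN => ?_, ?_⟩⟩⟩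
  · obtain ⟨ρ, sec, hs⟩ := hq.exists_isStar (q a)
    obtain ⟨ρ', h0, h, hsub⟩ := hs.exists_image_ball_subset rfl hN
    exact ⟨_, ⟨(hs.mono h0 h).image_ball_mem_nhds rfl,
      (hs.mono h0 h).isPathConnected_image_ball rfl⟩, hsub⟩
  · rintro ⟨s, ⟨hs, -⟩, hsub⟩
    exact mem_of_superset hs hsub

namespace IsStar

variable [SimplyConnectedSpace T]

/-- Distinct legs lie in distinct components of the complement of the centre of the star. -/
theorem leg_notMem_component (hq : IsCoveringMap q) (hs : IsStar q b ρ sec) (ha : q a = b)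
    {l l' : Leg b} (hl : l ≠ l') {r r' : ℝ} (hr : r ∈ Ioo 0 ρ) (hr' : r' ∈ Ioo 0 ρ) :
    sec a (legPath b l' r') ∉ connectedComponentIn {a}ᶜ (sec a (legPath b l r)) := by
  have := hq.t2Space_of_bouquet
  have := hq.locallyPathConnectedSpace_of_bouquet
  obtain ⟨V, hV, hVc, h0, hcV, N, hN, hNV⟩ := exists_arc_side
    (c := fun u => sec a (legPath b l u)) hr.1
    ((hs.continuousOn_leg ha l).mono (Icc_subset_Ico_right hr.2))
    ((hs.injOn_leg ha l).mono (Icc_subset_Ico_right hr.2)) (hs.isOpen_leg ha l hr.1 hr.2.le)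
  simp only [hs.leg_zero ha] at h0 hN hVc
  have hsub : connectedComponentIn {a}ᶜ (sec a (legPath b l r)) ⊆ V :=
    isPreconnected_connectedComponentIn.subset_of_isClosed_insert hV hVc
      (fun h => connectedComponentIn_subset _ _ h rfl)
      ⟨_, mem_connectedComponentIn (hs.leg_ne ha l hr), hcV ⟨r, ⟨hr.1, le_rfl⟩, rfl⟩⟩
  intro h
  have hleg : (fun u => sec a (legPath b l' u)) '' Ioo 0 ρ ⊆ V := by
    refine IsPreconnected.subset_of_isClosed_insert hV hVc
      (isPreconnected_Ioo.image _ ((hs.continuousOn_leg ha l').mono Ioo_subset_Ico_self)) ?_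
      ⟨_, ⟨r', hr', rfl⟩, hsub h⟩
    rintro ⟨u, hu, hua⟩
    exact hs.leg_ne ha l' hu hua
  obtain ⟨ρ', hρ', hρ'ρ, hN'⟩ := hs.exists_image_ball_subset ha hN
  have hu : ρ' / 2 ∈ Ioo 0 ρ := ⟨by linarith, by linarith⟩
  obtain ⟨v, hv, hvu⟩ := hNV ⟨hN' ⟨_, (hs.mono hρ' hρ'ρ).legPath_mem_ball l'
    ⟨by linarith, by linarith⟩, rfl⟩, hleg ⟨ρ' / 2, hu, rfl⟩⟩
  exact hl (hs.leg_inj ha ⟨hv.1, hv.2.trans hr.2⟩ hu hvu).1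

/-- Every direction at the centre of a star contains exactly one leg. -/
theorem exists_leg (hq : IsCoveringMap q) (hs : IsStar q b ρ sec) (ha : q a = b) {x : T}
    (hx : x ≠ a) : ∃ l : Leg b,
      (∀ r ∈ Ioo 0 ρ, sec a (legPath b l r) ∈ connectedComponentIn {a}ᶜ x) ∧
      ∀ l' ≠ l, ∀ r ∈ Ioo 0 ρ, sec a (legPath b l' r) ∉ connectedComponentIn {a}ᶜ x := by
  have := hq.t2Space_of_bouquet
  have := hq.locallyPathConnectedSpace_of_bouquet
  have hδo : IsOpen (connectedComponentIn {a}ᶜ x) := isOpen_compl_singleton.connectedComponentIn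
  have hcl := isClosed_insert_connectedComponentIn a x
  have hxδ : x ∈ connectedComponentIn {a}ᶜ x := mem_connectedComponentIn hx
  have haδ : a ∉ connectedComponentIn {a}ᶜ x := fun h => connectedComponentIn_subset _ _ h rfl
  obtain ⟨l, r, hr, hlr⟩ : ∃ l : Leg b, ∃ r ∈ Ioo 0 ρ,
      sec a (legPath b l r) ∈ connectedComponentIn {a}ᶜ x := by
    by_contra! hcon
    have hN : sec a '' Metric.ball b ρ ∩ connectedComponentIn {a}ᶜ x = ∅ := by
      rw [eq_empty_iff_forall_notMem]
      rintro _ ⟨⟨y, hy, rfl⟩, hyδ⟩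
      rcases hs.star y hy with rfl | ⟨l, r, hr, rfl⟩
      · rw [hs.base a ha] at hyδ
        exact haδ hyδ
      · exact hcon l r hr hyδ
    have hclopen : IsClopen (connectedComponentIn {a}ᶜ x) := by
      refine ⟨?_, hδo⟩
      have : connectedComponentIn {a}ᶜ x =
          insert a (connectedComponentIn {a}ᶜ x) \ sec a '' Metric.ball b ρ := by
        apply Subset.antisymm
        · exact fun y hy => ⟨Or.inr hy, fun h => eq_empty_iff_forall_notMem.1 hN y ⟨h, hy⟩⟩
        · rintro y ⟨rfl | hy, hy'⟩
          · exact absurd (mem_of_mem_nhds (hs.image_ball_mem_nhds ha)) hy'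
          · exact hy
      rw [this]
      exact hcl.sdiff (hs.isOpen_image a ha _ subset_rfl Metric.isOpen_ball)
    rcases isClopen_iff.1 hclopen with h | h
    · exact (h ▸ hxδ : x ∈ (∅ : Set T))
    · exact haδ (h ▸ mem_univ a)
  have heq := connectedComponentIn_eq hlr
  refine ⟨l, fun u hu => ?_, fun l' hl' u hu => ?_⟩
  · rw [heq]
    refine (isPreconnected_Ioo.image (fun u => sec a (legPath b l u))
      ((hs.continuousOn_leg ha l).mono Ioo_subset_Ico_self)).subset_connectedComponentIn
      ⟨r, hr, rfl⟩ ?_ ⟨u, hu, rfl⟩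
    rintro _ ⟨v, hv, rfl⟩
    exact hs.leg_ne ha l hv
  · rw [heq]
    exact hs.leg_notMem_component hq ha hl'.symm hr hu

end IsStar

end Star

/-! ### Rays in the universal cover -/

section Rays

variable {g : ℕ} {T : Type*} [TopologicalSpace T] {q : T → bouquet g}

theorem IsStar.sec_eq_of_isPreconnected {b : bouquet g} {ρ : ℝ} {sec : T → bouquet g → T} {a : T}
    (hs : IsStar q b ρ sec) (ha : q a = b) {C : Set T} (hC : C ⊆ q ⁻¹' Metric.ball b ρ)
    (hpre : IsPreconnected C) (haC : a ∈ C) : ∀ y ∈ C, sec a (q y) = y := by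
  obtain ⟨a', ha', h⟩ := hs.sheet C hC hpre ⟨a, haC⟩
  have := h a haC
  rw [ha, hs.base a' ha'] at this
  rwa [← this]

theorem exists_pos_orient_eq (o : Bool) (u : UnitAddCircle) :
    ∃ t : ℝ, 0 < t ∧ ((orient o t : ℝ) : UnitAddCircle) = u := by
  induction u using QuotientAddGroup.induction_on with
  | H z =>
    have hint : ∀ n : ℤ, ((n : ℝ) : UnitAddCircle) = 0 := fun n =>
      (AddCircle.coe_eq_zero_iff (1 : ℝ)).2 ⟨n, by simp⟩
    obtain ⟨n, hn⟩ := exists_nat_gt |z|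
    have hz := abs_lt.1 hn
    cases o
    · refine ⟨n - z, by linarith, ?_⟩
      have := hint n
      simp only [orient, Bool.false_eq_true, if_false, neg_sub]
      rw [AddCircle.coe_sub]
      erw [this]
      rw [sub_zero]
    · refine ⟨z + n, by linarith, ?_⟩
      have := hint n
      simp only [orient, if_true]
      rw [AddCircle.coe_add]
      erw [this]
      rw [add_zero]

/-- The ray along a coordinate circle lifts to the universal cover. -/
theorem IsCoveringMap.exists_ray (hq : IsCoveringMap q) (a : T) (l : Leg (q a)) :
    ∃ c : C(ℝ, T), c 0 = a ∧ ∀ r, q (c r) = legPath (q a) l r := by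
  obtain ⟨c, ⟨h0, hc⟩, -⟩ := hq.existsUnique_continuousMap_lifts
    ⟨legPath (q a) l, continuous_legPath _ l⟩ 0 a (by simp [legPath_zero])
  exact ⟨c, h0, fun r => congrFun hc r⟩

/-- The coordinates of the bouquet lift to real functions on the universal cover. Along a ray, one
of them is affine and the others are constant. -/
theorem IsCoveringMap.exists_winding [SimplyConnectedSpace T] (hq : IsCoveringMap q) (i : Fin g) :
    ∃ h : T → ℝ, ∀ (a : T) (l : Leg (q a)) (c : C(ℝ, T)), c 0 = a →
      (∀ r, q (c r) = legPath (q a) l r) →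
      ∀ r, h (c r) = h a + if i = l.1.1 then orient l.1.2 r else 0 := by
  have := hq.locallyPathConnectedSpace_of_bouquet
  have hcov := AddCircle.isCoveringMap_coe (1 : ℝ)
  let a₀ : T := Classical.arbitrary T
  have hcont : Continuous fun y => (q y : Fin g → UnitAddCircle) i :=
    (continuous_apply i).comp (continuous_subtype_val.comp hq.continuous)
  obtain ⟨z, hz⟩ := QuotientAddGroup.mk_surjective ((q a₀ : Fin g → UnitAddCircle) i)
  obtain ⟨h, ⟨-, hh⟩, -⟩ := hcov.existsUnique_continuousMap_lifts ⟨_, hcont⟩ a₀ z hz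
  have hh' : ∀ y, ((h y : ℝ) : UnitAddCircle) = (q y : Fin g → UnitAddCircle) i :=
    fun y => congrFun hh y
  refine ⟨h, fun a l c h0 hc => ?_⟩
  have hor : Continuous (orient l.1.2) := continuous_orient _
  have heq : (fun r => h (c r)) = fun r => h a + if i = l.1.1 then orient l.1.2 r else 0 := by
    refine hcov.eq_of_comp_eq (by fun_prop) ?_ (funext fun r => ?_) 0 ?_
    · split_ifs
      · fun_prop
      · fun_prop
    · simp only [Function.comp_apply]
      rw [hh', hc, coe_legPath, AddCircle.coe_add, hh' a, Pi.add_apply]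
      congr 1
      split_ifs with hi
      · rw [hi, Pi.single_eq_same]
      · rw [Pi.single_eq_of_ne hi, AddCircle.coe_zero]
    · simp [h0, orient]
  exact fun r => congrFun heq r

theorem exists_legPath_eq {b b' : bouquet g} (l : Leg b)
    (h : ∀ j ≠ l.1.1, (b' : Fin g → UnitAddCircle) j = 0) : ∃ r > 0, legPath b l r = b' := by
  obtain ⟨r, hr, hu⟩ := exists_pos_orient_eq l.1.2
    ((b' : Fin g → UnitAddCircle) l.1.1 - (b : Fin g → UnitAddCircle) l.1.1)
  refine ⟨r, hr, Subtype.ext ?_⟩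
  rw [coe_legPath, hu]
  ext j
  by_cases hj : j = l.1.1
  · rw [hj]
    simp
  · simp [Pi.single_eq_of_ne hj, h j hj, l.2 j hj]

/-- Every direction of the universal cover contains points above every point of the bouquet. -/
theorem IsDirection.exists_proj_eq [SimplyConnectedSpace T] (hq : IsCoveringMap q) {δ : Set T}
    (hδ : IsDirection δ) (b' : bouquet g) : ∃ y ∈ δ, q y = b' := by
  obtain ⟨a, x, hx, rfl⟩ := hδ
  obtain ⟨ρ, sec, hs⟩ := hq.exists_isStar (q a)
  obtain ⟨l, hl, -⟩ := hs.exists_leg hq rfl hx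
  obtain ⟨c, hc0, hc⟩ := hq.exists_ray a l
  obtain ⟨h, hh⟩ := hq.exists_winding l.1.1
  have hhc : ∀ r, h (c r) = h a + orient l.1.2 r := fun r => by
    rw [hh a l c hc0 hc r, if_pos rfl]
  have hane : ∀ r, 0 < r → h (c r) ≠ h a := fun r hr h0 => by
    have h1 : orient l.1.2 r = 0 := by linarith [hhc r]
    have h2 := abs_orient l.1.2 r
    rw [h1, abs_zero, eq_comm, abs_eq_zero] at h2
    exact hr.ne' h2
  have hcδ : ∀ r, 0 < r → c r ∈ connectedComponentIn {a}ᶜ x := by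
    have hr₀ : ρ / 2 ∈ Ioo 0 ρ := ⟨by linarith [hs.pos], by linarith [hs.pos]⟩
    have h1 : c (ρ / 2) ∈ connectedComponentIn {a}ᶜ x := by
      have h2 := hs.sec_eq_of_isPreconnected (C := c '' Ico 0 ρ) rfl ?_
        (isPreconnected_Ico.image _ c.continuous.continuousOn) ⟨0, ⟨le_rfl, hs.pos⟩, hc0⟩
        (c (ρ / 2)) ⟨_, Ioo_subset_Ico_self hr₀, rfl⟩
      · rw [← h2, hc]
        exact hl _ hr₀
      · rintro _ ⟨r, hr, rfl⟩
        rw [mem_preimage, hc]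
        exact hs.legPath_mem_ball l hr
    intro r hr
    rw [connectedComponentIn_eq h1]
    refine (isPreconnected_Ioi.image c c.continuous.continuousOn).subset_connectedComponentIn
      ⟨_, hr₀.1, rfl⟩ ?_ ⟨r, hr, rfl⟩
    rintro _ ⟨u, hu, rfl⟩ h0
    exact hane u hu (congrArg h h0)
  by_cases hb' : ∀ j ≠ l.1.1, (b' : Fin g → UnitAddCircle) j = 0
  · obtain ⟨r, hr, hrb⟩ := exists_legPath_eq l hb'
    exact ⟨c r, hcδ r hr, (hc r).trans hrb⟩
  · push Not at hb'
    obtain ⟨k, hk, hkb⟩ := hb'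
    -- Follow the ray to a point above the wedge point and leave it along the circle of `b'`.
    obtain ⟨r, hr, hrb⟩ := exists_legPath_eq (b' := ⟨0, fun i j hi => absurd rfl hi⟩) l
      fun _ _ => rfl
    have hcr : (q (c r) : Fin g → UnitAddCircle) = 0 := by rw [hc, hrb]
    let l' : Leg (q (c r)) := ⟨(k, true), fun j _ => by rw [hcr]; rfl⟩
    obtain ⟨c', hc'0, hc'⟩ := hq.exists_ray (c r) l'
    obtain ⟨r', hr', hrb'⟩ := exists_legPath_eq (b' := b') l' fun j hj => by
      by_contra hjb
      exact hj (b'.2 j k hjb hkb)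
    refine ⟨c' r', ?_, (hc' r').trans hrb'⟩
    have hcr' : c' 0 ∈ connectedComponentIn {a}ᶜ x := hc'0 ▸ hcδ r hr
    rw [connectedComponentIn_eq hcr']
    refine (isPreconnected_Ici.image c' c'.continuous.continuousOn).subset_connectedComponentIn
      ⟨0, self_mem_Ici, rfl⟩ ?_ ⟨r', hr'.le, rfl⟩
    rintro _ ⟨u, hu, rfl⟩ h0
    refine hane r hr ?_
    have := hh (c r) l' c' hc'0 hc' u
    rw [if_neg (Ne.symm hk), add_zero] at this
    rw [← this]
    exact congrArg h h0

/-- A connected set that contains a whole fibre is everything, as every direction meets the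
fibre. -/
theorem IsPreconnected.eq_univ_of_fiber_subset [SimplyConnectedSpace T] (hq : IsCoveringMap q)
    {A : Set T} (hA : IsPreconnected A) (hne : A.Nonempty) {b' : bouquet g}
    (h : ∀ y, q y = b' → y ∈ A) : A = univ := by
  rw [eq_univ_iff_forall]
  intro a
  by_contra ha
  obtain ⟨x, hx⟩ := hne
  have hxa : x ≠ a := fun h => ha (h ▸ hx)
  obtain ⟨ρ, sec, hs⟩ := hq.exists_isStar (q a)
  obtain ⟨l, -, hl⟩ := hs.exists_leg hq rfl hxa
  let l' : Leg (q a) := ⟨(l.1.1, !l.1.2), l.2⟩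
  have hl' : l' ≠ l := fun h => by
    have := congrArg (fun m : Leg (q a) => m.1.2) h
    simp [l'] at this
  have hr : ρ / 2 ∈ Ioo 0 ρ := ⟨by linarith [hs.pos], by linarith [hs.pos]⟩
  obtain ⟨y, hy, hyb⟩ := IsDirection.exists_proj_eq hq ⟨a, _, hs.leg_ne rfl l' hr, rfl⟩ b'
  have hsub : A ⊆ _root_.connectedComponentIn {a}ᶜ x :=
    hA.subset_connectedComponentIn hx fun z hz (h : z = a) => ha (h ▸ hz)
  refine hl l' hl' _ hr ?_
  rw [connectedComponentIn_eq (hsub (h y hyb)), ← connectedComponentIn_eq hy]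
  exact mem_connectedComponentIn (hs.leg_ne rfl l' hr)

end Rays

/-! ### The metric of the tree -/

section Metric

variable {g : ℕ} {T : Type*} [TopologicalSpace T] {q : T → bouquet g}

theorem treeEDist_le (c : C(I, T)) :
    treeEDist q (c 0) (c 1) ≤ eVariationOn (fun s => q (c s)) univ :=
  iInf_le (fun c' : Path (c 0) (c 1) => eVariationOn (fun s : I => q (c' s)) univ) ⟨c, rfl, rfl⟩

theorem edist_le_treeEDist (x y : T) : edist (q x) (q y) ≤ treeEDist q x y := by
  refine le_iInf fun c => ?_
  have := eVariationOn.edist_le (fun s : I => q (c s)) (mem_univ 0) (mem_univ 1)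
  simpa using this

/-- The length of a part of the path `c`, run through by the monotone or antitone
reparametrization `φ`, bounds the distance of its end points. -/
theorem treeEDist_le_comp {x y : T} (c : Path x y) {φ : I → I} (hφ : Continuous φ) {s : Set I}
    (hs : ∀ u, φ u ∈ s) (hm : Monotone φ ∨ Antitone φ) :
    treeEDist q (c (φ 0)) (c (φ 1)) ≤ eVariationOn (fun s : I => q (c s)) s := by
  refine (treeEDist_le ⟨fun u => c (φ u), c.continuous.comp hφ⟩).trans ?_
  rcases hm with hm | hm
  · exact eVariationOn.comp_le_of_monotoneOn (fun s : I => q (c s)) φ (hm.monotoneOn _)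
      fun u _ => hs u
  · exact eVariationOn.comp_le_of_antitoneOn (fun s : I => q (c s)) φ (hm.antitoneOn _)
      fun u _ => hs u

theorem treeEDist_comm (x y : T) : treeEDist q x y = treeEDist q y x := by
  have : ∀ x y : T, treeEDist q x y ≤ treeEDist q y x := fun x y => le_iInf fun c => by
    have := treeEDist_le_comp (q := q) c unitInterval.continuous_symm (fun u => mem_univ (σ u))
      (Or.inr unitInterval.strictAnti_symm.antitone)
    simpa using this
  exact le_antisymm (this x y) (this y x)

theorem treeEDist_self (x : T) : treeEDist q x x = 0 := by
  have := treeEDist_le (q := q) (.const I x)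
  rw [eVariationOn.constant_on] at this
  · simpa using this
  · rintro _ ⟨s, -, rfl⟩ _ ⟨s', -, rfl⟩
    rfl

theorem eVariationOn_univ_eq (f : I → bouquet g) (u : I) :
    eVariationOn f univ = eVariationOn f (Iic u) + eVariationOn f (Ici u) := by
  rw [← eVariationOn.union f isGreatest_Iic isLeast_Ici, Iic_union_Ici]

theorem treeEDist_triangle (x y z : T) :
    treeEDist q x z ≤ treeEDist q x y + treeEDist q y z := by
  unfold treeEDist
  rw [ENNReal.iInf_add]
  refine le_iInf fun c => ?_
  rw [ENNReal.add_iInf]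
  refine le_iInf fun c' => (iInf_le _ (c.trans c')).trans ?_
  let u : I := ⟨1 / 2, by norm_num, by norm_num⟩
  rw [eVariationOn_univ_eq _ u]
  have hd : Monotone fun s : I => projIcc (0 : ℝ) 1 zero_le_one (2 * (s : ℝ)) :=
    (monotone_projIcc _).comp fun s s' (h : (s : ℝ) ≤ s') =>
      show 2 * (s : ℝ) ≤ 2 * s' by linarith
  have hd' : Monotone fun s : I => projIcc (0 : ℝ) 1 zero_le_one (2 * (s : ℝ) - 1) :=
    (monotone_projIcc _).comp fun s s' (h : (s : ℝ) ≤ s') =>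
      show 2 * (s : ℝ) - 1 ≤ 2 * s' - 1 by linarith
  refine add_le_add ?_ ?_
  · refine le_trans (le_of_eq ?_) (eVariationOn.comp_le_of_monotoneOn (fun s : I => q (c s))
      (t := Iic u) (s := univ) _ (hd.monotoneOn _) fun _ _ => mem_univ _)
    refine eVariationOn.eq_of_eqOn fun s (hs : (s : ℝ) ≤ 1 / 2) => ?_
    simp only [Path.trans, Path.coe_mk_mk, Function.comp_apply, if_pos hs]
    rfl
  · refine le_trans (le_of_eq ?_) (eVariationOn.comp_le_of_monotoneOn (fun s : I => q (c' s))
      (t := Ici u) (s := univ) _ (hd'.monotoneOn _) fun _ _ => mem_univ _)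
    refine eVariationOn.eq_of_eqOn fun s (hs : 1 / 2 ≤ (s : ℝ)) => ?_
    simp only [Path.trans, Path.coe_mk_mk, Function.comp_apply]
    split_ifs with h
    · have h' : (s : ℝ) = 1 / 2 := le_antisymm h hs
      rw [h']
      simp
    · rfl

/-- If `z` separates `x` from `y`, then the distances add up. -/
theorem treeEDist_add_le {x y z : T} (h : y ∉ connectedComponentIn {z}ᶜ x) :
    treeEDist q x z + treeEDist q z y ≤ treeEDist q x y := by
  refine le_iInf fun c => ?_
  obtain ⟨u, hu⟩ : ∃ u, c u = z := by
    by_contra! hcon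
    refine h ((isPreconnected_range c.continuous).subset_connectedComponentIn ⟨0, c.source⟩ ?_
      ⟨1, c.target⟩)
    rintro _ ⟨u, rfl⟩
    exact hcon u
  rw [eVariationOn_univ_eq _ u]
  refine add_le_add ?_ ?_
  · have := treeEDist_le_comp (q := q) c (φ := fun s => s * u) (by fun_prop) (s := Iic u)
      (fun s => unitInterval.mul_le_right) (Or.inl fun s s' h => by
        exact mul_le_mul_of_nonneg_right (α := ℝ) h u.2.1)
    simpa [hu] using this
  · have := treeEDist_le_comp (q := q) c (φ := fun s => σ (σ s * σ u)) (by fun_prop) (s := Ici u)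
      (fun s => by
        have : σ s * σ u ≤ σ u := unitInterval.mul_le_right
        rw [mem_Ici, ← unitInterval.symm_symm u]
        exact unitInterval.strictAnti_symm.antitone (by simpa using this)) (Or.inl fun s s' h => by
        refine unitInterval.strictAnti_symm.antitone ?_
        exact mul_le_mul_of_nonneg_right (α := ℝ) (unitInterval.strictAnti_symm.antitone h) (σ u).2.1)
    simpa [hu] using this

/-- A point that is closer to `x` than `z` is on the same side of `z` as `x`. -/
theorem mem_component_of_treeEDist_lt {x y z : T} (h : treeEDist q x y < treeEDist q z x) :
    y ∈ connectedComponentIn {z}ᶜ x := by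
  by_contra hy
  rw [treeEDist_comm z x] at h
  exact absurd (le_self_add.trans (treeEDist_add_le hy)) (not_le.2 h)

variable {b : bouquet g} {ρ : ℝ} {sec : T → bouquet g → T} {a : T}

theorem IsStar.treeEDist_leg_le (hs : IsStar q b ρ sec) (ha : q a = b) (l : Leg b) {r : ℝ}
    (hr : r ∈ Ico 0 ρ) : treeEDist q a (sec a (legPath b l r)) ≤ ENNReal.ofReal r := by
  have hsub : ∀ u : I, (u : ℝ) * r ∈ Ico 0 ρ := fun u =>
    ⟨mul_nonneg u.2.1 hr.1, (mul_le_of_le_one_left hr.1 u.2.2).trans_lt hr.2⟩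
  let c : C(I, T) := ⟨fun u => sec a (legPath b l (u * r)),
    (hs.continuousOn_leg ha l).comp_continuous (by fun_prop) hsub⟩
  have h0 : c 0 = a := by simp [c, hs.leg_zero ha]
  have h1 : c 1 = sec a (legPath b l r) := by simp [c]
  have hle := treeEDist_le (q := q) c
  rw [h0, h1] at hle
  refine hle.trans ?_
  have hL : LipschitzOnWith 1 (legPath b l) (Ico 0 ρ) := by
    refine LipschitzOnWith.of_dist_le_mul fun v hv v' hv' => ?_
    rw [dist_legPath b l (abs_le.2 ⟨by linarith [hv.1, hv'.2, hs.le], by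
      linarith [hv.2, hv'.1, hs.le]⟩), Real.dist_eq, NNReal.coe_one, one_mul]
  have hm : MonotoneOn (fun u : I => (u : ℝ) * r) univ := fun u _ u' _ h =>
    mul_le_mul_of_nonneg_right h hr.1
  have h2 : eVariationOn (fun u : I => q (c u)) univ =
      eVariationOn (legPath b l ∘ fun u : I => (u : ℝ) * r) univ :=
    eVariationOn.eq_of_eqOn fun u _ => hs.proj_leg ha l (hsub u)
  rw [h2]
  refine (hL.comp_eVariationOn_le fun u _ => hsub u).trans ?_
  have h3 := hm.eVariationOn_eq (mem_univ 0) (mem_univ 1)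
  have h4 : (univ ∩ Icc 0 1 : Set I) = univ := by
    ext u
    simp [unitInterval.le_one']
  rw [h4] at h3
  simpa using h3.le

theorem IsStar.le_treeEDist_leg (hs : IsStar q b ρ sec) (ha : q a = b) (l : Leg b) {r : ℝ}
    (hr : r ∈ Ico 0 ρ) : ENNReal.ofReal r ≤ treeEDist q a (sec a (legPath b l r)) := by
  refine le_trans (le_of_eq ?_) (edist_le_treeEDist a _)
  rw [ha, hs.proj_leg ha l hr, edist_comm, edist_dist,
    dist_legPath_self b l hr.1 (by linarith [hr.2, hs.le])]

theorem IsStar.treeEDist_le_of_mem (hs : IsStar q b ρ sec) (ha : q a = b) {y : T}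
    (hy : y ∈ sec a '' Metric.ball b ρ) : treeEDist q a y ≤ ENNReal.ofReal ρ := by
  obtain ⟨y, hy, rfl⟩ := hy
  rcases hs.star y hy with rfl | ⟨l, r, hr, rfl⟩
  · rw [hs.base a ha, treeEDist_self]
    exact zero_le
  · exact (hs.treeEDist_leg_le ha l (Ioo_subset_Ico_self hr)).trans
      (ENNReal.ofReal_le_ofReal hr.2.le)

/-- A connected set that projects to a small ball is small. -/
theorem IsStar.treeEDist_le_of_isPreconnected (hs : IsStar q b ρ sec) {C : Set T}
    (hC : C ⊆ q ⁻¹' Metric.ball b ρ) (hpre : IsPreconnected C) {x y : T} (hx : x ∈ C)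
    (hy : y ∈ C) : treeEDist q x y ≤ ENNReal.ofReal (2 * ρ) := by
  obtain ⟨a, ha, h⟩ := hs.sheet C hC hpre ⟨x, hx⟩
  refine (treeEDist_triangle x a y).trans ?_
  rw [treeEDist_comm x a, two_mul, ENNReal.ofReal_add hs.pos.le hs.pos.le]
  exact add_le_add (hs.treeEDist_le_of_mem ha ⟨_, hC hx, h x hx⟩)
    (hs.treeEDist_le_of_mem ha ⟨_, hC hy, h y hy⟩)

theorem treeEDist_ne_top [PreconnectedSpace T] (hq : IsCoveringMap q) (x y : T) :
    treeEDist q x y ≠ ⊤ := by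
  have hnear : ∀ z : T, ∃ N ∈ 𝓝 z, ∀ w ∈ N, treeEDist q z w ≠ ⊤ := fun z => by
    obtain ⟨ρ, sec, hs⟩ := hq.exists_isStar (q z)
    exact ⟨_, hs.image_ball_mem_nhds rfl, fun w hw =>
      ((hs.treeEDist_le_of_mem rfl hw).trans_lt ENNReal.ofReal_lt_top).ne⟩
  have hclopen : IsClopen {z | treeEDist q x z ≠ ⊤} := by
    constructor
    · rw [← isOpen_compl_iff, isOpen_iff_mem_nhds]
      intro z hz
      obtain ⟨N, hN, h⟩ := hnear z
      filter_upwards [hN] with w hw hcon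
      refine hz (ne_top_of_le_ne_top (ENNReal.add_ne_top.2 ⟨hcon, h w hw⟩) ?_)
      rw [treeEDist_comm z w]
      exact treeEDist_triangle x w z
    · rw [isOpen_iff_mem_nhds]
      intro z hz
      obtain ⟨N, hN, h⟩ := hnear z
      filter_upwards [hN] with w hw
      exact ne_top_of_le_ne_top (ENNReal.add_ne_top.2 ⟨hz, h w hw⟩) (treeEDist_triangle x z w)
  rcases isClopen_iff.1 hclopen with h | h
  · exact absurd (show x ∈ {z | treeEDist q x z ≠ ⊤} by simp [treeEDist_self]) (by simp [h])
  · exact (h ▸ mem_univ y : y ∈ {z | treeEDist q x z ≠ ⊤})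

end Metric

/-! ### Deck transformations -/

section Deck

variable {T B : Type*} [TopologicalSpace T] [TopologicalSpace B] [SimplyConnectedSpace T]
  {q : T → B}

/-- The deck transformation may be computed with any path from the base point. -/
theorem deckTransformation_eq (hq : IsCoveringMap q) {b : B} (t₀ : q ⁻¹' {b})
    (α : FundamentalGroup B b) {t : T} (c : Path (t₀ : T) t) {L : C(I, T)}
    (hL : ∀ u, q (L u) = q (c u)) (hL0 : L 0 = hq.monodromy α t₀) :
    deckTransformation hq t₀ α t = L 1 := by
  have hhom : (PathConnectedSpace.somePath (t₀ : T) t).Homotopic c :=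
    SimplyConnectedSpace.paths_homotopic _ _
  have h1 : ((PathConnectedSpace.somePath (t₀ : T) t).map hq.continuous).Homotopic
      (c.map hq.continuous) := hhom.map ⟨q, hq.continuous⟩
  have hstart : (c.map hq.continuous).toContinuousMap 0 = q (hq.monodromy α t₀ : T) := by
    have h2 : q (hq.monodromy α t₀ : T) = b := (hq.monodromy α t₀).2
    have h0 : q (t₀ : T) = b := t₀.2
    simp [h0, h2]
  rw [deckTransformation, hq.liftPath_apply_one_eq_of_homotopicRel h1 _ _ hstart]
  have : L = hq.liftPath (c.map hq.continuous).toContinuousMap (hq.monodromy α t₀ : T) hstart := by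
    rw [hq.eq_liftPath_iff']
    exact ⟨funext hL, hL0⟩
  rw [this]

theorem deckTransformation_base (hq : IsCoveringMap q) {b : B} (t₀ : q ⁻¹' {b})
    (α : FundamentalGroup B b) : deckTransformation hq t₀ α t₀ = hq.monodromy α t₀ := by
  have h1 : q (hq.monodromy α t₀ : T) = b := (hq.monodromy α t₀).2
  have h0 : q (t₀ : T) = b := t₀.2
  exact deckTransformation_eq hq t₀ α (Path.refl _) (L := .const I (hq.monodromy α t₀ : T))
    (fun u => by simp [h0, h1]) rfl

/-- Deck transformations do not increase the distance from the base point. -/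
theorem treeEDist_deckTransformation_le {g : ℕ} {q : T → bouquet g} (hq : IsCoveringMap q)
    {b : bouquet g} (t₀ : q ⁻¹' {b}) (α : FundamentalGroup (bouquet g) b) (t : T) :
    treeEDist q (deckTransformation hq t₀ α t₀) (deckTransformation hq t₀ α t) ≤
      treeEDist q t₀ t := by
  refine le_iInf fun c => ?_
  have h0 : q (t₀ : T) = b := t₀.2
  have h1 : q (hq.monodromy α t₀ : T) = b := (hq.monodromy α t₀).2
  have hstart : (c.map hq.continuous).toContinuousMap 0 = q (hq.monodromy α t₀ : T) := by
    simp [h0, h1]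
  have hL := hq.liftPath_lifts (c.map hq.continuous).toContinuousMap _ hstart
  have hL0 := hq.liftPath_zero (c.map hq.continuous).toContinuousMap _ hstart
  have hL' : ∀ u, q (hq.liftPath (c.map hq.continuous).toContinuousMap _ hstart u) = q (c u) :=
    fun u => congrFun hL u
  rw [deckTransformation_eq hq t₀ α c hL' hL0, deckTransformation_base]
  have hle := treeEDist_le (q := q) (hq.liftPath (c.map hq.continuous).toContinuousMap _ hstart)
  rw [hL0] at hle
  refine hle.trans (le_of_eq ?_)
  exact eVariationOn.eq_of_eqOn fun u _ => hL' u

end Deck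

/-! ### Lifts of a map of the surface to the trees -/

section Lift

variable {X S T B : Type*} [TopologicalSpace X] [TopologicalSpace S] [TopologicalSpace T]
  [TopologicalSpace B] {p : C(S, X)} {q : T → B} {φ : C(X, B)} {F : C(S, T)}

theorem IsCoveringMap.exists_joinedIn_preimage (hp : IsCoveringMap p) {W : Set X}
    (hW : IsPathConnected W) {s : S} (hs : p s ∈ W) {x : X} (hx : x ∈ W) :
    ∃ s', p s' = x ∧ JoinedIn (p ⁻¹' W) s s' := by
  obtain ⟨c, hc⟩ := hW.joinedIn _ hs _ hx
  have hL := hp.liftPath_lifts c.toContinuousMap s (by simp)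
  have hL0 := hp.liftPath_zero c.toContinuousMap s (by simp)
  set L := hp.liftPath c.toContinuousMap s (by simp)
  have hL' : ∀ u, p (L u) = c u := fun u => congrFun hL u
  refine ⟨L 1, by rw [hL', c.target], ⟨L, hL0, rfl⟩, fun u => ?_⟩
  change p (L u) ∈ W
  rw [hL']
  exact hc u

/-- The monodromy of the image of a loop in the base of `p` is computed by lifting the loop
with `p`. -/
theorem IsCoveringMap.monodromy_map_eq (hq : IsCoveringMap q) (hF : ∀ s, q (F s) = φ (p s)) {s₀ : S}
    (c : Path (p s₀) (p s₀)) {L : C(I, S)} (hL : ∀ u, p (L u) = c u) (hL0 : L 0 = s₀) :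
    (hq.monodromy (FundamentalGroup.map φ (p s₀) (Path.Homotopic.Quotient.mk c))
      ⟨F s₀, hF s₀⟩ : T) = F (L 1) := by
  have hstart : (c.map φ.continuous).toContinuousMap 0 = q (F s₀) := by simp [hF]
  have h1 : F.comp L = hq.liftPath (c.map φ.continuous).toContinuousMap (F s₀) hstart := by
    rw [hq.eq_liftPath_iff']
    refine ⟨funext fun u => ?_, by simp [hL0]⟩
    simp [hF, hL]
  change hq.liftPath (c.map φ.continuous).toContinuousMap (F s₀) _ 1 = _
  rw [← h1]
  rfl

/-- If `φ` is surjective on fundamental groups, then the lift of `φ` is onto the fibre. -/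
theorem exists_lift_eq_of_map_surjective [PathConnectedSpace T] (hp : IsCoveringMap p)
    (hq : IsCoveringMap q) (hF : ∀ s, q (F s) = φ (p s)) (s₀ : S)
    (hφ : Function.Surjective (FundamentalGroup.map φ (p s₀))) {y : T} (hy : q y = φ (p s₀)) :
    ∃ s, p s = p s₀ ∧ F s = y := by
  let c := PathConnectedSpace.somePath (F s₀) y
  let β : Path (φ (p s₀)) (φ (p s₀)) := (c.map hq.continuous).cast (hF s₀).symm hy.symm
  obtain ⟨α, hα⟩ := hφ (Path.Homotopic.Quotient.mk β)
  induction α using Path.Homotopic.Quotient.ind with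
  | mk ℓ =>
  have hL := hp.liftPath_lifts ℓ.toContinuousMap s₀ (by simp)
  have hL0 := hp.liftPath_zero ℓ.toContinuousMap s₀ (by simp)
  set L := hp.liftPath ℓ.toContinuousMap s₀ (by simp)
  have hL' : ∀ u, p (L u) = ℓ u := fun u => congrFun hL u
  refine ⟨L 1, by rw [hL', ℓ.target], ?_⟩
  rw [← hq.monodromy_map_eq hF ℓ hL' hL0, hα]
  have hstart : β.toContinuousMap 0 = q (F s₀) := by simp [hF]
  have h1 : c.toContinuousMap = hq.liftPath β.toContinuousMap (F s₀) hstart := by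
    rw [hq.eq_liftPath_iff']
    exact ⟨rfl, by simp⟩
  change hq.liftPath β.toContinuousMap (F s₀) _ 1 = _
  rw [← h1]
  simp

end Lift

section TreeLift

variable {X S T : Type*} [TopologicalSpace X] [TopologicalSpace S] [TopologicalSpace T]
  {g : ℕ} {p : C(S, X)} {q : T → bouquet g} {φ : C(X, bouquet g)} {F : C(S, T)}

/-- The image of the lift is connected and contains a whole fibre of the universal cover. -/
theorem surjective_lift [PathConnectedSpace S] [SimplyConnectedSpace T] (hp : IsCoveringMap p)
    (hq : IsCoveringMap q) (hF : ∀ s, q (F s) = φ (p s)) (s₀ : S)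
    (hφ : Function.Surjective (FundamentalGroup.map φ (p s₀))) : Function.Surjective F := by
  rw [← range_eq_univ]
  refine (isPreconnected_range F.continuous).eq_univ_of_fiber_subset hq ⟨_, s₀, rfl⟩
    (b' := φ (p s₀)) fun y hy => ?_
  obtain ⟨s, -, hs⟩ := exists_lift_eq_of_map_surjective hp hq hF s₀ hφ hy
  exact ⟨s, hs⟩

variable {b : bouquet g} {ρ : ℝ} {sec : T → bouquet g → T}

theorem IsStar.treeEDist_lift_le (hs : IsStar q b ρ sec) (hF : ∀ s, q (F s) = φ (p s)) {W : Set X}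
    (hW : MapsTo φ W (Metric.ball b ρ)) {s s' : S} (h : JoinedIn (p ⁻¹' W) s s') :
    treeEDist q (F s) (F s') ≤ ENNReal.ofReal (2 * ρ) := by
  obtain ⟨c, hc⟩ := h
  refine hs.treeEDist_le_of_isPreconnected (C := range fun u => F (c u)) ?_
    (isPreconnected_range (F.continuous.comp c.continuous)) ⟨0, by simp⟩ ⟨1, by simp⟩
  rintro _ ⟨u, rfl⟩
  rw [mem_preimage, hF]
  exact hW (hc u)

theorem IsStar.lift_eq_sec (hs : IsStar q b ρ sec) (hF : ∀ s, q (F s) = φ (p s)) {W : Set X}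
    (hW : MapsTo φ W (Metric.ball b ρ)) {s s' : S} (h : JoinedIn (p ⁻¹' W) s s')
    (hb : q (F s) = b) : F s' = sec (F s) (φ (p s')) := by
  obtain ⟨c, hc⟩ := h
  rw [← hF]
  refine (hs.sec_eq_of_isPreconnected hb (C := range fun u => F (c u)) ?_
    (isPreconnected_range (F.continuous.comp c.continuous)) ⟨0, by simp⟩ _ ⟨1, by simp⟩).symm
  rintro _ ⟨u, rfl⟩
  rw [mem_preimage, hF]
  exact hW (hc u)

end TreeLift

section TwoTrees

variable {X S T₁ T₂ : Type*} [TopologicalSpace X] [LocallyPathConnectedSpace X]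
  [TopologicalSpace S] [TopologicalSpace T₁] [TopologicalSpace T₂]
  {g : ℕ} {p : C(S, X)} {q₁ : T₁ → bouquet g} {q₂ : T₂ → bouquet g}
  {φ₁ φ₂ : C(X, bouquet g)} {F₁ : C(S, T₁)} {F₂ : C(S, T₂)}

/-- Points of the cover above a small set can be moved, by a small amount in both trees, to lie
above any other point of the set. -/
theorem exists_nhds_treeEDist_lift_le (hp : IsCoveringMap p) (hq₁ : IsCoveringMap q₁)
    (hq₂ : IsCoveringMap q₂) (hF₁ : ∀ s, q₁ (F₁ s) = φ₁ (p s)) (hF₂ : ∀ s, q₂ (F₂ s) = φ₂ (p s))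
    (x : X) {ε : ℝ} (hε : 0 < ε) :
    ∃ W ∈ 𝓝 x, ∀ s, p s ∈ W → ∀ x' ∈ W, ∃ s', p s' = x' ∧
      treeEDist q₁ (F₁ s) (F₁ s') ≤ ENNReal.ofReal ε ∧
      treeEDist q₂ (F₂ s) (F₂ s') ≤ ENNReal.ofReal ε := by
  obtain ⟨ρ₁, sec₁, hs₁⟩ := hq₁.exists_isStar (φ₁ x)
  obtain ⟨ρ₂, sec₂, hs₂⟩ := hq₂.exists_isStar (φ₂ x)
  have h₁ := hs₁.mono (lt_min hs₁.pos (half_pos hε)) (min_le_left _ _)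
  have h₂ := hs₂.mono (lt_min hs₂.pos (half_pos hε)) (min_le_left _ _)
  have hN : φ₁ ⁻¹' Metric.ball (φ₁ x) (min ρ₁ (ε / 2)) ∩
      φ₂ ⁻¹' Metric.ball (φ₂ x) (min ρ₂ (ε / 2)) ∈ 𝓝 x :=
    inter_mem (φ₁.continuous.continuousAt (Metric.ball_mem_nhds _ h₁.pos))
      (φ₂.continuous.continuousAt (Metric.ball_mem_nhds _ h₂.pos))
  obtain ⟨W, ⟨hW, hWp⟩, hWN⟩ := (path_connected_basis x).mem_iff.1 hN
  refine ⟨W, hW, fun s hs x' hx' => ?_⟩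
  obtain ⟨s', hs', hj⟩ := hp.exists_joinedIn_preimage hWp hs hx'
  refine ⟨s', hs', (h₁.treeEDist_lift_le hF₁ (fun z hz => (hWN hz).1) hj).trans ?_,
    (h₂.treeEDist_lift_le hF₂ (fun z hz => (hWN hz).2) hj).trans ?_⟩
  · exact ENNReal.ofReal_le_ofReal (by linarith [min_le_right ρ₁ (ε / 2)])
  · exact ENNReal.ofReal_le_ofReal (by linarith [min_le_right ρ₂ (ε / 2)])

/-- The fibre of the cover above the base point is coarsely dense, simultaneously in both
trees. -/
theorem exists_treeEDist_fiber_le [CompactSpace X] [PathConnectedSpace S] (hp : IsCoveringMap p)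
    (hq₁ : IsCoveringMap q₁) (hq₂ : IsCoveringMap q₂) (hF₁ : ∀ s, q₁ (F₁ s) = φ₁ (p s))
    (hF₂ : ∀ s, q₂ (F₂ s) = φ₂ (p s)) (s₀ : S) :
    ∃ K : ℝ≥0∞, K ≠ ⊤ ∧ ∀ s, ∃ s', p s' = p s₀ ∧ treeEDist q₁ (F₁ s) (F₁ s') ≤ K ∧
      treeEDist q₂ (F₂ s) (F₂ s') ≤ K := by
  let P : Set X → Prop := fun A => ∃ K : ℝ≥0∞, K ≠ ⊤ ∧ ∀ s, p s ∈ A → ∃ s', p s' = p s₀ ∧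
    treeEDist q₁ (F₁ s) (F₁ s') ≤ K ∧ treeEDist q₂ (F₂ s) (F₂ s') ≤ K
  have hmono : ∀ {A A' : Set X}, A ⊆ A' → P A' → P A := fun hA ⟨K, hK, h⟩ =>
    ⟨K, hK, fun s hs => h s (hA hs)⟩
  have hloc : ∀ x, ∃ W ∈ 𝓝 x, ∀ x' ∈ W, P {x'} → P W := fun x => by
    obtain ⟨W, hW, h⟩ := exists_nhds_treeEDist_lift_le hp hq₁ hq₂ hF₁ hF₂ x one_pos
    refine ⟨W, hW, fun x' hx' ⟨K, hK, hKs⟩ => ⟨ENNReal.ofReal 1 + K, by simp [hK],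
      fun s hs => ?_⟩⟩
    obtain ⟨s', hs', h1, h2⟩ := h s hs x' hx'
    obtain ⟨s'', hs'', h1', h2'⟩ := hKs s' hs'
    exact ⟨s'', hs'', (treeEDist_triangle _ _ _).trans (add_le_add h1 h1'),
      (treeEDist_triangle _ _ _).trans (add_le_add h2 h2')⟩
  have hclopen : IsClopen {x | P {x}} := by
    constructor
    · rw [← isOpen_compl_iff, isOpen_iff_mem_nhds]
      intro x hx
      obtain ⟨W, hW, h⟩ := hloc x
      filter_upwards [hW] with x' hx' hP
      exact hx (hmono (singleton_subset_iff.2 (mem_of_mem_nhds hW)) (h x' hx' hP))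
    · rw [isOpen_iff_mem_nhds]
      intro x hx
      obtain ⟨W, hW, h⟩ := hloc x
      filter_upwards [hW] with x' hx'
      exact hmono (singleton_subset_iff.2 hx') (h x (mem_of_mem_nhds hW) hx)
  have hall : ∀ s, P {p s} := by
    rcases isClopen_iff.1 (hclopen.preimage p.continuous) with h | h
    · refine absurd (show s₀ ∈ p ⁻¹' {x | P {x}} from ?_) (by simp [h])
      exact ⟨0, by simp, fun s hs => ⟨s, hs, by simp [treeEDist_self]⟩⟩
    · exact fun s => (h ▸ mem_univ s : s ∈ p ⁻¹' {x | P {x}})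
  have huniv : P univ := by
    refine isCompact_univ.induction_on (p := P) ⟨0, by simp, fun s hs => hs.elim⟩
      (fun A A' hA => hmono hA) ?_ fun x _ => ?_
    · rintro A A' ⟨K, hK, h⟩ ⟨K', hK', h'⟩
      refine ⟨max K K', by simp [hK, hK'], fun s hs => ?_⟩
      rcases hs with hs | hs
      · obtain ⟨s', hs', h1, h2⟩ := h s hs
        exact ⟨s', hs', h1.trans (le_max_left _ _), h2.trans (le_max_left _ _)⟩
      · obtain ⟨s', hs', h1, h2⟩ := h' s hs
        exact ⟨s', hs', h1.trans (le_max_right _ _), h2.trans (le_max_right _ _)⟩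
    · obtain ⟨W, hW, h⟩ := hloc x
      refine ⟨W, nhdsWithin_le_nhds hW, ?_⟩
      by_cases hne : ∃ s, p s ∈ W
      · obtain ⟨s, hs⟩ := hne
        exact h _ hs (hall s)
      · exact ⟨0, by simp, fun s hs => (hne ⟨s, hs⟩).elim⟩
  obtain ⟨K, hK, h⟩ := huniv
  exact ⟨K, hK, fun s => h s (mem_univ _)⟩

end TwoTrees

/-! ### Escaping from a vertex in both trees -/

section Escape

variable {g : ℕ}

open Classical in
/-- The signed distance to `b` that is negative on the leg `l` of length `ρ` and positive on the other
legs; it is continuous on the star of radius `ρ` only. -/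
noncomputable def legCoord (b : bouquet g) (l : Leg b) (ρ : ℝ) (y : bouquet g) : ℝ :=
  if y ∈ legPath b l '' Ioo 0 ρ then -dist y b else dist y b

variable {b : bouquet g} {ρ : ℝ}

theorem legCoord_self (l : Leg b) (hρ : ρ ≤ 1 / 4) : legCoord b l ρ b = 0 := by
  rw [legCoord, if_neg, dist_self]
  rintro ⟨r, hr, h⟩
  exact legPath_ne_self b l hr.1 (by linarith [hr.2]) h

theorem continuousOn_legCoord (hρ : ρ ≤ 1 / 4)
    (hstar : ∀ y ∈ Metric.ball b ρ, y = b ∨ ∃ l : Leg b, ∃ r ∈ Ioo 0 ρ, y = legPath b l r)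
    (l : Leg b) : ContinuousOn (legCoord b l ρ) (Metric.ball b ρ) := by
  intro y hy
  apply ContinuousAt.continuousWithinAt
  have hd : ContinuousAt (fun y => dist y b) y := (continuous_id.dist continuous_const).continuousAt
  rcases hstar y hy with rfl | ⟨l', r, hr, rfl⟩
  · rw [ContinuousAt, legCoord_self l hρ, tendsto_zero_iff_norm_tendsto_zero]
    have h1 : Tendsto (fun z => dist z y) (𝓝 y) (𝓝 0) := by
      simpa [ContinuousAt] using hd
    refine h1.congr fun z => ?_
    rw [legCoord]
    split_ifs <;> simp
  · by_cases hl : l' = l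
    · subst hl
      refine hd.neg.congr ?_
      filter_upwards [(isOpen_image_legPath hρ hstar l').mem_nhds ⟨r, hr, rfl⟩] with z hz
      rw [legCoord, if_pos hz]
      rfl
    · refine hd.congr ?_
      filter_upwards [(isOpen_image_legPath hρ hstar l').mem_nhds ⟨r, hr, rfl⟩] with z hz
      rw [legCoord, if_neg]
      rintro ⟨u, hu, huz⟩
      obtain ⟨v, hv, hvz⟩ := hz
      exact hl (legPath_inj b ⟨hv.1, by linarith [hv.2]⟩ ⟨hu.1, by linarith [hu.2]⟩
        (hvz.trans huz.symm)).1

theorem eq_legPath_of_legCoord_nonpos (hρ : ρ ≤ 1 / 4) {l : Leg b} {y : bouquet g}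
    (hy : legCoord b l ρ y ≤ 0) : y = legPath b l (-legCoord b l ρ y) := by
  rw [legCoord] at hy ⊢
  split_ifs at hy ⊢ with h
  · obtain ⟨r, hr, rfl⟩ := h
    rw [neg_neg, dist_legPath_self b l hr.1.le (by linarith [hr.2])]
  · have h0 : dist y b = 0 := le_antisymm hy dist_nonneg
    rw [h0, neg_zero, legPath_zero]
    exact dist_eq_zero.1 h0

theorem eq_legPath_of_legCoord_nonneg (hρ : ρ ≤ 1 / 4) {l l' : Leg b} {y : bouquet g}
    (hyb : y ∈ Metric.ball b ρ) (hyl : y ∈ legPath b l' '' Icc 0 ρ) (hy : 0 ≤ legCoord b l ρ y) :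
    y = legPath b l' (legCoord b l ρ y) := by
  obtain ⟨r, hr, rfl⟩ := hyl
  have hd := dist_legPath_self b l' hr.1 (by linarith [hr.2])
  rw [legCoord] at hy ⊢
  split_ifs at hy ⊢ with h
  · have h0 : r = 0 := le_antisymm (by linarith) hr.1
    rw [hd, h0, neg_zero]
  · rw [hd]

theorem legCoord_eq_zero_of_mem_of_mem (hρ : ρ ≤ 1 / 4) (l : Leg b) {l₁ l₂ : Leg b} (hl : l₁ ≠ l₂)
    {y : bouquet g} (h₁ : y ∈ legPath b l₁ '' Icc 0 ρ) (h₂ : y ∈ legPath b l₂ '' Icc 0 ρ) :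
    legCoord b l ρ y = 0 := by
  obtain ⟨r, hr, rfl⟩ := h₁
  obtain ⟨r', hr', h⟩ := h₂
  rcases eq_or_lt_of_le hr.1 with h0 | h0
  · rw [← h0, legPath_zero, legCoord_self l hρ]
  rcases eq_or_lt_of_le hr'.1 with h0' | h0'
  · rw [← h, ← h0', legPath_zero, legCoord_self l hρ]
  · exact absurd (legPath_inj b ⟨h0, by linarith [hr.2]⟩ ⟨h0', by linarith [hr'.2]⟩ h.symm).1 hl

theorem exists_leg_of_legCoord_pos {l : Leg b} {y : bouquet g}
    (hstar : y = b ∨ ∃ l : Leg b, ∃ r ∈ Ioo 0 ρ, y = legPath b l r) (hρ : ρ ≤ 1 / 4)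
    (hy : 0 < legCoord b l ρ y) : ∃ l' ≠ l, ∃ r ∈ Ioo 0 ρ, y = legPath b l' r := by
  rcases hstar with rfl | ⟨l', r, hr, rfl⟩
  · rw [legCoord_self l hρ] at hy
    exact absurd hy (lt_irrefl _)
  · refine ⟨l', ?_, r, hr, rfl⟩
    rintro rfl
    rw [legCoord, if_pos ⟨r, hr, rfl⟩] at hy
    linarith [dist_nonneg (x := legPath b l' r) (y := b)]

/-- An injective map from a disc to a product of two stars, taking the centre to the centre, meets
the product of the complements of one leg in each of the stars. -/
theorem exists_leg_of_injective_disc {b₁ b₂ : bouquet g} {ρ₁ ρ₂ : ℝ} (hρ₁ : ρ₁ ≤ 1 / 4)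
    (hρ₂ : ρ₂ ≤ 1 / 4) (hstar₁ : ∀ y ∈ Metric.ball b₁ ρ₁,
      y = b₁ ∨ ∃ l : Leg b₁, ∃ r ∈ Ioo 0 ρ₁, y = legPath b₁ l r)
    (hstar₂ : ∀ y ∈ Metric.ball b₂ ρ₂,
      y = b₂ ∨ ∃ l : Leg b₂, ∃ r ∈ Ioo 0 ρ₂, y = legPath b₂ l r)
    {k₁ k₂ : ℂ → bouquet g} (hk₁ : ContinuousOn k₁ (Metric.closedBall 0 1))
    (hk₂ : ContinuousOn k₂ (Metric.closedBall 0 1))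
    (hm₁ : MapsTo k₁ (Metric.closedBall 0 1) (Metric.ball b₁ ρ₁))
    (hm₂ : MapsTo k₂ (Metric.closedBall 0 1) (Metric.ball b₂ ρ₂))
    (hinj : ∀ z ∈ Metric.closedBall (0 : ℂ) 1, ∀ w ∈ Metric.closedBall (0 : ℂ) 1,
      k₁ z = k₁ w → k₂ z = k₂ w → z = w) (h₁ : k₁ 0 = b₁) (h₂ : k₂ 0 = b₂)
    (l₁ : Leg b₁) (l₂ : Leg b₂) :
    ∃ z ∈ Metric.closedBall (0 : ℂ) 1, (∃ l ≠ l₁, ∃ r ∈ Ioo 0 ρ₁, k₁ z = legPath b₁ l r) ∧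
      ∃ l ≠ l₂, ∃ r ∈ Ioo 0 ρ₂, k₂ z = legPath b₂ l r := by
  have hcl : ∀ {b : bouquet g} {ρ : ℝ} {k : ℂ → bouquet g} (l : Leg b),
      ContinuousOn k (Metric.closedBall 0 1) →
      IsClosed (Metric.closedBall (0 : ℂ) 1 ∩ k ⁻¹' (legPath b l '' Icc 0 ρ)) := fun {b ρ k} l hk =>
    hk.preimage_isClosed_of_isClosed Metric.isClosed_closedBall
      (isCompact_Icc.image (continuous_legPath b l)).isClosed
  have hcov : ∀ {b : bouquet g} {ρ : ℝ} (l : Leg b),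
      (∀ y ∈ Metric.ball b ρ, y = b ∨ ∃ l : Leg b, ∃ r ∈ Ioo 0 ρ, y = legPath b l r) →
      ∀ y ∈ Metric.ball b ρ, ∃ l, y ∈ legPath b l '' Icc 0 ρ := fun {b ρ} l hstar y hy => by
    rcases hstar y hy with rfl | ⟨l', r, hr, rfl⟩
    · exact ⟨l, 0, ⟨le_rfl, (Metric.pos_of_mem_ball hy).le⟩, legPath_zero _ _⟩
    · exact ⟨l', r, Ioo_subset_Icc_self hr, rfl⟩
  obtain ⟨z, hz, hz₁, hz₂⟩ := exists_pos_of_injective_disc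
    (x := fun z => legCoord b₁ l₁ ρ₁ (k₁ z)) (y := fun z => legCoord b₂ l₂ ρ₂ (k₂ z))
    ((continuousOn_legCoord hρ₁ hstar₁ l₁).comp hk₁ hm₁)
    ((continuousOn_legCoord hρ₂ hstar₂ l₂).comp hk₂ hm₂) hinj
    (fun z _ w _ h h0 => (eq_legPath_of_legCoord_nonpos hρ₁ h0).trans
      ((congrArg (fun v => legPath b₁ l₁ (-v)) h).trans
        (eq_legPath_of_legCoord_nonpos hρ₁ (h.symm.trans_le h0)).symm))
    (fun z _ w _ h h0 => (eq_legPath_of_legCoord_nonpos hρ₂ h0).trans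
      ((congrArg (fun v => legPath b₂ l₂ (-v)) h).trans
        (eq_legPath_of_legCoord_nonpos hρ₂ (h.symm.trans_le h0)).symm))
    (fun l => Metric.closedBall 0 1 ∩ k₁ ⁻¹' (legPath b₁ l '' Icc 0 ρ₁)) (fun l => hcl l hk₁)
    (fun z hz _ => (hcov l₁ hstar₁ _ (hm₁ hz)).imp fun l hl => ⟨hz, hl⟩)
    (fun l z hz w hw h h0 => (eq_legPath_of_legCoord_nonneg hρ₁ (hm₁ hz.1) hz.2.2 h0).trans
      ((congrArg (legPath b₁ l) h).trans
        (eq_legPath_of_legCoord_nonneg hρ₁ (hm₁ hw.1) hw.2.2 (h0.trans_eq h)).symm))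
    (fun l l' hl z _ h h' => legCoord_eq_zero_of_mem_of_mem hρ₁ l₁ hl h.2 h'.2)
    (fun l => Metric.closedBall 0 1 ∩ k₂ ⁻¹' (legPath b₂ l '' Icc 0 ρ₂)) (fun l => hcl l hk₂)
    (fun z hz _ => (hcov l₂ hstar₂ _ (hm₂ hz)).imp fun l hl => ⟨hz, hl⟩)
    (fun l z hz w hw h h0 => (eq_legPath_of_legCoord_nonneg hρ₂ (hm₂ hz.1) hz.2.2 h0).trans
      ((congrArg (legPath b₂ l) h).trans
        (eq_legPath_of_legCoord_nonneg hρ₂ (hm₂ hw.1) hw.2.2 (h0.trans_eq h)).symm))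
    (fun l l' hl z _ h h' => legCoord_eq_zero_of_mem_of_mem hρ₂ l₂ hl h.2 h'.2)
    (by simp only [h₁, legCoord_self l₁ hρ₁]) (by simp only [h₂, legCoord_self l₂ hρ₂])
  exact ⟨z, hz, exists_leg_of_legCoord_pos (hstar₁ _ (hm₁ hz)) hρ₁ hz₁,
    exists_leg_of_legCoord_pos (hstar₂ _ (hm₂ hz)) hρ₂ hz₂⟩

/-- Moving away from the vertex `y` along a leg at `a` that does not point towards `y`. -/
theorem IsStar.escape {T : Type*} [TopologicalSpace T] [SimplyConnectedSpace T]
    {q : T → bouquet g} {sec : T → bouquet g → T} {a y : T}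
    (hs : IsStar q b ρ sec) (ha : q a = b) (hy : y ≠ a) {l : Leg b}
    (hl : ∀ r ∈ Ioo 0 ρ, sec a (legPath b l r) ∉ connectedComponentIn {a}ᶜ y) {r : ℝ}
    (hr : r ∈ Ioo 0 ρ) :
    sec a (legPath b l r) ∈ connectedComponentIn {y}ᶜ a ∧
      treeEDist q y a + ENNReal.ofReal r ≤ treeEDist q y (sec a (legPath b l r)) := by
  constructor
  · refine (isPreconnected_Icc.image (fun u => sec a (legPath b l u)) ((hs.continuousOn_leg ha l).mono
      (Icc_subset_Ico_right hr.2))).subset_connectedComponentIn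
      ⟨0, ⟨le_rfl, hr.1.le⟩, hs.leg_zero ha l⟩ ?_ ⟨r, ⟨hr.1.le, le_rfl⟩, rfl⟩
    rintro _ ⟨u, hu, rfl⟩ (h : sec a (legPath b l u) = y)
    rcases eq_or_lt_of_le hu.1 with h0 | h0
    · rw [← h0, hs.leg_zero ha] at h
      exact hy h.symm
    · refine hl u ⟨h0, hu.2.trans_lt hr.2⟩ ?_
      rw [h]
      exact mem_connectedComponentIn hy
  · exact (add_le_add le_rfl (hs.le_treeEDist_leg ha l (Ioo_subset_Ico_self hr))).trans
      (treeEDist_add_le (hl r hr))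

end Escape

section Heavy

variable {X S T₁ T₂ : Type*} [TopologicalSpace X]
  [TopologicalSpace S] [TopologicalSpace T₁] [TopologicalSpace T₂]
  {g : ℕ} {p : C(S, X)} {q₁ : T₁ → bouquet g} {q₂ : T₂ → bouquet g}
  {φ₁ φ₂ : C(X, bouquet g)} {F₁ : C(S, T₁)} {F₂ : C(S, T₂)}

/-- Discs through a point of the surface yield, for all directions at its image, a nearby point
whose image lies in other directions. -/
theorem exists_escape_legs [LocallyPathConnectedSpace X]
    (hdisc : ∀ x : X, ∀ U ∈ 𝓝 x, ∃ j : ℂ → X, ContinuousOn j (Metric.closedBall 0 1) ∧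
      InjOn j (Metric.closedBall 0 1) ∧ MapsTo j (Metric.closedBall 0 1) U ∧ j 0 = x)
    (hinj : ∀ x, ∃ U ∈ 𝓝 x, ∀ y ∈ U, ∀ z ∈ U, φ₁ y = φ₁ z → φ₂ y = φ₂ z → y = z)
    {x : X} {ρ₁ ρ₂ : ℝ} {sec₁ : T₁ → bouquet g → T₁} {sec₂ : T₂ → bouquet g → T₂}
    (hs₁ : IsStar q₁ (φ₁ x) ρ₁ sec₁) (hs₂ : IsStar q₂ (φ₂ x) ρ₂ sec₂) :
    ∃ W : Set X, IsPathConnected W ∧ x ∈ W ∧ MapsTo φ₁ W (Metric.ball (φ₁ x) ρ₁) ∧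
      MapsTo φ₂ W (Metric.ball (φ₂ x) ρ₂) ∧ ∃ ε : ℝ, 0 < ε ∧ ∀ l₁ l₂, ∃ x' ∈ W,
      (∃ l ≠ l₁, ∃ r ∈ Ioo 0 ρ₁, ε ≤ r ∧ φ₁ x' = legPath (φ₁ x) l r) ∧
      ∃ l ≠ l₂, ∃ r ∈ Ioo 0 ρ₂, ε ≤ r ∧ φ₂ x' = legPath (φ₂ x) l r := by
  obtain ⟨U, hU, hUinj⟩ := hinj x
  have hN : φ₁ ⁻¹' Metric.ball (φ₁ x) ρ₁ ∩ φ₂ ⁻¹' Metric.ball (φ₂ x) ρ₂ ∈ 𝓝 x :=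
    inter_mem (φ₁.continuous.continuousAt (Metric.ball_mem_nhds _ hs₁.pos))
      (φ₂.continuous.continuousAt (Metric.ball_mem_nhds _ hs₂.pos))
  obtain ⟨W, ⟨hW, hWp⟩, hWN⟩ := (path_connected_basis x).mem_iff.1 hN
  refine ⟨W, hWp, mem_of_mem_nhds hW, fun z hz => (hWN hz).1, fun z hz => (hWN hz).2, ?_⟩
  obtain ⟨j, hj, hji, hjU, hj0⟩ := hdisc x (U ∩ W) (inter_mem hU hW)
  have hev : ∀ l₁ l₂, ∀ᶠ ε : ℝ in 𝓝[>] 0, ∃ x' ∈ W,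
      (∃ l ≠ l₁, ∃ r ∈ Ioo 0 ρ₁, ε ≤ r ∧ φ₁ x' = legPath (φ₁ x) l r) ∧
      ∃ l ≠ l₂, ∃ r ∈ Ioo 0 ρ₂, ε ≤ r ∧ φ₂ x' = legPath (φ₂ x) l r := fun l₁ l₂ => by
    obtain ⟨z, hz, ⟨l, hl, r, hr, hlr⟩, l', hl', r', hr', hlr'⟩ :=
      exists_leg_of_injective_disc hs₁.le hs₂.le hs₁.star hs₂.star
      (k₁ := fun z => φ₁ (j z)) (k₂ := fun z => φ₂ (j z))
      (φ₁.continuous.comp_continuousOn hj) (φ₂.continuous.comp_continuousOn hj)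
      (fun z hz => (hWN (hjU hz).2).1) (fun z hz => (hWN (hjU hz).2).2)
      (fun z hz w hw h h' => hji hz hw (hUinj _ (hjU hz).1 _ (hjU hw).1 h h'))
      (congrArg φ₁ hj0) (congrArg φ₂ hj0) l₁ l₂
    filter_upwards [Ioo_mem_nhdsGT (lt_min hr.1 hr'.1)] with ε hε
    exact ⟨j z, (hjU hz).2, ⟨l, hl, r, hr, hε.2.le.trans (min_le_left _ _), hlr⟩,
      l', hl', r', hr', hε.2.le.trans (min_le_right _ _), hlr'⟩
  obtain ⟨ε, h, hε⟩ := ((eventually_all.2 fun l₁ => eventually_all.2 (hev l₁)).and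
    self_mem_nhdsWithin).exists
  exact ⟨ε, hε, h⟩

variable (q₁ q₂ F₁ F₂) in
/-- From `s` one can reach a point of the cover whose images in the trees are on the same sides of
`y₁` and `y₂`, and farther from these vertices by `ε`. -/
def CanEscape (ε : ℝ) (y₁ : T₁) (y₂ : T₂) (s : S) : Prop :=
  ∃ s', F₁ s' ∈ connectedComponentIn {y₁}ᶜ (F₁ s) ∧ F₂ s' ∈ connectedComponentIn {y₂}ᶜ (F₂ s) ∧
    treeEDist q₁ y₁ (F₁ s) + ENNReal.ofReal ε ≤ treeEDist q₁ y₁ (F₁ s') ∧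
    treeEDist q₂ y₂ (F₂ s) + ENNReal.ofReal ε ≤ treeEDist q₂ y₂ (F₂ s')

/-- At the points above `x` there is only a finite number of pairs of legs pointing towards `y₁` and
`y₂`, so the amount `ε` can be chosen independently of `y₁`, `y₂` and the point. -/
theorem exists_canEscape [LocallyPathConnectedSpace X] [SimplyConnectedSpace T₁]
    [SimplyConnectedSpace T₂] (hp : IsCoveringMap p) (hq₁ : IsCoveringMap q₁)
    (hq₂ : IsCoveringMap q₂)
    (hF₁ : ∀ s, q₁ (F₁ s) = φ₁ (p s)) (hF₂ : ∀ s, q₂ (F₂ s) = φ₂ (p s))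
    (hdisc : ∀ x : X, ∀ U ∈ 𝓝 x, ∃ j : ℂ → X, ContinuousOn j (Metric.closedBall 0 1) ∧
      InjOn j (Metric.closedBall 0 1) ∧ MapsTo j (Metric.closedBall 0 1) U ∧ j 0 = x)
    (hinj : ∀ x, ∃ U ∈ 𝓝 x, ∀ y ∈ U, ∀ z ∈ U, φ₁ y = φ₁ z → φ₂ y = φ₂ z → y = z) (x : X) :
    ∃ ε : ℝ, 0 < ε ∧ ∀ s, p s = x → ∀ y₁ ≠ F₁ s, ∀ y₂ ≠ F₂ s, CanEscape q₁ q₂ F₁ F₂ ε y₁ y₂ s := by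
  obtain ⟨ρ₁, sec₁, hs₁⟩ := hq₁.exists_isStar (φ₁ x)
  obtain ⟨ρ₂, sec₂, hs₂⟩ := hq₂.exists_isStar (φ₂ x)
  obtain ⟨W, hWp, hxW, hW₁, hW₂, ε, hε, h⟩ := exists_escape_legs hdisc hinj hs₁ hs₂
  refine ⟨ε, hε, ?_⟩
  rintro s rfl y₁ hy₁ y₂ hy₂
  obtain ⟨l₁, -, hl₁⟩ := hs₁.exists_leg hq₁ (hF₁ s) hy₁
  obtain ⟨l₂, -, hl₂⟩ := hs₂.exists_leg hq₂ (hF₂ s) hy₂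
  obtain ⟨x', hx', ⟨m₁, hm₁, r₁, hr₁, hεr₁, hx₁⟩, m₂, hm₂, r₂, hr₂, hεr₂, hx₂⟩ := h l₁ l₂
  obtain ⟨s', hs', hj⟩ := hp.exists_joinedIn_preimage hWp hxW hx'
  have e₁ := hs₁.lift_eq_sec hF₁ hW₁ hj (hF₁ s)
  have e₂ := hs₂.lift_eq_sec hF₂ hW₂ hj (hF₂ s)
  rw [hs', hx₁] at e₁
  rw [hs', hx₂] at e₂
  obtain ⟨c₁, d₁⟩ := hs₁.escape (hF₁ s) hy₁ (hl₁ m₁ hm₁) hr₁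
  obtain ⟨c₂, d₂⟩ := hs₂.escape (hF₂ s) hy₂ (hl₂ m₂ hm₂) hr₂
  rw [← e₁] at c₁ d₁
  rw [← e₂] at c₂ d₂
  exact ⟨s', c₁, c₂, (add_le_add le_rfl (ENNReal.ofReal_le_ofReal hεr₁)).trans d₁,
    (add_le_add le_rfl (ENNReal.ofReal_le_ofReal hεr₂)).trans d₂⟩

/-- The escape from `s₁`, at the cost of half its amount, is also one from the nearby point `s`. -/
theorem canEscape_of_near {ε : ℝ} (hε : 0 < ε) {η : ℝ} (hη : 2 * η ≤ ε) (hη0 : 0 ≤ η)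
    {y₁ : T₁} {y₂ : T₂} {s s₁ : S} (h₁ : treeEDist q₁ (F₁ s) (F₁ s₁) ≤ ENNReal.ofReal η)
    (h₂ : treeEDist q₂ (F₂ s) (F₂ s₁) ≤ ENNReal.ofReal η)
    (hd₁ : ENNReal.ofReal η < treeEDist q₁ y₁ (F₁ s))
    (hd₂ : ENNReal.ofReal η < treeEDist q₂ y₂ (F₂ s))
    (h : y₁ ≠ F₁ s₁ → y₂ ≠ F₂ s₁ → CanEscape q₁ q₂ F₁ F₂ ε y₁ y₂ s₁) :
    CanEscape q₁ q₂ F₁ F₂ (ε / 2) y₁ y₂ s := by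
  have c₁ := mem_component_of_treeEDist_lt (h₁.trans_lt hd₁)
  have c₂ := mem_component_of_treeEDist_lt (h₂.trans_lt hd₂)
  obtain ⟨s', m₁, m₂, e₁, e₂⟩ := h (fun h => connectedComponentIn_subset _ _ c₁ h.symm)
    fun h => connectedComponentIn_subset _ _ c₂ h.symm
  rw [← connectedComponentIn_eq c₁] at m₁
  rw [← connectedComponentIn_eq c₂] at m₂
  have key : ∀ {a b c : ℝ≥0∞}, a ≤ b + ENNReal.ofReal η → b + ENNReal.ofReal ε ≤ c →
      a + ENNReal.ofReal (ε / 2) ≤ c := fun {a b c} hab hbc => by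
    refine (add_le_add hab le_rfl).trans (le_trans ?_ hbc)
    rw [add_assoc, ← ENNReal.ofReal_add hη0 (by linarith)]
    exact add_le_add le_rfl (ENNReal.ofReal_le_ofReal (by linarith))
  refine ⟨s', m₁, m₂, key ?_ e₁, key ?_ e₂⟩
  · refine (treeEDist_triangle y₁ (F₁ s₁) (F₁ s)).trans (add_le_add le_rfl ?_)
    rwa [treeEDist_comm]
  · refine (treeEDist_triangle y₂ (F₂ s₁) (F₂ s)).trans (add_le_add le_rfl ?_)
    rwa [treeEDist_comm]

/-- Away from the vertices `y₁` and `y₂`, one can escape by a uniform amount, by compactness. -/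
theorem exists_uniform_canEscape [LocallyPathConnectedSpace X] [CompactSpace X]
    (hp : IsCoveringMap p)
    (hq₁ : IsCoveringMap q₁) (hq₂ : IsCoveringMap q₂)
    (hF₁ : ∀ s, q₁ (F₁ s) = φ₁ (p s)) (hF₂ : ∀ s, q₂ (F₂ s) = φ₂ (p s))
    (hesc : ∀ x : X, ∃ ε : ℝ, 0 < ε ∧ ∀ s, p s = x → ∀ y₁ ≠ F₁ s, ∀ y₂ ≠ F₂ s,
      CanEscape q₁ q₂ F₁ F₂ ε y₁ y₂ s) {η : ℝ} (hη : 0 < η) :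
    ∃ ε : ℝ, 0 < ε ∧ ∀ s y₁ y₂, ENNReal.ofReal η ≤ treeEDist q₁ y₁ (F₁ s) →
      ENNReal.ofReal η ≤ treeEDist q₂ y₂ (F₂ s) → CanEscape q₁ q₂ F₁ F₂ ε y₁ y₂ s := by
  have hmono : ∀ {ε ε' : ℝ} {y₁ y₂ s}, ε' ≤ ε → CanEscape q₁ q₂ F₁ F₂ ε y₁ y₂ s →
      CanEscape q₁ q₂ F₁ F₂ ε' y₁ y₂ s := fun {ε ε' y₁ y₂ s} hε ⟨s', m₁, m₂, e₁, e₂⟩ =>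
    ⟨s', m₁, m₂, (add_le_add le_rfl (ENNReal.ofReal_le_ofReal hε)).trans e₁,
      (add_le_add le_rfl (ENNReal.ofReal_le_ofReal hε)).trans e₂⟩
  have huniv := isCompact_univ.induction_on (s := (univ : Set X)) (p := fun A => ∃ ε : ℝ, 0 < ε ∧
    ∀ s y₁ y₂, p s ∈ A → ENNReal.ofReal η ≤ treeEDist q₁ y₁ (F₁ s) →
      ENNReal.ofReal η ≤ treeEDist q₂ y₂ (F₂ s) → CanEscape q₁ q₂ F₁ F₂ ε y₁ y₂ s)
    ⟨1, one_pos, fun s _ _ hs => hs.elim⟩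
    (fun A A' hA ⟨ε, hε, h⟩ => ⟨ε, hε, fun s y₁ y₂ hs => h s y₁ y₂ (hA hs)⟩) ?_ fun x _ => ?_
  · obtain ⟨ε, hε, h⟩ := huniv
    exact ⟨ε, hε, fun s y₁ y₂ => h s y₁ y₂ (mem_univ _)⟩
  · rintro A A' ⟨ε, hε, h⟩ ⟨ε', hε', h'⟩
    refine ⟨min ε ε', lt_min hε hε', fun s y₁ y₂ hs h₁ h₂ => ?_⟩
    rcases hs with hs | hs
    · exact hmono (min_le_left _ _) (h s y₁ y₂ hs h₁ h₂)
    · exact hmono (min_le_right _ _) (h' s y₁ y₂ hs h₁ h₂)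
  · obtain ⟨ε, hε, h⟩ := hesc x
    have hpos : 0 < min (ε / 2) (η / 2) := by positivity
    obtain ⟨W, hW, hWs⟩ := exists_nhds_treeEDist_lift_le hp hq₁ hq₂ hF₁ hF₂ x hpos
    refine ⟨W, nhdsWithin_le_nhds hW, ε / 2, half_pos hε, fun s y₁ y₂ hs h₁ h₂ => ?_⟩
    obtain ⟨s₁, hs₁, d₁, d₂⟩ := hWs s hs x (mem_of_mem_nhds hW)
    have hlt : ENNReal.ofReal (min (ε / 2) (η / 2)) < ENNReal.ofReal η :=
      (ENNReal.ofReal_lt_ofReal_iff hη).2 (by linarith [min_le_right (ε / 2) (η / 2)])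
    exact canEscape_of_near hε (by linarith [min_le_left (ε / 2) (η / 2)]) hpos.le d₁ d₂
      (hlt.trans_le h₁) (hlt.trans_le h₂) fun hy₁ hy₂ => h s₁ hs₁ y₁ hy₁ y₂ hy₂

/-- Iterating the escape, one gets arbitrarily far inside every quadrant that contains a point of
the image of the cover. -/
theorem exists_far
    (hesc : ∀ x : X, ∃ ε : ℝ, 0 < ε ∧ ∀ s, p s = x → ∀ y₁ ≠ F₁ s, ∀ y₂ ≠ F₂ s,
      CanEscape q₁ q₂ F₁ F₂ ε y₁ y₂ s)
    (hunif : ∀ η : ℝ, 0 < η → ∃ ε : ℝ, 0 < ε ∧ ∀ s y₁ y₂,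
      ENNReal.ofReal η ≤ treeEDist q₁ y₁ (F₁ s) → ENNReal.ofReal η ≤ treeEDist q₂ y₂ (F₂ s) →
      CanEscape q₁ q₂ F₁ F₂ ε y₁ y₂ s)
    {s : S} {y₁ : T₁} {y₂ : T₂} (h₁ : y₁ ≠ F₁ s) (h₂ : y₂ ≠ F₂ s) (n : ℕ) :
    ∃ s', F₁ s' ∈ connectedComponentIn {y₁}ᶜ (F₁ s) ∧ F₂ s' ∈ connectedComponentIn {y₂}ᶜ (F₂ s) ∧
      n ≤ treeEDist q₁ y₁ (F₁ s') ∧ n ≤ treeEDist q₂ y₂ (F₂ s') := by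
  obtain ⟨η, hη, hη'⟩ := hesc (p s)
  obtain ⟨ε, hε, hε'⟩ := hunif η hη
  have key : ∀ k : ℕ, ∃ s', F₁ s' ∈ connectedComponentIn {y₁}ᶜ (F₁ s) ∧
      F₂ s' ∈ connectedComponentIn {y₂}ᶜ (F₂ s) ∧
      ENNReal.ofReal (η + k * ε) ≤ treeEDist q₁ y₁ (F₁ s') ∧
      ENNReal.ofReal (η + k * ε) ≤ treeEDist q₂ y₂ (F₂ s') := fun k => by
    induction k with
    | zero =>
      obtain ⟨s', m₁, m₂, e₁, e₂⟩ := hη' s rfl y₁ h₁ y₂ h₂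
      exact ⟨s', m₁, m₂, by simpa using le_add_self.trans e₁, by simpa using le_add_self.trans e₂⟩
    | succ k ih =>
      obtain ⟨s', m₁, m₂, e₁, e₂⟩ := ih
      have hk : ENNReal.ofReal η ≤ ENNReal.ofReal (η + k * ε) :=
        ENNReal.ofReal_le_ofReal (by nlinarith [hε.le, (Nat.cast_nonneg k : (0 : ℝ) ≤ k)])
      obtain ⟨s'', m₁', m₂', e₁', e₂'⟩ := hε' s' y₁ y₂ (hk.trans e₁) (hk.trans e₂)
      have hsum : ENNReal.ofReal (η + (k + 1 : ℕ) * ε) =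
          ENNReal.ofReal (η + k * ε) + ENNReal.ofReal ε := by
        rw [← ENNReal.ofReal_add (by positivity) hε.le]
        congr 1
        push_cast
        ring
      rw [← connectedComponentIn_eq m₁] at m₁'
      rw [← connectedComponentIn_eq m₂] at m₂'
      rw [hsum]
      exact ⟨s'', m₁', m₂', (add_le_add e₁ le_rfl).trans e₁', (add_le_add e₂ le_rfl).trans e₂'⟩
  obtain ⟨k, hk⟩ := exists_nat_gt (n / ε)
  obtain ⟨s', m₁, m₂, e₁, e₂⟩ := key k
  have hn : (n : ℝ≥0∞) ≤ ENNReal.ofReal (η + k * ε) := by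
    rw [← ENNReal.ofReal_natCast]
    refine ENNReal.ofReal_le_ofReal ?_
    rw [div_lt_iff₀ hε] at hk
    linarith
  exact ⟨s', m₁, m₂, hn.trans e₁, hn.trans e₂⟩

end Heavy

/-! ### The orbit of the base point -/

section Orbit

variable {X S T₁ T₂ : Type*} [TopologicalSpace X] [TopologicalSpace S] [TopologicalSpace T₁]
  [TopologicalSpace T₂] [SimplyConnectedSpace T₁] [SimplyConnectedSpace T₂]
  {g : ℕ} {p : C(S, X)} {q₁ : T₁ → bouquet g} {q₂ : T₂ → bouquet g}
  {φ₁ φ₂ : C(X, bouquet g)} {F₁ : C(S, T₁)} {F₂ : C(S, T₂)}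

theorem deckTransformation_map_base {T : Type*} [TopologicalSpace T] [SimplyConnectedSpace T]
    {q : T → bouquet g} {φ : C(X, bouquet g)} {F : C(S, T)} (hq : IsCoveringMap q)
    (hF : ∀ s, q (F s) = φ (p s)) {s₀ : S} (c : Path (p s₀) (p s₀)) {L : C(I, S)}
    (hL : ∀ u, p (L u) = c u) (hL0 : L 0 = s₀) :
    deckTransformation hq ⟨F s₀, hF s₀⟩
      (FundamentalGroup.map φ (p s₀) (Path.Homotopic.Quotient.mk c)) (F s₀) = F (L 1) :=
  (deckTransformation_base hq ⟨F s₀, hF s₀⟩ _).trans (hq.monodromy_map_eq hF c hL hL0)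

/-- The points of the image of the cover above the base point of the surface are translates of the
base point in both trees at once. -/
theorem exists_deckTransformation_eq [PathConnectedSpace S] (hq₁ : IsCoveringMap q₁)
    (hq₂ : IsCoveringMap q₂) (hF₁ : ∀ s, q₁ (F₁ s) = φ₁ (p s)) (hF₂ : ∀ s, q₂ (F₂ s) = φ₂ (p s))
    {s₀ s : S} (hs : p s = p s₀) : ∃ α : FundamentalGroup X (p s₀),
      deckTransformation hq₁ ⟨F₁ s₀, hF₁ s₀⟩ (FundamentalGroup.map φ₁ (p s₀) α) (F₁ s₀) = F₁ s ∧
      deckTransformation hq₂ ⟨F₂ s₀, hF₂ s₀⟩ (FundamentalGroup.map φ₂ (p s₀) α) (F₂ s₀) = F₂ s := by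
  let c := PathConnectedSpace.somePath s₀ s
  refine ⟨Path.Homotopic.Quotient.mk ((c.map p.continuous).cast rfl hs.symm), ?_, ?_⟩
  · rw [deckTransformation_map_base hq₁ hF₁ _ (L := c.toContinuousMap) (fun u => rfl) (by simp)]
    simp
  · rw [deckTransformation_map_base hq₂ hF₂ _ (L := c.toContinuousMap) (fun u => rfl) (by simp)]
    simp

theorem exists_eq_deckTransformation (hp : IsCoveringMap p) (hq₁ : IsCoveringMap q₁)
    (hq₂ : IsCoveringMap q₂) (hF₁ : ∀ s, q₁ (F₁ s) = φ₁ (p s)) (hF₂ : ∀ s, q₂ (F₂ s) = φ₂ (p s))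
    {s₀ : S} (α : FundamentalGroup X (p s₀)) : ∃ s,
      deckTransformation hq₁ ⟨F₁ s₀, hF₁ s₀⟩ (FundamentalGroup.map φ₁ (p s₀) α) (F₁ s₀) = F₁ s ∧
      deckTransformation hq₂ ⟨F₂ s₀, hF₂ s₀⟩ (FundamentalGroup.map φ₂ (p s₀) α) (F₂ s₀) = F₂ s := by
  induction α using Path.Homotopic.Quotient.ind with
  | mk c =>
  have hL := hp.liftPath_lifts c.toContinuousMap s₀ (by simp)
  have hL0 := hp.liftPath_zero c.toContinuousMap s₀ (by simp)
  set L := hp.liftPath c.toContinuousMap s₀ (by simp)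
  exact ⟨L 1, deckTransformation_map_base hq₁ hF₁ c (fun u => congrFun hL u) hL0,
    deckTransformation_map_base hq₂ hF₂ c (fun u => congrFun hL u) hL0⟩

/-! ### The image of the cover lies in the core -/

/-- A point `w` near a point `u` that is far from `y` is on the same side of `y` as `u`, and far
from `t`. -/
theorem mem_component_and_lt_of_far {T : Type*} [TopologicalSpace T] {q : T → bouquet g}
    {t u w y : T} {n m : ℕ} {K : ℝ≥0∞}
    (hu : m ≤ treeEDist q y u) (hw : treeEDist q u w ≤ K) (hm : n + (K + treeEDist q y t) < m) :
    w ∈ connectedComponentIn {y}ᶜ u ∧ n < treeEDist q t w := by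
  constructor
  · refine mem_component_of_treeEDist_lt (hw.trans_lt (lt_of_lt_of_le ?_ hu))
    exact (le_self_add.trans le_add_self).trans_lt hm
  · have h1 : treeEDist q y u ≤ treeEDist q t w + (K + treeEDist q y t) := by
      refine (treeEDist_triangle y t u).trans ?_
      rw [add_comm K, ← add_assoc, add_comm (treeEDist q t w), add_assoc]
      refine add_le_add le_rfl ((treeEDist_triangle t w u).trans (add_le_add le_rfl ?_))
      rwa [treeEDist_comm]
    have h2 := hm.trans_le (hu.trans h1)
    exact lt_of_add_lt_add_right h2

/-- Every quadrant that meets the image of the cover is heavy. -/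
theorem isHeavy_of_lift_mem [LocallyPathConnectedSpace X] [CompactSpace X] [PathConnectedSpace S]
    (hp : IsCoveringMap p) (hq₁ : IsCoveringMap q₁) (hq₂ : IsCoveringMap q₂)
    (hF₁ : ∀ s, q₁ (F₁ s) = φ₁ (p s)) (hF₂ : ∀ s, q₂ (F₂ s) = φ₂ (p s))
    (hdisc : ∀ x : X, ∀ U ∈ 𝓝 x, ∃ j : ℂ → X, ContinuousOn j (Metric.closedBall 0 1) ∧
      InjOn j (Metric.closedBall 0 1) ∧ MapsTo j (Metric.closedBall 0 1) U ∧ j 0 = x)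
    (hinj : ∀ x, ∃ U ∈ 𝓝 x, ∀ y ∈ U, ∀ z ∈ U, φ₁ y = φ₁ z → φ₂ y = φ₂ z → y = z)
    (s₀ : S) (t : T₁ × T₂) {Q : Set (T₁ × T₂)} (hQ : IsQuadrant Q) {s : S} (hs : (F₁ s, F₂ s) ∈ Q) :
    IsHeavy (fun α : FundamentalGroup X (p s₀) =>
        deckTransformation hq₁ ⟨F₁ s₀, hF₁ s₀⟩ (FundamentalGroup.map φ₁ (p s₀) α))
      (fun α : FundamentalGroup X (p s₀) =>
        deckTransformation hq₂ ⟨F₂ s₀, hF₂ s₀⟩ (FundamentalGroup.map φ₂ (p s₀) α))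
      (treeEDist q₁) (treeEDist q₂) t Q := by
  obtain ⟨_, _, ⟨y₁, z₁, -, rfl⟩, ⟨y₂, z₂, -, rfl⟩, rfl⟩ := hQ
  have hc₁ := connectedComponentIn_eq hs.1
  have hc₂ := connectedComponentIn_eq hs.2
  have hesc := exists_canEscape hp hq₁ hq₂ hF₁ hF₂ hdisc hinj
  have hfar := exists_far hesc (fun η hη => exists_uniform_canEscape hp hq₁ hq₂ hF₁ hF₂ hesc hη)
    (s := s) (fun h => connectedComponentIn_subset _ _ hs.1 h.symm)
    (fun h => connectedComponentIn_subset _ _ hs.2 h.symm)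
  obtain ⟨K, hK, hnear⟩ := exists_treeEDist_fiber_le hp hq₁ hq₂ hF₁ hF₂ s₀
  have hK₁ : K + treeEDist q₁ (F₁ s₀) t.1 ≠ ⊤ := ENNReal.add_ne_top.2 ⟨hK, treeEDist_ne_top hq₁ _ _⟩
  have hK₂ : K + treeEDist q₂ (F₂ s₀) t.2 ≠ ⊤ := ENNReal.add_ne_top.2 ⟨hK, treeEDist_ne_top hq₂ _ _⟩
  have key : ∀ n : ℕ, ∃ α : FundamentalGroup X (p s₀),
      (deckTransformation hq₁ ⟨F₁ s₀, hF₁ s₀⟩ (FundamentalGroup.map φ₁ (p s₀) α) t.1 ∈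
          connectedComponentIn {y₁}ᶜ z₁ ∧
        n < treeEDist q₁ t.1
          (deckTransformation hq₁ ⟨F₁ s₀, hF₁ s₀⟩ (FundamentalGroup.map φ₁ (p s₀) α) t.1)) ∧
      (deckTransformation hq₂ ⟨F₂ s₀, hF₂ s₀⟩ (FundamentalGroup.map φ₂ (p s₀) α) t.2 ∈
          connectedComponentIn {y₂}ᶜ z₂ ∧
        n < treeEDist q₂ t.2
          (deckTransformation hq₂ ⟨F₂ s₀, hF₂ s₀⟩ (FundamentalGroup.map φ₂ (p s₀) α) t.2)) := by
    intro n
    obtain ⟨m, hm⟩ := ENNReal.exists_nat_gt (r := max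
      (n + (K + treeEDist q₁ (F₁ s₀) t.1 + treeEDist q₁ y₁ t.1))
      (n + (K + treeEDist q₂ (F₂ s₀) t.2 + treeEDist q₂ y₂ t.2)))
      (by
        rw [Ne, max_eq_top, not_or]
        exact ⟨ENNReal.add_ne_top.2 ⟨ENNReal.natCast_ne_top n,
          ENNReal.add_ne_top.2 ⟨hK₁, treeEDist_ne_top hq₁ _ _⟩⟩,
          ENNReal.add_ne_top.2 ⟨ENNReal.natCast_ne_top n,
          ENNReal.add_ne_top.2 ⟨hK₂, treeEDist_ne_top hq₂ _ _⟩⟩⟩)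
    obtain ⟨s', m₁, m₂, d₁, d₂⟩ := hfar m
    obtain ⟨s'', hs'', k₁, k₂⟩ := hnear s'
    obtain ⟨α, hα₁, hα₂⟩ := exists_deckTransformation_eq hq₁ hq₂ hF₁ hF₂ hs''
    refine ⟨α, ?_, ?_⟩
    · rw [hc₁, connectedComponentIn_eq m₁]
      refine mem_component_and_lt_of_far d₁
        ((treeEDist_triangle _ (F₁ s'') _).trans (add_le_add k₁ ?_)) ((le_max_left _ _).trans_lt hm)
      rw [← hα₁]
      exact treeEDist_deckTransformation_le hq₁ ⟨F₁ s₀, hF₁ s₀⟩ _ _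
    · rw [hc₂, connectedComponentIn_eq m₂]
      refine mem_component_and_lt_of_far d₂
        ((treeEDist_triangle _ (F₂ s'') _).trans (add_le_add k₂ ?_)) ((le_max_right _ _).trans_lt hm)
      rw [← hα₂]
      exact treeEDist_deckTransformation_le hq₂ ⟨F₂ s₀, hF₂ s₀⟩ _ _
  choose γ hγ₁ hγ₂ using key
  refine ⟨γ, fun n => ⟨(hγ₁ n).1, (hγ₂ n).1⟩, ?_, ?_⟩
  · refine ENNReal.tendsto_nhds_top fun n => ?_
    filter_upwards [eventually_ge_atTop n] with k hk
    exact lt_of_le_of_lt (Nat.cast_le.2 hk) (hγ₁ k).2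
  · refine ENNReal.tendsto_nhds_top fun n => ?_
    filter_upwards [eventually_ge_atTop n] with k hk
    exact lt_of_le_of_lt (Nat.cast_le.2 hk) (hγ₂ k).2

end Orbit

/-! ### Fibres of the complement of a union of quadrants -/

section Fibres

variable {T₁ T₂ : Type*} [TopologicalSpace T₁] [TopologicalSpace T₂]

/-- The fibre is the complement of a union of directions in the second tree. -/
theorem isPreconnected_fiber_fst [T2Space T₂] [LocallyConnectedSpace T₂] [PathConnectedSpace T₂]
    {𝒬 : Set (Set (T₁ × T₂))} (h𝒬 : ∀ Q ∈ 𝒬, IsQuadrant Q) (a : T₁) :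
    IsPreconnected ((⋃₀ 𝒬)ᶜ ∩ Prod.fst ⁻¹' {a}) := by
  have h : (⋃₀ 𝒬)ᶜ ∩ Prod.fst ⁻¹' {a} = (fun b => (a, b)) ''
      (⋃₀ {δ₂ | IsDirection δ₂ ∧ ∃ δ₁ : Set T₁, a ∈ δ₁ ∧ δ₁ ×ˢ δ₂ ∈ 𝒬})ᶜ := by
    apply Subset.antisymm
    · rintro ⟨_, b⟩ ⟨hab, rfl⟩
      refine ⟨b, ?_, rfl⟩
      rintro ⟨δ₂, ⟨-, δ₁, ha, hQ⟩, hb⟩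
      exact hab ⟨_, hQ, ha, hb⟩
    · rintro _ ⟨b, hb, rfl⟩
      refine ⟨?_, rfl⟩
      rintro ⟨Q, hQ, hab⟩
      obtain ⟨δ₁, δ₂, -, h₂, rfl⟩ := h𝒬 Q hQ
      exact hb ⟨δ₂, ⟨h₂, δ₁, hab.1, hQ⟩, hab.2⟩
  rw [h]
  exact (isPreconnected_compl_sUnion_directions _ fun δ hδ => hδ.1).image _ (by fun_prop)

/-- The fibre is the complement of a union of directions in the first tree. -/
theorem isPreconnected_fiber_snd [T2Space T₁] [LocallyConnectedSpace T₁] [PathConnectedSpace T₁]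
    {𝒬 : Set (Set (T₁ × T₂))} (h𝒬 : ∀ Q ∈ 𝒬, IsQuadrant Q) (b : T₂) :
    IsPreconnected ((⋃₀ 𝒬)ᶜ ∩ Prod.snd ⁻¹' {b}) := by
  have h : (⋃₀ 𝒬)ᶜ ∩ Prod.snd ⁻¹' {b} = (fun a => (a, b)) ''
      (⋃₀ {δ₁ | IsDirection δ₁ ∧ ∃ δ₂ : Set T₂, b ∈ δ₂ ∧ δ₁ ×ˢ δ₂ ∈ 𝒬})ᶜ := by
    apply Subset.antisymm
    · rintro ⟨a, _⟩ ⟨hab, rfl⟩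
      refine ⟨a, ?_, rfl⟩
      rintro ⟨δ₁, ⟨-, δ₂, hb, hQ⟩, ha⟩
      exact hab ⟨_, hQ, ha, hb⟩
    · rintro _ ⟨a, ha, rfl⟩
      refine ⟨?_, rfl⟩
      rintro ⟨Q, hQ, hab⟩
      obtain ⟨δ₁, δ₂, h₁, -, rfl⟩ := h𝒬 Q hQ
      exact ha ⟨δ₁, ⟨h₁, δ₂, hab.2, hQ⟩, hab.1⟩
  rw [h]
  exact (isPreconnected_compl_sUnion_directions _ fun δ hδ => hδ.1).image _ (by fun_prop)

end Fibres

/-! ### Minimality of the core -/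

section Minimal

theorem IsConnected.exists_isDirection {T : Type*} [TopologicalSpace T] {A : Set T}
    (hA : IsConnected A) {a : T} (ha : a ∉ A) : ∃ y ≠ a, A ⊆ _root_.connectedComponentIn {a}ᶜ y := by
  obtain ⟨y, hy⟩ := hA.nonempty
  exact ⟨y, fun h => ha (h ▸ hy),
    hA.isPreconnected.subset_connectedComponentIn hy fun z hz (h : z = a) => ha (h ▸ hz)⟩

/-- If a set with connected fibres contains the image of `(F₁, F₂)` but not the point `(a, b)`, then
the image lies over the union of a direction at `a` and a direction at `b`. -/
theorem exists_directions_of_notMem {S T₁ T₂ : Type*} [TopologicalSpace S] [TopologicalSpace T₁]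
    [TopologicalSpace T₂] [PreconnectedSpace S] [T1Space T₁] [LocallyConnectedSpace T₁]
    [T1Space T₂] [LocallyConnectedSpace T₂] {F₁ : C(S, T₁)} {F₂ : C(S, T₂)}
    (hsurj : Function.Surjective F₁) {A : Set (T₁ × T₂)} (hA : ∀ s, (F₁ s, F₂ s) ∈ A)
    (hA₁ : ∀ a, IsConnected (A ∩ Prod.fst ⁻¹' {a})) (hA₂ : ∀ b, IsConnected (A ∩ Prod.snd ⁻¹' {b}))
    {a : T₁} {b : T₂} (hab : (a, b) ∉ A) : ∃ y₁ ≠ a, ∃ y₂ ≠ b,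
      ∀ s, F₁ s ∈ connectedComponentIn {a}ᶜ y₁ ∨ F₂ s ∈ connectedComponentIn {b}ᶜ y₂ := by
  obtain ⟨y₂, hy₂, h₂⟩ := ((hA₁ a).image Prod.snd continuous_snd.continuousOn).exists_isDirection
    (a := b) (by
      rintro ⟨⟨a', b'⟩, ⟨h, rfl⟩, rfl⟩
      exact hab h)
  obtain ⟨y₁, hy₁, h₁⟩ := ((hA₂ b).image Prod.fst continuous_fst.continuousOn).exists_isDirection
    (a := a) (by
      rintro ⟨⟨a', b'⟩, ⟨h, rfl⟩, rfl⟩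
      exact hab h)
  refine ⟨y₁, hy₁, y₂, hy₂, ?_⟩
  have ha : ∀ s, F₁ s = a → F₂ s ∈ connectedComponentIn {b}ᶜ y₂ := fun s hs =>
    h₂ ⟨_, ⟨hA s, hs⟩, rfl⟩
  have hb : ∀ s, F₂ s = b → F₁ s ∈ connectedComponentIn {a}ᶜ y₁ := fun s hs =>
    h₁ ⟨_, ⟨hA s, hs⟩, rfl⟩
  have ho₁ : IsOpen (connectedComponentIn {a}ᶜ y₁) := isOpen_compl_singleton.connectedComponentIn
  have ho₂ : IsOpen (connectedComponentIn {b}ᶜ y₂) := isOpen_compl_singleton.connectedComponentIn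
  have hclopen : IsClopen {s | F₁ s ∉ connectedComponentIn {a}ᶜ y₁ ∧
      F₂ s ∉ connectedComponentIn {b}ᶜ y₂} := by
    constructor
    · exact (ho₁.isClosed_compl.preimage F₁.continuous).inter
        (ho₂.isClosed_compl.preimage F₂.continuous)
    · have : {s | F₁ s ∉ connectedComponentIn {a}ᶜ y₁ ∧ F₂ s ∉ connectedComponentIn {b}ᶜ y₂} =
          F₁ ⁻¹' (insert a (connectedComponentIn {a}ᶜ y₁))ᶜ ∩
            F₂ ⁻¹' (insert b (connectedComponentIn {b}ᶜ y₂))ᶜ := by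
        ext s
        simp only [mem_ofPred_eq, mem_inter_iff, mem_preimage, mem_compl_iff, mem_insert_iff, not_or]
        exact ⟨fun h => ⟨⟨fun h' => h.2 (ha s h'), h.1⟩, fun h' => h.1 (hb s h'), h.2⟩,
          fun h => ⟨h.1.2, h.2.2⟩⟩
      rw [this]
      exact ((isClosed_insert_connectedComponentIn a y₁).isOpen_compl.preimage F₁.continuous).inter
        ((isClosed_insert_connectedComponentIn b y₂).isOpen_compl.preimage F₂.continuous)
  rcases isClopen_iff.1 hclopen with h | h
  · intro s
    by_contra! hcon
    exact (h ▸ hcon : s ∈ (∅ : Set S))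
  · obtain ⟨s, hs⟩ := hsurj a
    have : s ∈ {s | F₁ s ∉ connectedComponentIn {a}ᶜ y₁ ∧ F₂ s ∉ connectedComponentIn {b}ᶜ y₂} :=
      h ▸ mem_univ s
    exact absurd (ha s hs) this.2

/-- Opposite to every direction at `a` there is a direction containing `a` whose intersection with
it is bounded, an open arc: its vertex is the end point of a short leg at `a`. -/
theorem exists_opposite_direction {g : ℕ} {T : Type*} [TopologicalSpace T] [SimplyConnectedSpace T]
    {q : T → bouquet g} (hq : IsCoveringMap q) {a y : T} (hy : y ≠ a) :
    ∃ η : Set T, IsDirection η ∧ a ∈ η ∧ ∃ K : ℝ≥0∞, K ≠ ⊤ ∧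
      ∀ z ∈ η ∩ connectedComponentIn {a}ᶜ y, treeEDist q a z ≤ K := by
  have := hq.t2Space_of_bouquet
  have := hq.locallyPathConnectedSpace_of_bouquet
  obtain ⟨ρ, sec, hs⟩ := hq.exists_isStar (q a)
  obtain ⟨l, hl, -⟩ := hs.exists_leg hq rfl hy
  have hr : ρ / 2 ∈ Ioo 0 ρ := ⟨by linarith [hs.pos], by linarith [hs.pos]⟩
  have hsub : Icc 0 (ρ / 2) ⊆ Ico 0 ρ := Icc_subset_Ico_right hr.2
  have harc := connectedComponentIn_inter_subset_arc (c := fun u => sec a (legPath (q a) l u)) hr.1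
    ((hs.continuousOn_leg rfl l).mono hsub) ((hs.injOn_leg rfl l).mono hsub)
    (hs.isOpen_leg rfl l hr.1 hr.2.le)
  simp only [hs.leg_zero (rfl : q a = q a)] at harc
  have hne : a ≠ sec a (legPath (q a) l (ρ / 2)) := (hs.leg_ne rfl l hr).symm
  refine ⟨_, ⟨_, a, hne, rfl⟩, mem_connectedComponentIn hne, ENNReal.ofReal ρ,
    ENNReal.ofReal_ne_top, ?_⟩
  rintro z ⟨hz, hz'⟩
  rw [connectedComponentIn_eq (hl _ hr)] at hz'
  obtain ⟨u, hu, rfl⟩ := harc ⟨hz, hz'⟩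
  exact (hs.treeEDist_leg_le rfl l ⟨hu.1.le, hu.2.trans hr.2⟩).trans
    (ENNReal.ofReal_le_ofReal (hu.2.le.trans hr.2.le))

/-- A point `w` of the opposite direction that is not far from a point `u` of the direction is not
far from `a`: either it lies in the bounded intersection or `a` separates it from `u`. -/
theorem treeEDist_le_of_opposite {g : ℕ} {T : Type*} [TopologicalSpace T] {q : T → bouquet g}
    {η : Set T} {a y t u w : T} {K E : ℝ≥0∞}
    (hη : ∀ z ∈ η ∩ connectedComponentIn {a}ᶜ y, treeEDist q a z ≤ K) (hw : w ∈ η)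
    (hu : u ∈ connectedComponentIn {a}ᶜ y) (huw : treeEDist q u w ≤ E) :
    treeEDist q t w ≤ treeEDist q t a + (K + E) := by
  refine (treeEDist_triangle t a w).trans (add_le_add le_rfl ?_)
  by_cases h : w ∈ connectedComponentIn {a}ᶜ y
  · exact (hη w ⟨hw, h⟩).trans le_self_add
  · rw [connectedComponentIn_eq hu] at h
    exact (le_add_self.trans (treeEDist_add_le h)).trans (huw.trans le_add_self)

end Minimal

section Light

variable {X S T₁ T₂ : Type*} [TopologicalSpace X] [TopologicalSpace S] [TopologicalSpace T₁]
  [TopologicalSpace T₂] [SimplyConnectedSpace T₁] [SimplyConnectedSpace T₂]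
  {g : ℕ} {p : C(S, X)} {q₁ : T₁ → bouquet g} {q₂ : T₂ → bouquet g}
  {φ₁ φ₂ : C(X, bouquet g)} {F₁ : C(S, T₁)} {F₂ : C(S, T₂)}

/-- If the image of the cover lies over the union of a direction at `a` and a direction at `b`, then
the point `(a, b)` lies in a light quadrant, made of opposite directions: an orbit point in this
quadrant is at bounded distance from the image, hence close to `a` or to `b` in one of the
trees. -/
theorem exists_light_quadrant (hp : IsCoveringMap p) (hq₁ : IsCoveringMap q₁)
    (hq₂ : IsCoveringMap q₂) (hF₁ : ∀ s, q₁ (F₁ s) = φ₁ (p s)) (hF₂ : ∀ s, q₂ (F₂ s) = φ₂ (p s))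
    (s₀ : S) (t : T₁ × T₂) {a y₁ : T₁} {b y₂ : T₂} (hy₁ : y₁ ≠ a) (hy₂ : y₂ ≠ b)
    (h : ∀ s, F₁ s ∈ connectedComponentIn {a}ᶜ y₁ ∨ F₂ s ∈ connectedComponentIn {b}ᶜ y₂) :
    ∃ Q : Set (T₁ × T₂), (a, b) ∈ Q ∧ IsQuadrant Q ∧
      ¬IsHeavy (fun α : FundamentalGroup X (p s₀) =>
          deckTransformation hq₁ ⟨F₁ s₀, hF₁ s₀⟩ (FundamentalGroup.map φ₁ (p s₀) α))
        (fun α : FundamentalGroup X (p s₀) =>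
          deckTransformation hq₂ ⟨F₂ s₀, hF₂ s₀⟩ (FundamentalGroup.map φ₂ (p s₀) α))
        (treeEDist q₁) (treeEDist q₂) t Q := by
  obtain ⟨η₁, hη₁, ha, K₁, hK₁, hb₁⟩ := exists_opposite_direction hq₁ hy₁
  obtain ⟨η₂, hη₂, hb, K₂, hK₂, hb₂⟩ := exists_opposite_direction hq₂ hy₂
  refine ⟨η₁ ×ˢ η₂, ⟨ha, hb⟩, ⟨η₁, η₂, hη₁, hη₂, rfl⟩, ?_⟩
  rintro ⟨γ, hγ, hlim₁, hlim₂⟩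
  have hM₁ : treeEDist q₁ t.1 a + (K₁ + treeEDist q₁ (F₁ s₀) t.1) < ⊤ := lt_top_iff_ne_top.2
    (ENNReal.add_ne_top.2 ⟨treeEDist_ne_top hq₁ _ _, ENNReal.add_ne_top.2
      ⟨hK₁, treeEDist_ne_top hq₁ _ _⟩⟩)
  have hM₂ : treeEDist q₂ t.2 b + (K₂ + treeEDist q₂ (F₂ s₀) t.2) < ⊤ := lt_top_iff_ne_top.2
    (ENNReal.add_ne_top.2 ⟨treeEDist_ne_top hq₂ _ _, ENNReal.add_ne_top.2
      ⟨hK₂, treeEDist_ne_top hq₂ _ _⟩⟩)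
  obtain ⟨n, hn₁, hn₂⟩ := ((hlim₁.eventually_const_lt hM₁).and
    (hlim₂.eventually_const_lt hM₂)).exists
  obtain ⟨s, hs₁, hs₂⟩ := exists_eq_deckTransformation hp hq₁ hq₂ hF₁ hF₂ (γ n)
  rcases h s with hs | hs
  · refine absurd (treeEDist_le_of_opposite hb₁ (hγ n).1 hs ?_) (not_le.2 hn₁)
    rw [← hs₁]
    exact treeEDist_deckTransformation_le hq₁ ⟨F₁ s₀, hF₁ s₀⟩ _ _
  · refine absurd (treeEDist_le_of_opposite hb₂ (hγ n).2 hs ?_) (not_le.2 hn₂)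
    rw [← hs₂]
    exact treeEDist_deckTransformation_le hq₂ ⟨F₂ s₀, hF₂ s₀⟩ _ _

end Light

/-- `p : S → H₁ ∩ H₂` is the cover of the splitting surface for the kernel of `f_*`, the maps
`q₁` and `q₂` are universal covers of the bouquets, and `fhat` is the lift of `f`. The class `α` in
the fundamental group of the surface at `p s₀` acts on the `i`-th tree by the deck transformation
of the class `(f_i)_* α`, relative to the point `fhat_i s₀`. The point `t` is the base point in the
definition of heavy quadrants. -/
theorem mainTheorem4 {M : Type*} [TopologicalSpace M] (g : ℕ) (H₁ H₂ : Set M)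
    (hM : IsHeegaardSplitting g H₁ H₂)
    (f : C(↥(H₁ ∩ H₂), bouquet g × bouquet g))
    (hf : IsStallingsMap g H₁ H₂ f) (hinj : IsLocallyInjective f)
    {S : Type*} [TopologicalSpace S] [PathConnectedSpace S]
    (p : C(S, ↥(H₁ ∩ H₂))) (hp : IsCoveringMap p) (s₀ : S)
    (hker : (FundamentalGroup.map p s₀).range = (FundamentalGroup.map f (p s₀)).ker)
    {T₁ : Type*} [TopologicalSpace T₁] [SimplyConnectedSpace T₁]
    (q₁ : T₁ → bouquet g) (hq₁ : IsCoveringMap q₁)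
    {T₂ : Type*} [TopologicalSpace T₂] [SimplyConnectedSpace T₂]
    (q₂ : T₂ → bouquet g) (hq₂ : IsCoveringMap q₂)
    (fhat : C(S, T₁ × T₂))
    (hfhat₁ : ∀ s, q₁ (fhat s).1 = firstCoord f (p s))
    (hfhat₂ : ∀ s, q₂ (fhat s).2 = secondCoord f (p s))
    (t : T₁ × T₂) :
    IsLeast
      {X : Set (T₁ × T₂) | range fhat ⊆ X ∧
        (∀ t₁ : T₁, IsConnected (X ∩ Prod.fst ⁻¹' {t₁})) ∧
        (∀ t₂ : T₂, IsConnected (X ∩ Prod.snd ⁻¹' {t₂}))}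
      (guirardelCore
        (fun α : FundamentalGroup ↥(H₁ ∩ H₂) (p s₀) =>
          deckTransformation hq₁ ⟨(fhat s₀).1, hfhat₁ s₀⟩
            (FundamentalGroup.map (firstCoord f) (p s₀) α))
        (fun α : FundamentalGroup ↥(H₁ ∩ H₂) (p s₀) =>
          deckTransformation hq₂ ⟨(fhat s₀).2, hfhat₂ s₀⟩
            (FundamentalGroup.map (secondCoord f) (p s₀) α))
        (treeEDist q₁) (treeEDist q₂) t) := by
  have := hM.handlebody_left.compactSpace
  have := hM.handlebody_left.locallyPathConnectedSpace
  have := hq₁.t2Space_of_bouquet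
  have := hq₁.locallyPathConnectedSpace_of_bouquet
  have := hq₂.t2Space_of_bouquet
  have := hq₂.locallyPathConnectedSpace_of_bouquet
  obtain ⟨⟨e₁, he₁⟩, ⟨e₂, he₂⟩⟩ := hf
  let F₁ : C(S, T₁) := ContinuousMap.fst.comp fhat
  let F₂ : C(S, T₂) := ContinuousMap.snd.comp fhat
  have hsurj₁ : Function.Surjective F₁ := surjective_lift hp hq₁ hfhat₁ s₀
    (hM.handlebody_left.map_surjective e₁ _ he₁ _)
  have hsurj₂ : Function.Surjective F₂ := surjective_lift hp hq₂ hfhat₂ s₀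
    (hM.handlebody_right.map_surjective e₂ _ he₂ _)
  have hloc : ∀ x, ∃ U ∈ 𝓝 x, ∀ y ∈ U, ∀ z ∈ U, firstCoord f y = firstCoord f z →
      secondCoord f y = secondCoord f z → y = z := fun x => by
    obtain ⟨U, hU, hxU, hUf⟩ := hinj x
    exact ⟨U, hU.mem_nhds hxU, fun y hy z hz h h' => hUf hy hz (Prod.ext h h')⟩
  refine ⟨?_, ?_⟩
  · have hsub : range fhat ⊆ guirardelCore
        (fun α : FundamentalGroup ↥(H₁ ∩ H₂) (p s₀) =>
          deckTransformation hq₁ ⟨(fhat s₀).1, hfhat₁ s₀⟩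
            (FundamentalGroup.map (firstCoord f) (p s₀) α))
        (fun α : FundamentalGroup ↥(H₁ ∩ H₂) (p s₀) =>
          deckTransformation hq₂ ⟨(fhat s₀).2, hfhat₂ s₀⟩
            (FundamentalGroup.map (secondCoord f) (p s₀) α))
        (treeEDist q₁) (treeEDist q₂) t := by
      rintro _ ⟨s, rfl⟩ ⟨Q, ⟨hQ, hlight⟩, hs⟩
      exact hlight (isHeavy_of_lift_mem (F₁ := F₁) (F₂ := F₂) hp hq₁ hq₂ hfhat₁ hfhat₂
        (fun x U hU => hM.handlebody_left.exists_disc x hU) hloc s₀ t hQ hs)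
    refine ⟨hsub, fun t₁ => ⟨?_, ?_⟩, fun t₂ => ⟨?_, ?_⟩⟩
    · obtain ⟨s, hs⟩ := hsurj₁ t₁
      exact ⟨fhat s, hsub ⟨s, rfl⟩, hs⟩
    · exact isPreconnected_fiber_fst (fun Q hQ => hQ.1) t₁
    · obtain ⟨s, hs⟩ := hsurj₂ t₂
      exact ⟨fhat s, hsub ⟨s, rfl⟩, hs⟩
    · exact isPreconnected_fiber_snd (fun Q hQ => hQ.1) t₂
  · rintro A ⟨hA, hA₁, hA₂⟩ ⟨a, b⟩ hab
    by_contra hcon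
    obtain ⟨y₁, hy₁, y₂, hy₂, h⟩ := exists_directions_of_notMem (F₁ := F₁) (F₂ := F₂) hsurj₁
      (fun s => hA ⟨s, rfl⟩) hA₁ hA₂ hcon
    obtain ⟨Q, hQab, hQ, hlight⟩ := exists_light_quadrant (F₁ := F₁) (F₂ := F₂) hp hq₁ hq₂
      hfhat₁ hfhat₂ s₀ t hy₁ hy₂ h
    exact hab ⟨Q, ⟨hQ, hlight⟩, hQab⟩
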